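/- **Setting.** Let $g\in C^0([0,1])$, $p\in C^1([0,1])$, $f\in C^0([0,1]^2)$ be real-valued and consider $$y_t(t,z)+y_z(t,z)=g(z)\,y(t,1)+\int_z^1 f(z,s)\,y(t,s)\,ds,\qquad t\ge 0,\ z\in[0,1], \tag{1}$$ $$y(t,0)=u(t)-\int_0^1 p(s)\,y(t,s)\,ds,\qquad t\ge 0, \tag{2}$$ $$u(t)=u_i\quad\text{for } t\in[\tau_i,\tau_{i+1}),\ i=0,1,2,\dots, \tag{3}$$ where $0=\tau_0<\tau_1<\tau_2<\dots$ and $\tau_i\to\infty$. **Kernels.** A *kernel pair* consists of continuous functions $k,l$ on the triangle $\{0\le z\le s\le 1\}$ which, with $Dk$, $Dl$ denoting derivatives in the direction $(1,1)$ within the triangle (so $D=\partial_z+\partial_s$ for $C^1$ functions), satisfy $$l(z,1)=-g(z),\qquad Dl(z,s)=f(z,s)+\int_z^s f(z,w)\,l(w,s)\,dw,$$ $$k(z,1)=-g(z)+\int_z^1 k(z,s)\,g(s)\,ds,\qquad Dk(z,s)=f(z,s)-\int_z^s k(z,w)\,f(w,s)\,dw,$$ $$l(z,s)=k(z,s)+\int_z^s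 l(z,w)\,k(w,s)\,dw .$$ (At the vertex $(0,1)$, where the line in the direction $(1,1)$ meets the triangle in one point only, no equation for $Dk$, $Dl$ is imposed.) The feedback is $$u_i=\int_0^1\bigl(p(s)+k(0,s)\bigr)\,y(\tau_i,s)\,ds,\qquad i=0,1,2,\dots \tag{4}$$ **Solutions.** Let $y_0\in C^1([0,1])$. A function $\varphi$ on an interval $I$ is piecewise continuous if every compact subset of $I$ contains only finitely many of its discontinuities and all one-sided limits that make sense exist and are finite. A *solution* with initial condition $y_0$ is a function $y:[0,\infty)\times[0,1]\to\mathbb R$ such that - (a) $t\mapsto y(t,z)$ is piecewise continuous and right differentiable on $[0,\infty)$, for every $z\in[0,1]$; - (b) $z\mapsto y(t,z)$ is piecewise continuous and left continuous on $[0,1]$, for every $t\ge0$; - (c) $y$ is continuous on $\{(t,z)\in[0,\infty)\times[0,1]: t-z\ne\tau_i\ \forall i\}$ and of class $C^1$ on $A:=\{(t,z)\in[0,\infty)\times[0,1]: t-z\ne\tau_i,\ t-z\ne 1+\tau_i,\ t\ne 1+\tau_i\ \forall i\}$; - (d) the left derivative of $z\mapsto y(t,z)$ exists and is finite at every $z\in(0,1]$,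 for every $t\ge 0$; - (e) $y_t$ and $y_z$ are bounded on $A\cap([0,r]\times[0,1])$, for every $r>0$; - (f) (1) holds on $A$, (2) and (3) hold, and $y(0,z)=y_0(z)$ for all $z\in(0,1]$. Write $\|w\|_\infty=\sup_{z\in[0,1]}|w(z)|$ and $y[t]=y(t,\cdot)$. Given $k$, say that $(\sigma,T,G)$ is *admissible* if for every $y_0\in C^1([0,1])$ and every sequence $0=\tau_0<\tau_1<\dots$ with $\tau_i\to\infty$ and $\sup_i(\tau_{i+1}-\tau_i)\le T$ the closed loop (1)–(4) with initial condition $y_0$ has a unique solution, and this solution satisfies $$\|y[t]\|_\infty\le G\,e^{-\sigma t}\,\|y_0\|_\infty\qquad\text{for all } t\ge 0 .$$ **Theorem.** A kernel pair exists. For every kernel pair $(k,l)$: 1. For every $\sigma>0$ there are $T,G>0$ such that $(\sigma,T,G)$ is admissible. 2. Let $\tilde k(s)=p(s)+k(0,s)+\int_0^s\bigl(p(w)+k(0,w)\bigr)\,l(w,s)\,dw$. If $f$ and $g$ are of class $C^1$, then $\tilde k\in C^1([0,1])$. Whenever $\tilde k\in C^1([0,1])$, put $M=|\tilde k(1)|+\int_0^1|\tilde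 k'(s)|\,ds$, $a=\tilde k(0)$ and $p_a(T)=\int_0^T e^{-a(T-s)}\,ds$; then for all $\sigma,T>0$ with $M\,p_a(T)\,e^{\sigma(1+T)}<1$ there is $G>0$ such that $(\sigma,T,G)$ is admissible. -/

import Mathlib

open Set Filter Topology MeasureTheory

noncomputable section

/-- `φ` is piecewise continuous on the interval `I`: every compact subset of `I` contains only
finitely many discontinuities of `φ : I → ℝ`, and all one-sided limits that make sense in `I`
exist and are finite (where a one-sided limit makes no sense, the filter is `⊥`). -/
def PiecewiseContOn (φ : ℝ → ℝ) (I : Set ℝ) : Prop :=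
  (∀ K : Set ℝ, K ⊆ I → IsCompact K → {t ∈ K | ¬ ContinuousWithinAt φ I t}.Finite) ∧
  ∀ t ∈ I, (∃ L : ℝ, Tendsto φ (𝓝[I ∩ Ioi t] t) (𝓝 L)) ∧
    (∃ L : ℝ, Tendsto φ (𝓝[I ∩ Iio t] t) (𝓝 L))

/-- The part of `[0,∞) × [0,1]` off the characteristics `t - z = τ i`. -/
def contRegion (τ : ℕ → ℝ) : Set (ℝ × ℝ) :=
  {q | 0 ≤ q.1 ∧ q.2 ∈ Icc (0 : ℝ) 1 ∧ ∀ i, q.1 - q.2 ≠ τ i}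

/-- The part of `[0,∞) × [0,1]` off the characteristics `t - z = τ i`, `t - z = 1 + τ i` and the
lines `t = 1 + τ i`, on which the outlet value `y(t,1)` in the right-hand side may jump. -/
def regRegion (τ : ℕ → ℝ) : Set (ℝ × ℝ) :=
  {q | 0 ≤ q.1 ∧ q.2 ∈ Icc (0 : ℝ) 1 ∧
    ∀ i, q.1 - q.2 ≠ τ i ∧ q.1 - q.2 ≠ 1 + τ i ∧ q.1 ≠ 1 + τ i}

/-- `∂y/∂t` on `[0,∞) × [0,1]` (one-sided at `t = 0`). -/
def partialT (y : ℝ → ℝ → ℝ) (t z : ℝ) : ℝ := derivWithin (fun r => y r z) (Ici 0) t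

/-- `∂y/∂z` on `[0,∞) × [0,1]` (one-sided at `z = 0` and `z = 1`). -/
def partialZ (y : ℝ → ℝ → ℝ) (t z : ℝ) : ℝ := derivWithin (fun r => y t r) (Icc 0 1) z

/-- `y` (its values outside `[0,∞) × [0,1]` are irrelevant) is a solution of
`y_t + y_z = g(z) y(t,1) + ∫_z^1 f(z,s) y(t,s) ds`, `y(t,0) = u(t) - ∫_0^1 p(s) y(t,s) ds`, with
zero-order hold `u(t) = u i` on `[τ i, τ (i+1))` and initial condition `y₀`. -/
structure IsSampledSolution (g p : ℝ → ℝ) (f : ℝ → ℝ → ℝ) (τ u : ℕ → ℝ) (y₀ : ℝ → ℝ)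
    (y : ℝ → ℝ → ℝ) : Prop where
  piecewise_t : ∀ z ∈ Icc (0 : ℝ) 1, PiecewiseContOn (fun t => y t z) (Ici 0)
  right_diff_t : ∀ z ∈ Icc (0 : ℝ) 1, ∀ t, 0 ≤ t →
    ∃ d : ℝ, HasDerivWithinAt (fun r => y r z) d (Ici t) t
  piecewise_z : ∀ t, 0 ≤ t → PiecewiseContOn (y t) (Icc 0 1)
  left_cont_z : ∀ t, 0 ≤ t → ∀ z ∈ Icc (0 : ℝ) 1, ContinuousWithinAt (y t) (Icc 0 z) z
  cont : ContinuousOn (fun q : ℝ × ℝ => y q.1 q.2) (contRegion τ)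
  contDiff : ContDiffOn ℝ 1 (fun q : ℝ × ℝ => y q.1 q.2) (regRegion τ)
  left_diff_z : ∀ t, 0 ≤ t → ∀ z ∈ Ioc (0 : ℝ) 1,
    ∃ d : ℝ, HasDerivWithinAt (y t) d (Icc 0 z) z
  bounded_partials : ∀ r : ℝ, 0 < r → ∃ C : ℝ, ∀ t z : ℝ, (t, z) ∈ regRegion τ → t ≤ r →
    |partialT y t z| ≤ C ∧ |partialZ y t z| ≤ C
  pde : ∀ t z : ℝ, (t, z) ∈ regRegion τ →
    partialT y t z + partialZ y t z = g z * y t 1 + ∫ s in z..1, f z s * y t s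
  boundary : ∀ i : ℕ, ∀ t ∈ Ico (τ i) (τ (i + 1)),
    y t 0 = u i - ∫ s in (0 : ℝ)..1, p s * y t s
  initial : ∀ z ∈ Ioc (0 : ℝ) 1, y 0 z = y₀ z

/-- The triangle `0 ≤ z ≤ s ≤ 1`, on which the Volterra kernels live. -/
def kernelTriangle : Set (ℝ × ℝ) := {q | 0 ≤ q.1 ∧ q.1 ≤ q.2 ∧ q.2 ≤ 1}

/-- The kernels `k`, `l` of the backstepping transformation `x(z) = y(z) - ∫_z^1 k(z,s) y(s) ds`
and of its inverse `y(z) = x(z) + ∫_z^1 l(z,s) x(s) ds`. The equations for `k_z + k_s` and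
`l_z + l_s` are understood through the derivative in the direction `(1,1)` within the triangle;
this is `∂_z + ∂_s` for kernels of class `C¹`, and makes sense when `f`, `g` are only continuous. -/
structure IsKernelPair (g : ℝ → ℝ) (f k l : ℝ → ℝ → ℝ) : Prop where
  cont_k : ContinuousOn (fun q : ℝ × ℝ => k q.1 q.2) kernelTriangle
  cont_l : ContinuousOn (fun q : ℝ × ℝ => l q.1 q.2) kernelTriangle
  l_boundary : ∀ z ∈ Icc (0 : ℝ) 1, l z 1 = -g z
  l_pde : ∀ z s : ℝ, (z, s) ∈ kernelTriangle →
    HasDerivWithinAt (fun h => l (z + h) (s + h))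
      (f z s + ∫ w in z..s, f z w * l w s) (Icc (-z) (1 - s)) 0
  k_boundary : ∀ z ∈ Icc (0 : ℝ) 1, k z 1 = -g z + ∫ s in z..1, k z s * g s
  k_pde : ∀ z s : ℝ, (z, s) ∈ kernelTriangle →
    HasDerivWithinAt (fun h => k (z + h) (s + h))
      (f z s - ∫ w in z..s, k z w * f w s) (Icc (-z) (1 - s)) 0
  inverse : ∀ z s : ℝ, (z, s) ∈ kernelTriangle →
    l z s = k z s + ∫ w in z..s, l z w * k w s

/-- The sampled feedback `u i = ∫_0^1 (p(s) + k(0,s)) y(τ i, s) ds`. -/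
def feedbackInput (p : ℝ → ℝ) (k : ℝ → ℝ → ℝ) (τ : ℕ → ℝ) (y : ℝ → ℝ → ℝ) (i : ℕ) : ℝ :=
  ∫ s in (0 : ℝ)..1, (p s + k 0 s) * y (τ i) s

/-- `y` solves the closed loop. -/
def IsClosedLoopSolution (g p : ℝ → ℝ) (f k : ℝ → ℝ → ℝ) (τ : ℕ → ℝ) (y₀ : ℝ → ℝ)
    (y : ℝ → ℝ → ℝ) : Prop :=
  IsSampledSolution g p f τ (feedbackInput p k τ y) y₀ y

/-- A sampling schedule with all gaps at most `T`. -/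
structure IsSchedule (τ : ℕ → ℝ) (T : ℝ) : Prop where
  strictMono : StrictMono τ
  zero : τ 0 = 0
  gap : ∀ i, τ (i + 1) - τ i ≤ T
  unbounded : Tendsto τ atTop atTop

/-- The sup norm on `[0,1]` (used for continuous, hence bounded, functions). -/
def supNorm (w : ℝ → ℝ) : ℝ := sSup ((fun z => |w z|) '' Icc (0 : ℝ) 1)

/-- For every `C¹` initial datum and every schedule with gaps at most `T`, the closed loop has a
unique solution, and `|y(t,z)| ≤ G e^{-σ t} ‖y₀‖_∞` for all `t ≥ 0` and all `z ∈ [0,1]`. -/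
def ExpStabilized (g p : ℝ → ℝ) (f k : ℝ → ℝ → ℝ) (σ T G : ℝ) : Prop :=
  ∀ (y₀ : ℝ → ℝ) (τ : ℕ → ℝ), ContDiffOn ℝ 1 y₀ (Icc 0 1) → IsSchedule τ T →
    ∃ y : ℝ → ℝ → ℝ, IsClosedLoopSolution g p f k τ y₀ y ∧
      (∀ y' : ℝ → ℝ → ℝ, IsClosedLoopSolution g p f k τ y₀ y' →
        ∀ t, 0 ≤ t → ∀ z ∈ Icc (0 : ℝ) 1, y' t z = y t z) ∧
      ∀ t, 0 ≤ t → ∀ z ∈ Icc (0 : ℝ) 1, |y t z| ≤ G * Real.exp (-σ * t) * supNorm y₀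

/-- The transformed gain `k̃(s) = p(s) + k(0,s) + ∫_0^s (p(w) + k(0,w)) l(w,s) dw`. -/
def kTilde (p : ℝ → ℝ) (k l : ℝ → ℝ → ℝ) (s : ℝ) : ℝ :=
  p s + k 0 s + ∫ w in (0 : ℝ)..s, (p w + k 0 w) * l w s

/-- `M = |k̃(1)| + ∫_0^1 |k̃'(s)| ds`. -/
def gainM (κ : ℝ → ℝ) : ℝ := |κ 1| + ∫ s in (0 : ℝ)..1, |derivWithin κ (Icc 0 1) s|

/-- `p_a(t) = ∫_0^t exp(-a (t - s)) ds`. -/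
def expIntegral (a t : ℝ) : ℝ := ∫ s in (0 : ℝ)..t, Real.exp (-a * (t - s))

end

/-! The backstepping transformation x(t,z) = y(t,z) - ∫_z^1 k(z,s) y(t,s) ds turns the equation into
pure transport x_t + x_z = 0. Hence x(t,z) = v(t-z) with v(t) = x(t,0), and y = x + ∫ l x is
recovered from v alone (`charSolution`). With the feedback inserted, the inlet condition becomes a
scalar delay equation with κ = k̃: on [τ_i, τ_{i+1}), v(t) + ∫_0^1 κ(s) v(t-s) ds = ∫_0^1 κ(s)
v(τ_i-s) ds.

Decay. By this equation v(t) is minus the change of ∫ κ(s) v(·-s) ds over a time of length at most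
T. If |v| ≤ N on [τ_i-1, t], then |v(t)| ≤ γN. Here γ can be made small with T because κ is
uniformly continuous (`exists_isContraction`), and γ = M p_a(T) works for C¹ gains by variation of
constants (`isContraction_of_contDiffOn`). The window reaches back by at most 1+T, so γ e^{σ(1+T)} <
1 yields the rate σ (`abs_le_exp_of_contraction`). Bounded kernels carry the decay over to y.

Existence. The delay equation is solved by superposition: a free response continuing the transformed
initial datum, plus one multiple of a shifted step response per sampling instant
(`exists_inletData`). The result is a finite sum of steps plus a primitive whose derivative jumps
only at τ_j and 1+τ_j. These are the characteristics on which y may be singular; the lines t = 1+τ_j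
come from the jumps of y(t,1) = v(t-1) (`pieceRegular_profile`). The equation for y follows by
differentiating `charSolution` along characteristics (`KernelData.fderiv_diag`).

Uniqueness does not use the transformation. The difference of two solutions is integrated along
characteristics, and in the weight e^{λt+μ(1-z)} its bound implies itself with half the constant
(`IsHomogeneous.eq_zero`).

Kernels. In the coordinates (z, r) with r = s-z, the derivative in the direction (1,1) is ∂_z at
fixed r, and Volterra products become an associative composition `kcomp`. The kernel equations
integrate to fixed point problems that contract in a weight e^{-λr}. The relation l = k + l∘k holds
because its defect m solves the homogeneous problem ∂_z m = f∘m - m∘f, with m = m∘g at s = 1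
(`eq_zero_of_kernelOp`). Associativity also gives l = k + k∘l, which eliminates k from the gain: k̃
= p + l(0,·) + ∫ p l. -/

/-! ### Functions with finitely many jumps, their primitives and convolutions -/

/-- A function of two variables with continuous partial derivatives is of class `C¹`. -/
theorem contDiff_one_of_partials {E₁ E₂ F : Type*} [NormedAddCommGroup E₁] [NormedSpace ℝ E₁]
    [NormedAddCommGroup E₂] [NormedSpace ℝ E₂] [NormedAddCommGroup F] [NormedSpace ℝ F]
    {f : E₁ × E₂ → F} {f₁ : E₁ × E₂ → E₁ →L[ℝ] F} {f₂ : E₁ × E₂ → E₂ →L[ℝ] F}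
    (h₁ : ∀ v : E₁ × E₂, HasFDerivAt (fun x => f (x, v.2)) (f₁ v) v.1)
    (h₂ : ∀ v : E₁ × E₂, HasFDerivAt (fun x => f (v.1, x)) (f₂ v) v.2)
    (c₁ : Continuous f₁) (c₂ : Continuous f₂) : ContDiff ℝ 1 f := by
  rw [contDiff_one_iff_hasFDerivAt]
  refine ⟨fun u => (f₁ u).coprod (f₂ u), ?_, fun u => ?_⟩
  · exact (ContinuousLinearMap.coprodEquivL (E := E₁) (F := E₂) (G := F) ℝ).continuous.comp
      (c₁.prodMk c₂)
  · have := hasStrictFDerivAt_uncurry_coprod (𝕜 := ℝ) (u := u) (f := fun x y => f (x, y))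
      (f₁ := fun x y => f₁ (x, y)) (f₂ := fun x y => f₂ (x, y))
      (Eventually.of_forall fun v => h₁ v) (Eventually.of_forall fun v => h₂ v)
      c₁.continuousAt c₂.continuousAt
    exact this.hasFDerivAt

/-- Three continuous scalar partial derivatives give class `C¹`. -/
theorem contDiff_one_of_three_partials {f f₁ f₂ f₃ : ℝ × ℝ × ℝ → ℝ}
    (h₁ : ∀ x y z, HasDerivAt (fun x => f (x, y, z)) (f₁ (x, y, z)) x)
    (h₂ : ∀ x y z, HasDerivAt (fun y => f (x, y, z)) (f₂ (x, y, z)) y)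
    (h₃ : ∀ x y z, HasDerivAt (fun z => f (x, y, z)) (f₃ (x, y, z)) z)
    (c₁ : Continuous f₁) (c₂ : Continuous f₂) (c₃ : Continuous f₃) : ContDiff ℝ 1 f := by
  have sm : Continuous fun c : ℝ => ContinuousLinearMap.toSpanSingleton ℝ c :=
    (ContinuousLinearMap.toSpanSingletonCLE (𝕜 := ℝ) (E := ℝ)).continuous
  refine contDiff_one_of_partials
    (f₁ := fun u => ContinuousLinearMap.toSpanSingleton ℝ (f₁ u))
    (f₂ := fun u => (ContinuousLinearMap.toSpanSingleton ℝ (f₂ u)).coprod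
      (ContinuousLinearMap.toSpanSingleton ℝ (f₃ u)))
    (fun v => (h₁ v.1 v.2.1 v.2.2).hasFDerivAt) (fun v => ?_) (sm.comp c₁) ?_
  · exact (hasStrictFDerivAt_uncurry_coprod (𝕜 := ℝ) (u := v.2) (f := fun y z => f (v.1, y, z))
      (f₁ := fun y z => ContinuousLinearMap.toSpanSingleton ℝ (f₂ (v.1, y, z)))
      (f₂ := fun y z => ContinuousLinearMap.toSpanSingleton ℝ (f₃ (v.1, y, z)))
      (Eventually.of_forall fun w => (h₂ v.1 w.1 w.2).hasFDerivAt)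
      (Eventually.of_forall fun w => (h₃ v.1 w.1 w.2).hasFDerivAt)
      (sm.comp (c₂.comp (by fun_prop))).continuousAt
      (sm.comp (c₃.comp (by fun_prop))).continuousAt).hasFDerivAt
  · exact (ContinuousLinearMap.coprodEquivL (E := ℝ) (F := ℝ) (G := ℝ) ℝ).continuous.comp
      ((sm.comp c₂).prodMk (sm.comp c₃))

/-- A locally bounded measurable function, continuous off the finite set `C`, and right continuous
everywhere. -/
structure PiecewiseCont (b : ℝ → ℝ) (C : Set ℝ) : Prop where
  meas : Measurable b
  bdd : ∀ R : ℝ, ∃ M : ℝ, ∀ x, |x| ≤ R → |b x| ≤ M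
  fin : C.Finite
  cont : ∀ x ∉ C, ContinuousAt b x
  rcont : ∀ x, ContinuousWithinAt b (Ici x) x

namespace PiecewiseCont

variable {b b' : ℝ → ℝ} {C C' : Set ℝ}

theorem of_continuous (h : Continuous b) : PiecewiseCont b ∅ where
  meas := h.measurable
  bdd R := by
    obtain ⟨M, hM⟩ := (isCompact_Icc (a := -R) (b := R)).exists_bound_of_continuousOn h.continuousOn
    exact ⟨M, fun x hx => hM x (abs_le.mp hx)⟩
  fin := finite_empty
  cont x _ := h.continuousAt
  rcont x := h.continuousWithinAt

theorem mono (h : PiecewiseCont b C) (hC : C ⊆ C') (hf : C'.Finite) : PiecewiseCont b C' :=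
  ⟨h.meas, h.bdd, hf, fun x hx => h.cont x fun h' => hx (hC h'), h.rcont⟩

theorem add (h : PiecewiseCont b C) (h' : PiecewiseCont b' C') :
    PiecewiseCont (fun x => b x + b' x) (C ∪ C') where
  meas := h.meas.add h'.meas
  bdd R := by
    obtain ⟨M, hM⟩ := h.bdd R
    obtain ⟨M', hM'⟩ := h'.bdd R
    exact ⟨M + M', fun x hx => (abs_add_le _ _).trans (add_le_add (hM x hx) (hM' x hx))⟩
  fin := h.fin.union h'.fin
  cont x hx := by
    rw [mem_union, not_or] at hx
    exact (h.cont x hx.1).add (h'.cont x hx.2)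
  rcont x := (h.rcont x).add (h'.rcont x)

theorem const_mul (h : PiecewiseCont b C) (a : ℝ) : PiecewiseCont (fun x => a * b x) C where
  meas := h.meas.const_mul a
  bdd R := by
    obtain ⟨M, hM⟩ := h.bdd R
    refine ⟨|a| * M, fun x hx => ?_⟩
    rw [abs_mul]
    exact mul_le_mul_of_nonneg_left (hM x hx) (abs_nonneg a)
  fin := h.fin
  cont x hx := (h.cont x hx).const_mul a
  rcont x := (h.rcont x).const_mul a

theorem sum {ι : Type*} (s : Finset ι) {b : ι → ℝ → ℝ} {C : ι → Set ℝ}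
    (h : ∀ i ∈ s, PiecewiseCont (b i) (C i)) :
    PiecewiseCont (fun x => ∑ i ∈ s, b i x) (⋃ i ∈ s, C i) := by
  classical
  induction s using Finset.induction_on with
  | empty => simpa using of_continuous continuous_const
  | insert a s ha ih =>
    simp only [Finset.sum_insert ha, Finset.set_biUnion_insert]
    exact (h a (Finset.mem_insert_self a s)).add
      (ih fun i hi => h i (Finset.mem_insert_of_mem hi))

theorem indicator_Ici {a : ℝ → ℝ} (ha : Continuous a) (θ : ℝ) :
    PiecewiseCont ((Ici θ).indicator a) {θ} where
  meas := ha.measurable.indicator measurableSet_Ici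
  bdd R := by
    obtain ⟨M, hM⟩ := (of_continuous ha).bdd R
    refine ⟨M, fun x hx => ?_⟩
    by_cases h : x ∈ Ici θ
    · simpa [indicator_of_mem h] using hM x hx
    · simpa [indicator_of_notMem h] using (abs_nonneg _).trans (hM x hx)
  fin := finite_singleton θ
  cont x hx := by
    rcases lt_or_gt_of_ne (show x ≠ θ from hx) with h | h
    · refine continuousAt_const (y := (0 : ℝ)) |>.congr ?_
      filter_upwards [gt_mem_nhds h] with y hy
      rw [indicator_of_notMem (by simpa using hy)]
    · refine ha.continuousAt.congr ?_
      filter_upwards [lt_mem_nhds h] with y hy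
      rw [indicator_of_mem (by simpa using (le_of_lt hy))]
  rcont x := by
    rcases lt_or_ge x θ with h | h
    · refine (continuousAt_const (y := (0 : ℝ)) |>.congr ?_).continuousWithinAt
      filter_upwards [gt_mem_nhds h] with y hy
      rw [indicator_of_notMem (by simpa using hy)]
    · refine ha.continuousWithinAt.congr (fun y hy => ?_) ?_
      · rw [indicator_of_mem (show y ∈ Ici θ from h.trans hy)]
      · rw [indicator_of_mem (show x ∈ Ici θ from h)]

theorem comp_sub (h : PiecewiseCont b C) (c : ℝ) :
    PiecewiseCont (fun x => b (x - c)) ((fun x => x + c) '' C) where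
  meas := h.meas.comp (measurable_id.sub_const c)
  bdd R := by
    obtain ⟨M, hM⟩ := h.bdd (R + |c|)
    exact ⟨M, fun x hx => hM _ ((abs_sub x c).trans (by linarith))⟩
  fin := h.fin.image _
  cont x hx := by
    have : x - c ∉ C := fun h' => hx ⟨x - c, h', by simp⟩
    exact ContinuousAt.comp (f := fun x => x - c) (h.cont _ this) (by fun_prop)
  rcont x := by
    refine ContinuousWithinAt.comp (f := fun x => x - c) (t := Ici (x - c)) (h.rcont (x - c))
      (by fun_prop) fun y hy => ?_
    simpa using hy

theorem intervalIntegrable (h : PiecewiseCont b C) (x y : ℝ) : IntervalIntegrable b volume x y := by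
  obtain ⟨M, hM⟩ := h.bdd (max |x| |y|)
  rw [intervalIntegrable_iff]
  refine Measure.integrableOn_of_bounded (M := M) ?_ h.meas.aestronglyMeasurable ?_
  · simp [uIoc]
  · filter_upwards [ae_restrict_mem measurableSet_uIoc] with t ht
    refine hM t ?_
    rcases le_total x y with hxy | hxy
    · rw [uIoc_of_le hxy] at ht
      exact abs_le_max_abs_abs ht.1.le ht.2
    · rw [uIoc_of_ge hxy] at ht
      rw [max_comm]
      exact abs_le_max_abs_abs ht.1.le ht.2

theorem ae_continuousAt_sub (h : PiecewiseCont b C) (c : ℝ) :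
    ∀ᵐ r : ℝ, ContinuousAt b (c - r) := by
  have : ((fun x => c - x) '' C).Countable := (h.fin.image _).countable
  filter_upwards [this.ae_notMem volume] with r hr
  exact h.cont _ fun h' => hr ⟨c - r, h', by simp⟩

theorem meas_comp_sub (h : PiecewiseCont b C) (c : ℝ) : Measurable fun r => b (c - r) :=
  h.meas.comp (measurable_const.sub measurable_id)

theorem bdd_comp_sub (h : PiecewiseCont b C) (R : ℝ) :
    ∃ M, 0 ≤ M ∧ ∀ c r, |c| ≤ R → |r| ≤ R → |b (c - r)| ≤ M := by
  obtain ⟨M, hM⟩ := h.bdd (2 * R)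
  exact ⟨|M|, abs_nonneg _, fun c r hc hr =>
    (hM _ ((abs_sub c r).trans (by linarith))).trans (le_abs_self M)⟩

theorem intervalIntegrable_comp_sub (h : PiecewiseCont b C) (c x y : ℝ) :
    IntervalIntegrable (fun r => b (c - r)) volume x y := by
  simpa using (h.intervalIntegrable (c - x) (c - y)).comp_sub_left c

end PiecewiseCont

theorem abs_le_of_mem_uIoc {ρ r R : ℝ} (hr : r ∈ uIoc 0 ρ) (h : |ρ| ≤ R) : |r| ≤ R := by
  rcases le_total 0 ρ with h0 | h0
  · rw [uIoc_of_le h0] at hr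
    rw [abs_of_pos hr.1]
    exact hr.2.trans ((le_abs_self ρ).trans h)
  · rw [uIoc_of_ge h0] at hr
    rw [abs_of_nonpos hr.2]
    have := neg_abs_le ρ
    linarith [hr.1]

/-- Continuity of `(c, z, ρ) ↦ ∫_0^ρ G(z,r) b(c-r) dr` for piecewise continuous `b`. -/
theorem continuous_conv {b : ℝ → ℝ} {C : Set ℝ} (hb : PiecewiseCont b C) {G : ℝ → ℝ → ℝ}
    (hG : Continuous fun q : ℝ × ℝ => G q.1 q.2) :
    Continuous fun q : ℝ × ℝ × ℝ => ∫ r in (0 : ℝ)..q.2.2, G q.2.1 r * b (q.1 - r) := by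
  rw [continuous_iff_continuousAt]
  rintro ⟨c, z, ρ⟩
  set R : ℝ := max |c| (max |z| |ρ|) + 1 with hR
  have hcR : |c| < R := by rw [hR]; exact lt_add_of_le_of_pos (le_max_left _ _) one_pos
  have hzR : |z| < R := by
    rw [hR]; exact lt_add_of_le_of_pos ((le_max_left _ _).trans (le_max_right _ _)) one_pos
  have hρR : |ρ| < R := by
    rw [hR]; exact lt_add_of_le_of_pos ((le_max_right _ _).trans (le_max_right _ _)) one_pos
  have hR0 : 0 < R := (abs_nonneg c).trans_lt hcR
  obtain ⟨M, hM0, hM⟩ := hb.bdd_comp_sub R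
  obtain ⟨K, hK⟩ := ((isCompact_Icc (a := -R) (b := R)).prod
    (isCompact_Icc (a := -R) (b := R))).exists_bound_of_continuousOn hG.continuousOn
  have hK0 : 0 ≤ K := (norm_nonneg _).trans
    (hK (0, 0) ⟨⟨by simpa using hR0.le, hR0.le⟩, ⟨by simpa using hR0.le, hR0.le⟩⟩)
  have key : ContinuousAt (fun p : (ℝ × ℝ) × ℝ =>
      ∫ r in (0 : ℝ)..p.2, G p.1.2 r * b (p.1.1 - r)) ((c, z), ρ) := by
    refine intervalIntegral.continuousAt_parametric_primitive_of_dominated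
      (F := fun (x : ℝ × ℝ) r => G x.2 r * b (x.1 - r)) (fun _ => K * M) (-R) R ?_ ?_ ?_ ?_ ?_ ?_ ?_
    · intro x
      exact ((by fun_prop : Continuous fun r => G x.2 r).measurable.mul
        (hb.meas_comp_sub x.1)).aestronglyMeasurable
    · have h1 : ∀ᶠ x : ℝ × ℝ in 𝓝 (c, z), |x.1| < R :=
        (continuous_fst.abs.tendsto (c, z)).eventually_lt_const hcR
      have h2 : ∀ᶠ x : ℝ × ℝ in 𝓝 (c, z), |x.2| < R :=
        (continuous_snd.abs.tendsto (c, z)).eventually_lt_const hzR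
      filter_upwards [h1, h2] with x hx1 hx2
      filter_upwards [ae_restrict_mem measurableSet_uIoc] with r hr
      rw [uIoc_of_le (by linarith)] at hr
      have hr' : |r| ≤ R := abs_le.mpr ⟨hr.1.le, hr.2⟩
      rw [norm_mul]
      exact mul_le_mul (hK (x.2, r) ⟨abs_le.mp hx2.le, abs_le.mp hr'⟩)
        (hM _ _ hx1.le hr') (norm_nonneg _) hK0
    · exact intervalIntegrable_const
    · refine ae_restrict_of_ae ?_
      filter_upwards [hb.ae_continuousAt_sub c] with r hr
      refine ContinuousAt.mul (by fun_prop) ?_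
      exact ContinuousAt.comp (f := fun x : ℝ × ℝ => x.1 - r) (x := (c, z)) hr (by fun_prop)
    · exact ⟨by linarith, hR0⟩
    · exact abs_lt.mp hρR
    · simp
  exact ContinuousAt.comp (f := fun q : ℝ × ℝ × ℝ => ((q.1, q.2.1), q.2.2)) (x := (c, z, ρ))
    key (by fun_prop)

/-- `B` is a primitive of the piecewise continuous function `b`. -/
structure IsPrimitive (B b : ℝ → ℝ) (C : Set ℝ) : Prop where
  pc : PiecewiseCont b C
  eq : ∀ c, B c = B 0 + ∫ s in (0 : ℝ)..c, b s

namespace IsPrimitive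

variable {B b B' b' : ℝ → ℝ} {C C' : Set ℝ}

theorem sub_eq (h : IsPrimitive B b C) (x y : ℝ) : B y - B x = ∫ s in x..y, b s := by
  rw [h.eq y, h.eq x, ← intervalIntegral.integral_add_adjacent_intervals
    (h.pc.intervalIntegrable 0 x) (h.pc.intervalIntegrable x y)]
  ring

theorem hasDerivAt (h : IsPrimitive B b C) {c : ℝ} (hc : c ∉ C) : HasDerivAt B (b c) c := by
  have := (intervalIntegral.integral_hasDerivAt_right (h.pc.intervalIntegrable 0 c)
    h.pc.meas.stronglyMeasurable.stronglyMeasurableAtFilter (h.pc.cont c hc)).const_add (B 0)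
  exact this.congr_of_eventuallyEq (Eventually.of_forall h.eq)

theorem hasDerivWithinAt_Ici (h : IsPrimitive B b C) (c : ℝ) :
    HasDerivWithinAt B (b c) (Ici c) c := by
  have := (intervalIntegral.integral_hasDerivWithinAt_right (s := Ici c) (t := Ioi c)
    (h.pc.intervalIntegrable 0 c)
    h.pc.meas.stronglyMeasurable.stronglyMeasurableAtFilter
    ((h.pc.rcont c).mono Ioi_subset_Ici_self)).const_add (B 0)
  exact this.congr (fun y _ => h.eq y) (h.eq c)

theorem abs_sub_le (h : IsPrimitive B b C) {R M : ℝ} (hM : ∀ x, |x| ≤ R → |b x| ≤ M) {x y : ℝ}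
    (hx : |x| ≤ R) (hy : |y| ≤ R) : |B y - B x| ≤ M * |y - x| := by
  rw [h.sub_eq x y]
  refine intervalIntegral.norm_integral_le_of_norm_le_const (f := b) fun t ht => hM t ?_
  rcases le_total x y with hxy | hxy
  · rw [uIoc_of_le hxy] at ht
    exact abs_le.mpr ⟨by linarith [(abs_le.mp hx).1, ht.1], ht.2.trans (abs_le.mp hy).2⟩
  · rw [uIoc_of_ge hxy] at ht
    exact abs_le.mpr ⟨by linarith [(abs_le.mp hy).1, ht.1], ht.2.trans (abs_le.mp hx).2⟩

theorem continuous (h : IsPrimitive B b C) : Continuous B := by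
  have : Continuous fun c => B 0 + ∫ s in (0 : ℝ)..c, b s :=
    continuous_const.add (intervalIntegral.continuous_primitive h.pc.intervalIntegrable 0)
  exact (funext h.eq : B = _) ▸ this

theorem contDiffAt (h : IsPrimitive B b C) {c : ℝ} (hc : c ∉ C) : ContDiffAt ℝ 1 B c := by
  have hopen : IsOpen Cᶜ := h.pc.fin.isClosed.isOpen_compl
  have : ContDiffOn ℝ 1 B Cᶜ := by
    have hd : ∀ x ∈ Cᶜ, HasDerivAt B (b x) x := fun x hx => h.hasDerivAt hx
    rw [show (1 : WithTop ℕ∞) = 0 + 1 by simp, contDiffOn_succ_iff_deriv_of_isOpen hopen]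
    refine ⟨fun x hx => (hd x hx).differentiableAt.differentiableWithinAt, by simp, ?_⟩
    rw [contDiffOn_zero]
    exact ContinuousOn.congr (fun x hx => (h.pc.cont x hx).continuousWithinAt)
      fun x hx => (hd x hx).deriv
  exact this.contDiffAt (hopen.mem_nhds hc)

theorem of_hasDerivAt (hb : Continuous b) (h : ∀ x, HasDerivAt B (b x) x) : IsPrimitive B b ∅ where
  pc := .of_continuous hb
  eq c := by
    rw [intervalIntegral.integral_eq_sub_of_hasDerivAt (fun x _ => h x) (hb.intervalIntegrable _ _)]
    ring

theorem add (h : IsPrimitive B b C) (h' : IsPrimitive B' b' C') :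
    IsPrimitive (fun x => B x + B' x) (fun x => b x + b' x) (C ∪ C') where
  pc := h.pc.add h'.pc
  eq c := by
    rw [intervalIntegral.integral_add (h.pc.intervalIntegrable _ _) (h'.pc.intervalIntegrable _ _),
      h.eq c, h'.eq c]
    ring

theorem const_mul (h : IsPrimitive B b C) (a : ℝ) :
    IsPrimitive (fun x => a * B x) (fun x => a * b x) C where
  pc := h.pc.const_mul a
  eq c := by rw [intervalIntegral.integral_const_mul, h.eq c]; ring

theorem sum {ι : Type*} (s : Finset ι) {B b : ι → ℝ → ℝ} {C : ι → Set ℝ}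
    (h : ∀ i ∈ s, IsPrimitive (B i) (b i) (C i)) :
    IsPrimitive (fun x => ∑ i ∈ s, B i x) (fun x => ∑ i ∈ s, b i x) (⋃ i ∈ s, C i) where
  pc := .sum s fun i hi => (h i hi).pc
  eq c := by
    rw [intervalIntegral.integral_finsetSum fun i hi => (h i hi).pc.intervalIntegrable _ _,
      ← Finset.sum_add_distrib]
    exact Finset.sum_congr rfl fun i hi => (h i hi).eq c

theorem comp_sub (h : IsPrimitive B b C) (a : ℝ) :
    IsPrimitive (fun x => B (x - a)) (fun x => b (x - a)) ((fun x => x + a) '' C) where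
  pc := h.pc.comp_sub a
  eq c := by
    rw [intervalIntegral.integral_comp_sub_right (fun x => b x), ← h.sub_eq]
    ring

end IsPrimitive

/-- The derivative of a convolution falls on the factor that is a primitive. -/
theorem hasDerivAt_conv {B b : ℝ → ℝ} {C : Set ℝ} (h : IsPrimitive B b C) {G : ℝ → ℝ}
    (hG : Continuous G) (ρ c : ℝ) :
    HasDerivAt (fun c => ∫ r in (0 : ℝ)..ρ, G r * B (c - r))
      (∫ r in (0 : ℝ)..ρ, G r * b (c - r)) c := by
  set R : ℝ := max |c| |ρ| + 1 with hR
  have hcR : |c| < R := by rw [hR]; exact lt_add_of_le_of_pos (le_max_left _ _) one_pos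
  have hρR : |ρ| ≤ R := by rw [hR]; exact (le_max_right _ _).trans (by linarith)
  obtain ⟨M, hM⟩ := h.pc.bdd (2 * R)
  have hBc := h.continuous
  refine (intervalIntegral.hasDerivAt_integral_of_dominated_loc_of_lip
    (s := Ioo (-R) R) (bound := fun r => |G r| * M) ?_ ?_ ?_ ?_ ?_ ?_ ?_).2
  · exact isOpen_Ioo.mem_nhds (abs_lt.mp hcR)
  · exact Eventually.of_forall fun x =>
      (by fun_prop : Continuous fun r => G r * B (x - r)).aestronglyMeasurable
  · exact (by fun_prop : Continuous fun r => G r * B (c - r)).intervalIntegrable _ _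
  · exact (hG.measurable.mul (h.pc.meas_comp_sub c)).aestronglyMeasurable
  -- A primitive of a locally bounded function is locally Lipschitz, which gives the domination; it
  -- is differentiable at c - r for almost every r, which suffices under the integral.
  · refine Eventually.of_forall fun r hr => LipschitzOnWith.of_dist_le_mul fun x hx y hy => ?_
    have hr' := abs_le_of_mem_uIoc hr hρR
    have e1 : |x - r| ≤ 2 * R := (abs_sub x r).trans (by linarith [(abs_lt.mpr hx)])
    have e2 : |y - r| ≤ 2 * R := (abs_sub y r).trans (by linarith [(abs_lt.mpr hy)])
    have := h.abs_sub_le hM e2 e1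
    rw [Real.dist_eq, Real.dist_eq, ← mul_sub, abs_mul, Real.coe_nnabs, abs_mul, abs_abs, mul_assoc]
    refine mul_le_mul_of_nonneg_left (this.trans ?_) (abs_nonneg _)
    rw [sub_sub_sub_cancel_right]
    exact mul_le_mul_of_nonneg_right (le_abs_self M) (abs_nonneg _)
  · exact (hG.abs.mul continuous_const).intervalIntegrable _ _
  · have : ((fun x => c - x) '' C).Countable := (h.pc.fin.image _).countable
    filter_upwards [this.ae_notMem volume] with r hr _
    have hr' : c - r ∉ C := fun h' => hr ⟨c - r, h', by simp⟩
    exact ((h.hasDerivAt hr').comp_sub_const c r).const_mul (G r)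

/-! ### Kernels differentiable along characteristics -/

/-- A kernel in the coordinates `(z, s - z)` together with its derivative in the first one. -/
structure SmoothKernel (Γ D : ℝ → ℝ → ℝ) : Prop where
  cont : Continuous fun q : ℝ × ℝ => Γ q.1 q.2
  cont_deriv : Continuous fun q : ℝ × ℝ => D q.1 q.2
  hasDerivAt : ∀ z r, HasDerivAt (fun z => Γ z r) (D z r) z

theorem SmoothKernel.hasDerivAt_integral {Γ D : ℝ → ℝ → ℝ} (h : SmoothKernel Γ D) {w : ℝ → ℝ}
    (hw : Measurable w) (hb : ∀ R : ℝ, ∃ M : ℝ, ∀ x, |x| ≤ R → |w x| ≤ M) (z ρ : ℝ) :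
    HasDerivAt (fun z => ∫ r in (0 : ℝ)..ρ, Γ z r * w r) (∫ r in (0 : ℝ)..ρ, D z r * w r) z := by
  have hc := h.cont
  have hd := h.cont_deriv
  obtain ⟨M, hM⟩ := hb |ρ|
  obtain ⟨K, hK⟩ := ((isCompact_Icc (a := z - 1) (b := z + 1)).prod
    (isCompact_Icc (a := -|ρ|) (b := |ρ|))).exists_bound_of_continuousOn hd.continuousOn
  have hwi : IntervalIntegrable w volume 0 ρ := by
    rw [intervalIntegrable_iff]
    refine Measure.integrableOn_of_bounded (M := M) (by simp [uIoc]) hw.aestronglyMeasurable ?_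
    filter_upwards [ae_restrict_mem measurableSet_uIoc] with t ht
    exact hM t (abs_le_of_mem_uIoc ht le_rfl)
  refine (intervalIntegral.hasDerivAt_integral_of_dominated_loc_of_deriv_le
    (F' := fun z r => D z r * w r)
    (s := Ioo (z - 1) (z + 1)) (bound := fun r => K * |w r|) ?_ ?_ ?_ ?_ ?_ ?_ ?_).2
  · exact isOpen_Ioo.mem_nhds ⟨by linarith, by linarith⟩
  · exact Eventually.of_forall fun x =>
      ((by fun_prop : Continuous fun r => Γ x r).measurable.mul hw).aestronglyMeasurable
  · exact hwi.continuousOn_mul (by fun_prop : Continuous fun r => Γ z r).continuousOn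
  · exact ((by fun_prop : Continuous fun r => D z r).measurable.mul hw).aestronglyMeasurable
  · refine Eventually.of_forall fun r hr x hx => ?_
    rw [norm_mul]
    exact mul_le_mul_of_nonneg_right
      (hK (x, r) ⟨⟨hx.1.le, hx.2.le⟩, abs_le.mp (abs_le_of_mem_uIoc hr le_rfl)⟩) (norm_nonneg _)
  · exact hwi.abs.const_mul K
  · exact Eventually.of_forall fun r _ x _ => (h.hasDerivAt x r).mul_const _

/-- The derivative in c falls on the primitive, the one in z on the kernel, the one in ρ on the
upper limit. All three are continuous although `b` jumps, because `b` occurs only under an integral.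
-/
theorem SmoothKernel.contDiff_conv {Γ D : ℝ → ℝ → ℝ} (hΓ : SmoothKernel Γ D) {B b : ℝ → ℝ}
    {C : Set ℝ} (h : IsPrimitive B b C) :
    ContDiff ℝ 1 fun q : ℝ × ℝ × ℝ => ∫ r in (0 : ℝ)..q.2.2, Γ q.2.1 r * B (q.1 - r) := by
  have hc := hΓ.cont
  have hB := h.continuous
  refine contDiff_one_of_three_partials
    (f₁ := fun q => ∫ r in (0 : ℝ)..q.2.2, Γ q.2.1 r * b (q.1 - r))
    (f₂ := fun q => ∫ r in (0 : ℝ)..q.2.2, D q.2.1 r * B (q.1 - r))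
    (f₃ := fun q => Γ q.2.1 q.2.2 * B (q.1 - q.2.2)) ?_ ?_ ?_ ?_ ?_ ?_
  · exact fun c z ρ => hasDerivAt_conv h (by fun_prop : Continuous fun r => Γ z r) ρ c
  · intro c z ρ
    have hcont : Continuous fun r => B (c - r) := by fun_prop
    exact hΓ.hasDerivAt_integral hcont.measurable (PiecewiseCont.of_continuous hcont).bdd z ρ
  · intro c z ρ
    have hcont : Continuous fun r => Γ z r * B (c - r) := by fun_prop
    exact intervalIntegral.integral_hasDerivAt_right (hcont.intervalIntegrable _ _)
      (hcont.stronglyMeasurableAtFilter _ _) hcont.continuousAt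
  · exact continuous_conv h.pc hc
  · exact continuous_conv (.of_continuous hB) hΓ.cont_deriv
  · fun_prop

/-- Differentiation of `h ↦ ∫_0^{a-h} Γ(z+h,r) w(r) dr` at `h = 0`. -/
theorem SmoothKernel.hasDerivAt_shift {Γ D : ℝ → ℝ → ℝ} (hΓ : SmoothKernel Γ D) {w : ℝ → ℝ}
    {C : Set ℝ} (hw : PiecewiseCont w C) (z a c : ℝ) (ha : c - a ∉ C) :
    HasDerivAt (fun h => ∫ r in (0 : ℝ)..a - h, Γ (z + h) r * w (c - r))
      (-(Γ z a * w (c - a)) + ∫ r in (0 : ℝ)..a, D z r * w (c - r)) 0 := by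
  have hc := hΓ.cont
  have hmeas := hw.meas_comp_sub c
  have hbdd : ∀ R : ℝ, ∃ M : ℝ, ∀ x, |x| ≤ R → |w (c - x)| ≤ M := fun R => by
    obtain ⟨M, -, hM⟩ := hw.bdd_comp_sub (max |c| R)
    exact ⟨M, fun x hx => hM c x (le_max_left _ _) (hx.trans (le_max_right _ _))⟩
  have hnear : ∀ᶠ ρ in 𝓝 a, c - ρ ∉ C := by
    have : Tendsto (fun ρ => c - ρ) (𝓝 a) (𝓝 (c - a)) :=
      Continuous.tendsto (by fun_prop) a
    exact this.eventually (hw.fin.isClosed.isOpen_compl.mem_nhds ha)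
  have hcw : ∀ ρ, c - ρ ∉ C → ContinuousAt (fun r => w (c - r)) ρ := fun ρ hρ =>
    ContinuousAt.comp (f := fun r => c - r) (hw.cont _ hρ) (by fun_prop)
  have sm : Continuous fun c : ℝ => ContinuousLinearMap.toSpanSingleton ℝ c :=
    (ContinuousLinearMap.toSpanSingletonCLE (𝕜 := ℝ) (E := ℝ)).continuous
  -- The two roles of h, in the kernel and in the upper limit, are separated into independent
  -- variables (h, ρ). Partial derivatives near (0, a) that are continuous at that one point
  -- suffice, so `w` may jump anywhere except at c - a.
  have key := (hasStrictFDerivAt_uncurry_coprod (𝕜 := ℝ) (u := ((0 : ℝ), a))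
    (f := fun h ρ => ∫ r in (0 : ℝ)..ρ, Γ (z + h) r * w (c - r))
    (f₁ := fun h ρ => ContinuousLinearMap.toSpanSingleton ℝ
      (∫ r in (0 : ℝ)..ρ, D (z + h) r * w (c - r)))
    (f₂ := fun h ρ => ContinuousLinearMap.toSpanSingleton ℝ (Γ (z + h) ρ * w (c - ρ)))
    (Eventually.of_forall fun v => ?_) ?_ ?_ ?_).hasFDerivAt
  · have hg : HasDerivAt (fun h : ℝ => (h, a - h)) ((1 : ℝ), (-1 : ℝ)) 0 :=
      (hasDerivAt_id (0 : ℝ)).prodMk ((hasDerivAt_id (0 : ℝ)).const_sub a)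
    have key' := HasFDerivAt.comp_hasDerivAt_of_eq (0 : ℝ) key hg (by simp)
    refine key'.congr_deriv ?_
    simp [Function.HasUncurry.uncurry]
    ring
  · have := (hΓ.hasDerivAt_integral hmeas hbdd (z + v.1) v.2)
    exact (this.comp_const_add z v.1).hasFDerivAt
  · have hev : ∀ᶠ v : ℝ × ℝ in 𝓝 (0, a), c - v.2 ∉ C := (continuous_snd.tendsto (0, a)).eventually hnear
    filter_upwards [hev] with v hv
    have hΓc : Continuous fun r => Γ (z + v.1) r := by fun_prop
    refine HasDerivAt.hasFDerivAt ?_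
    refine intervalIntegral.integral_hasDerivAt_right
      ((hw.intervalIntegrable_comp_sub c _ _).continuousOn_mul hΓc.continuousOn)
      (hΓc.measurable.mul hmeas).stronglyMeasurable.stronglyMeasurableAtFilter
      (hΓc.continuousAt.mul (hcw _ hv))
  · have := continuous_conv hw hΓ.cont_deriv
    exact (sm.comp (this.comp (by fun_prop : Continuous fun q : ℝ × ℝ => (c, z + q.1, q.2)))).continuousAt
  · refine sm.continuousAt.comp ?_
    refine ContinuousAt.mul (by fun_prop) ?_
    exact ContinuousAt.comp (f := Prod.snd) (x := ((0 : ℝ), a)) (hcw a ha) continuous_snd.continuousAt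

/-! ### Fubini on triangles and exponentially weighted estimates -/

/-- Fubini's theorem on a triangle. -/
theorem integral_triangle_swap {G : ℝ → ℝ → ℝ} {a b M : ℝ} (hab : a ≤ b)
    (hG : Measurable (Function.uncurry G))
    (hM : ∀ u ∈ Icc a b, ∀ w ∈ Icc a b, |G u w| ≤ M) :
    ∫ u in a..b, ∫ w in u..b, G u w = ∫ w in a..b, ∫ u in a..w, G u w := by
  set f : ℝ → ℝ → ℝ := fun u w => if u < w then G u w else 0 with hf
  have hfm : Measurable (Function.uncurry f) :=
    Measurable.ite (measurableSet_lt measurable_fst measurable_snd) hG measurable_const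
  have h1 : ∀ u ∈ Ioc a b, ∫ w in u..b, G u w = ∫ w in Ioc a b, f u w := by
    intro u hu
    rw [intervalIntegral.integral_of_le hu.2]
    have : (fun w => f u w) = (Ioi u).indicator (fun w => G u w) := by
      ext w; simp [hf, indicator]
    rw [this, setIntegral_indicator measurableSet_Ioi, Ioc_inter_Ioi, sup_eq_right.mpr hu.1.le]
  have h2 : ∀ w ∈ Ioc a b, ∫ u in a..w, G u w = ∫ u in Ioc a b, f u w := by
    intro w hw
    rw [intervalIntegral.integral_of_le hw.1.le]
    have : (fun u => f u w) = (Iio w).indicator (fun u => G u w) := by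
      ext w; simp [hf, indicator]
    rw [this, setIntegral_indicator measurableSet_Iio]
    have hs : Ioc a b ∩ Iio w = Ioo a w := by
      ext u; simp only [mem_inter_iff, mem_Ioc, mem_Iio, mem_Ioo]
      exact ⟨fun h => ⟨h.1.1, h.2⟩, fun h => ⟨⟨h.1, (h.2.trans_le hw.2).le⟩, h.2⟩⟩
    rw [hs, integral_Ioc_eq_integral_Ioo]
  rw [intervalIntegral.integral_of_le hab, intervalIntegral.integral_of_le hab,
    setIntegral_congr_fun measurableSet_Ioc h1, setIntegral_congr_fun measurableSet_Ioc h2]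
  refine integral_integral_swap ?_
  rw [Measure.prod_restrict]
  refine Measure.integrableOn_of_bounded (M := |M|) ?_ hfm.aestronglyMeasurable ?_
  · rw [Measure.prod_prod]
    simp [ENNReal.mul_eq_top]
  · filter_upwards [ae_restrict_mem (measurableSet_Ioc.prod measurableSet_Ioc)] with q hq
    simp only [Function.uncurry, hf]
    split_ifs
    · exact (hM q.1 ⟨hq.1.1.le, hq.1.2⟩ q.2 ⟨hq.2.1.le, hq.2.2⟩).trans (le_abs_self M)
    · simp

theorem integral_exp_mul {lam : ℝ} (hl : 0 < lam) (a b : ℝ) :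
    ∫ w in a..b, Real.exp (lam * w) = (Real.exp (lam * b) - Real.exp (lam * a)) / lam := by
  rw [intervalIntegral.integral_comp_mul_left (fun x => Real.exp x) hl.ne', integral_exp]
  simp only [smul_eq_mul]
  field_simp

/-- An integrand dominated by an increasing exponential. -/
theorem abs_integral_le_exp {φ : ℝ → ℝ} {lam M a b : ℝ} (hl : 0 < lam) (hM : 0 ≤ M) (hab : a ≤ b)
    (h : ∀ w ∈ Ioc a b, |φ w| ≤ M * Real.exp (lam * w)) :
    |∫ w in a..b, φ w| ≤ M / lam * Real.exp (lam * b) := by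
  have hc : Continuous fun w => M * Real.exp (lam * w) := by fun_prop
  have := intervalIntegral.norm_integral_le_of_norm_le hab (f := φ)
    (Eventually.of_forall fun w hw => h w hw) (hc.intervalIntegrable (μ := volume) a b)
  rw [Real.norm_eq_abs] at this
  refine this.trans ?_
  rw [intervalIntegral.integral_const_mul, integral_exp_mul hl, mul_div_assoc', div_mul_eq_mul_div]
  gcongr
  linarith [Real.exp_pos (lam * a)]

/-- An integrand dominated by a decreasing exponential. -/
theorem abs_integral_le_exp_sub {φ : ℝ → ℝ} {lam M r : ℝ} (hl : 0 < lam) (hM : 0 ≤ M) (hr : 0 ≤ r)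
    (h : ∀ w ∈ Icc 0 r, |φ w| ≤ M * Real.exp (lam * (r - w))) :
    |∫ w in (0 : ℝ)..r, φ w| ≤ M / lam * Real.exp (lam * r) := by
  have e := intervalIntegral.integral_comp_sub_left φ (a := 0) (b := r) r
  simp only [sub_self, sub_zero] at e
  rw [← e]
  refine abs_integral_le_exp hl hM hr fun w hw => ?_
  have := h (r - w) ⟨by linarith [hw.2], by linarith [hw.1]⟩
  simpa using this

/-- The common pattern of the uniqueness proofs, in place of Gronwall's inequality: a weighted bound
that implies itself with half the constant holds with every B/2^n, hence with 0. -/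
theorem exists_div_two_pow {P : ℝ → Prop} (h0 : ∃ B, 0 ≤ B ∧ P B)
    (hs : ∀ B, 0 ≤ B → P B → P (B / 2)) : ∃ B, 0 ≤ B ∧ ∀ n : ℕ, P (B / 2 ^ n) := by
  obtain ⟨B, hB, hP⟩ := h0
  refine ⟨B, hB, fun n => ?_⟩
  induction n with
  | zero => simpa using hP
  | succ n ih =>
    have := hs _ (by positivity) ih
    rwa [div_div, ← pow_succ] at this

theorem eq_zero_of_abs_le_div_two_pow {x B W : ℝ} (h : ∀ n : ℕ, |x| ≤ B / 2 ^ n * W) : x = 0 := by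
  have ht : Tendsto (fun n : ℕ => B / 2 ^ n * W) atTop (𝓝 0) := by
    have := ((tendsto_pow_atTop_nhds_zero_of_lt_one (r := (1 / 2 : ℝ)) (by norm_num)
      (by norm_num)).const_mul B).mul_const W
    simpa [div_eq_mul_inv] using this
  exact abs_nonpos_iff.mp (ge_of_tendsto' ht h)

/-! ### Extension of the data and kernels from the square and the triangle to the plane -/

/-- Projection of the line to `[0,1]`. -/
noncomputable def clamp (x : ℝ) : ℝ := max 0 (min x 1)

@[fun_prop]
theorem continuous_clamp : Continuous clamp := by unfold clamp; fun_prop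

theorem clamp_mem (x : ℝ) : clamp x ∈ Icc (0 : ℝ) 1 :=
  ⟨le_max_left _ _, max_le zero_le_one (min_le_right _ _)⟩

theorem clamp_of_mem {x : ℝ} (h : x ∈ Icc (0 : ℝ) 1) : clamp x = x := by
  rw [clamp, min_eq_left h.2, max_eq_right h.1]

theorem continuous_comp_clamp {φ : ℝ → ℝ} (h : ContinuousOn φ (Icc 0 1)) :
    Continuous fun x => φ (clamp x) :=
  h.comp_continuous continuous_clamp clamp_mem

theorem continuous_comp_clamp₂ {f : ℝ → ℝ → ℝ}
    (h : ContinuousOn (fun q : ℝ × ℝ => f q.1 q.2) (Icc 0 1 ×ˢ Icc 0 1)) :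
    Continuous fun q : ℝ × ℝ => f (clamp q.1) (clamp q.2) :=
  h.comp_continuous (f := fun q : ℝ × ℝ => (clamp q.1, clamp q.2)) (by fun_prop)
    fun q => ⟨clamp_mem _, clamp_mem _⟩

theorem continuous_comp_triangle {k : ℝ → ℝ → ℝ}
    (h : ContinuousOn (fun q : ℝ × ℝ => k q.1 q.2) kernelTriangle) :
    Continuous fun q : ℝ × ℝ => k (min (clamp q.1) (clamp q.2)) (clamp q.2) :=
  h.comp_continuous (f := fun q : ℝ × ℝ => (min (clamp q.1) (clamp q.2), clamp q.2)) (by fun_prop)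
    fun q => ⟨le_min (clamp_mem _).1 (clamp_mem _).1, min_le_right _ _, (clamp_mem _).2⟩

/-- The line r = const is a characteristic and meets s = 1 at z = 1 - r. This is the solution of ∂_z
Γ = E with the value β(r) there; in r only continuity is required. -/
theorem smoothKernel_primitive {β : ℝ → ℝ} {E : ℝ → ℝ → ℝ} (hβ : Continuous β)
    (hE : Continuous fun q : ℝ × ℝ => E q.1 q.2) :
    SmoothKernel (fun z r => β r - ∫ h in z..1 - r, E h r) E := by
  have hEswap : Continuous (Function.uncurry fun (r : ℝ) (h : ℝ) => E h r) :=
    hE.comp (f := fun q : ℝ × ℝ => (q.2, q.1)) (by fun_prop)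
  have hint : ∀ r x y, IntervalIntegrable (fun h => E h r) volume x y := fun r x y =>
    (by fun_prop : Continuous fun h => E h r).intervalIntegrable _ _
  have hΓ : ∀ z r, (∫ h in z..1 - r, E h r) = (∫ h in (0 : ℝ)..1 - r, E h r) -
      ∫ h in (0 : ℝ)..z, E h r := fun z r => by
    rw [intervalIntegral.integral_interval_sub_left (hint _ _ _) (hint _ _ _)]
  refine ⟨?_, hE, fun z r => ?_⟩
  · refine Continuous.congr (f := fun q : ℝ × ℝ => β q.2 -
      ((∫ h in (0 : ℝ)..1 - q.2, E h q.2) - ∫ h in (0 : ℝ)..q.1, E h q.2)) ?_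
      fun q => by rw [hΓ q.1 q.2]
    refine Continuous.sub (by fun_prop) (Continuous.sub ?_ ?_)
    · have := intervalIntegral.continuous_parametric_intervalIntegral_of_continuous (μ := volume)
        (a₀ := 0) hEswap (s := fun r : ℝ => 1 - r) (by fun_prop)
      exact this.comp continuous_snd
    · have hE2 : Continuous (Function.uncurry fun (q : ℝ × ℝ) (h : ℝ) => E h q.2) :=
        hE.comp (f := fun q : (ℝ × ℝ) × ℝ => (q.2, q.1.2)) (by fun_prop)
      exact intervalIntegral.continuous_parametric_intervalIntegral_of_continuous (μ := volume)
        (a₀ := 0) hE2 (s := fun q : ℝ × ℝ => q.1) (by fun_prop)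
  · have hc : Continuous fun h => E h r := by fun_prop
    have := (intervalIntegral.integral_hasDerivAt_left (hc.intervalIntegrable z (1 - r))
      (hc.stronglyMeasurableAtFilter _ _) hc.continuousAt).const_sub (β r)
    simpa using this

/-- A kernel on the triangle with a continuous derivative in the direction `(1,1)` extends, in the
coordinates `(z, s - z)`, to a smooth kernel on the plane. -/
theorem exists_smoothKernel {k E : ℝ → ℝ → ℝ}
    (hk : ContinuousOn (fun q : ℝ × ℝ => k q.1 q.2) kernelTriangle)
    (hE : Continuous fun q : ℝ × ℝ => E q.1 q.2)
    (hd : ∀ z s : ℝ, (z, s) ∈ kernelTriangle →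
      HasDerivWithinAt (fun h => k (z + h) (s + h)) (E z (s - z)) (Icc (-z) (1 - s)) 0) :
    ∃ Γ : ℝ → ℝ → ℝ, SmoothKernel Γ E ∧
      ∀ z r, 0 ≤ z → 0 ≤ r → z + r ≤ 1 → Γ z r = k z (z + r) := by
  have hke := continuous_comp_triangle hk
  refine ⟨fun z r => k (min (clamp (1 - r)) (clamp 1)) (clamp 1) - ∫ h in z..1 - r, E h r,
    smoothKernel_primitive (β := fun r => k (min (clamp (1 - r)) (clamp 1)) (clamp 1))
      (hke.comp (f := fun r : ℝ => (1 - r, 1)) (by fun_prop)) hE, fun z r hz hr hzr => ?_⟩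
  have h1 : clamp 1 = 1 := clamp_of_mem (by simp)
  have h2 : clamp (1 - r) = 1 - r := clamp_of_mem ⟨by linarith, by linarith⟩
  have key : ∫ h in z..1 - r, E h r = k (1 - r) (1 - r + r) - k z (z + r) := by
    refine intervalIntegral.integral_eq_sub_of_hasDerivAt_of_le (f := fun h => k h (h + r))
      (by linarith) ?_ ?_ ((by fun_prop : Continuous fun h => E h r).intervalIntegrable _ _)
    · exact hk.comp (f := fun h : ℝ => (h, h + r)) (by fun_prop)
        fun h hh => ⟨hz.trans hh.1, by simpa using hr, by linarith [hh.2]⟩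
    -- Only interior points of the characteristic segment are differentiated, so nothing is needed
    -- at its endpoints; for r = 1 the segment is the single vertex (0,1).
    · intro x hx
      have := (hd x (x + r) ⟨hz.trans hx.1.le, by simpa using hr, by linarith [hx.2]⟩).hasDerivAt
        (Icc_mem_nhds (by linarith [hx.1]) (by linarith [hx.2]))
      have h3 := HasDerivAt.comp_sub_const (f := fun h => k (x + h) (x + r + h)) x x
        (by simpa using this)
      refine h3.congr_of_eventuallyEq (Eventually.of_forall fun y => ?_)
      beta_reduce
      congr 1 <;> ring
  beta_reduce
  rw [key, h1, h2, min_eq_left (show 1 - r ≤ (1 : ℝ) by linarith), sub_add_cancel]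
  ring

/-! ### Algebra of Volterra kernels under composition -/

/-- Composition of Volterra kernels in the coordinates `(z, s - z)`. -/
noncomputable def kcomp (a b : ℝ → ℝ → ℝ) (z r : ℝ) : ℝ :=
  ∫ w in (0 : ℝ)..r, a z w * b (z + w) (r - w)

section kcomp

variable {a b c a' b' : ℝ → ℝ → ℝ}

theorem continuous_kcomp (ha : Continuous fun q : ℝ × ℝ => a q.1 q.2)
    (hb : Continuous fun q : ℝ × ℝ => b q.1 q.2) :
    Continuous fun q : ℝ × ℝ => kcomp a b q.1 q.2 := by
  unfold kcomp
  refine intervalIntegral.continuous_parametric_intervalIntegral_of_continuous (μ := volume)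
    (f := fun (q : ℝ × ℝ) w => a q.1 w * b (q.1 + w) (q.2 - w)) ?_ continuous_snd
  exact (ha.comp (f := fun p : (ℝ × ℝ) × ℝ => (p.1.1, p.2)) (by fun_prop)).mul
    (hb.comp (f := fun p : (ℝ × ℝ) × ℝ => (p.1.1 + p.2, p.1.2 - p.2)) (by fun_prop))

theorem kcomp_congr {z r : ℝ} (hz : 0 ≤ z) (hr : 0 ≤ r) (hzr : z + r ≤ 1)
    (ha : ∀ z r, 0 ≤ z → 0 ≤ r → z + r ≤ 1 → a z r = a' z r)
    (hb : ∀ z r, 0 ≤ z → 0 ≤ r → z + r ≤ 1 → b z r = b' z r) :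
    kcomp a b z r = kcomp a' b' z r := by
  refine intervalIntegral.integral_congr fun w hw => ?_
  rw [uIcc_of_le hr] at hw
  rw [ha z w hz hw.1 (by linarith [hw.2]),
    hb (z + w) (r - w) (by linarith [hw.1]) (by linarith [hw.2]) (by linarith)]

theorem kcomp_integrable (ha : Continuous fun q : ℝ × ℝ => a q.1 q.2)
    (hb : Continuous fun q : ℝ × ℝ => b q.1 q.2) (z r x y : ℝ) :
    IntervalIntegrable (fun w => a z w * b (z + w) (r - w)) volume x y := by
  have h1 : Continuous fun w => a z w := ha.comp (f := fun w => (z, w)) (by fun_prop)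
  have h2 : Continuous fun w => b (z + w) (r - w) :=
    hb.comp (f := fun w => (z + w, r - w)) (by fun_prop)
  exact (h1.mul h2).intervalIntegrable _ _

theorem kcomp_add_left (ha : Continuous fun q : ℝ × ℝ => a q.1 q.2)
    (ha' : Continuous fun q : ℝ × ℝ => a' q.1 q.2)
    (hb : Continuous fun q : ℝ × ℝ => b q.1 q.2) (z r : ℝ) :
    kcomp (fun z r => a z r + a' z r) b z r = kcomp a b z r + kcomp a' b z r := by
  unfold kcomp
  rw [← intervalIntegral.integral_add (kcomp_integrable ha hb _ _ _ _)
    (kcomp_integrable ha' hb _ _ _ _)]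
  simp only [add_mul]

theorem kcomp_sub_left (ha : Continuous fun q : ℝ × ℝ => a q.1 q.2)
    (ha' : Continuous fun q : ℝ × ℝ => a' q.1 q.2)
    (hb : Continuous fun q : ℝ × ℝ => b q.1 q.2) (z r : ℝ) :
    kcomp (fun z r => a z r - a' z r) b z r = kcomp a b z r - kcomp a' b z r := by
  unfold kcomp
  rw [← intervalIntegral.integral_sub (kcomp_integrable ha hb _ _ _ _)
    (kcomp_integrable ha' hb _ _ _ _)]
  simp only [sub_mul]

theorem kcomp_add_right (ha : Continuous fun q : ℝ × ℝ => a q.1 q.2)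
    (hb : Continuous fun q : ℝ × ℝ => b q.1 q.2)
    (hb' : Continuous fun q : ℝ × ℝ => b' q.1 q.2) (z r : ℝ) :
    kcomp a (fun z r => b z r + b' z r) z r = kcomp a b z r + kcomp a b' z r := by
  unfold kcomp
  rw [← intervalIntegral.integral_add (kcomp_integrable ha hb _ _ _ _)
    (kcomp_integrable ha hb' _ _ _ _)]
  simp only [mul_add]

theorem kcomp_sub_right (ha : Continuous fun q : ℝ × ℝ => a q.1 q.2)
    (hb : Continuous fun q : ℝ × ℝ => b q.1 q.2)
    (hb' : Continuous fun q : ℝ × ℝ => b' q.1 q.2) (z r : ℝ) :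
    kcomp a (fun z r => b z r - b' z r) z r = kcomp a b z r - kcomp a b' z r := by
  unfold kcomp
  rw [← intervalIntegral.integral_sub (kcomp_integrable ha hb _ _ _ _)
    (kcomp_integrable ha hb' _ _ _ _)]
  simp only [mul_sub]

/-- Fubini on the triangle 0 ≤ u ≤ w ≤ r, followed by the shift w ↦ w + u in the inner integral. -/
theorem kcomp_assoc (ha : Continuous fun q : ℝ × ℝ => a q.1 q.2)
    (hb : Continuous fun q : ℝ × ℝ => b q.1 q.2)
    (hc : Continuous fun q : ℝ × ℝ => c q.1 q.2) {z r : ℝ} (hr : 0 ≤ r) :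
    kcomp (kcomp a b) c z r = kcomp a (kcomp b c) z r := by
  have hG : Continuous (Function.uncurry fun u w : ℝ =>
      a z u * b (z + u) (w - u) * c (z + w) (r - w)) :=
    ((ha.comp (f := fun q : ℝ × ℝ => (z, q.1)) (by fun_prop)).mul
      (hb.comp (f := fun q : ℝ × ℝ => (z + q.1, q.2 - q.1)) (by fun_prop))).mul
      (hc.comp (f := fun q : ℝ × ℝ => (z + q.2, r - q.2)) (by fun_prop))
  obtain ⟨M, hM⟩ := ((isCompact_Icc (a := (0 : ℝ)) (b := r)).prod
    (isCompact_Icc (a := (0 : ℝ)) (b := r))).exists_bound_of_continuousOn hG.continuousOn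
  have := integral_triangle_swap hr hG.measurable (M := M) fun u hu w hw => hM (u, w) ⟨hu, hw⟩
  unfold kcomp
  calc _ = ∫ w in (0 : ℝ)..r, ∫ u in (0 : ℝ)..w,
        a z u * b (z + u) (w - u) * c (z + w) (r - w) := by
        simp only [intervalIntegral.integral_mul_const]
    _ = ∫ u in (0 : ℝ)..r, ∫ w in u..r,
        a z u * b (z + u) (w - u) * c (z + w) (r - w) := this.symm
    _ = _ := by
        refine intervalIntegral.integral_congr fun u _ => ?_
        rw [← intervalIntegral.integral_const_mul]
        have e := intervalIntegral.integral_comp_add_right (a := 0) (b := r - u)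
          (fun w => a z u * b (z + u) (w - u) * c (z + w) (r - w)) u
        rw [zero_add, sub_add_cancel] at e
        rw [← e]
        refine intervalIntegral.integral_congr fun w _ => ?_
        rw [add_sub_cancel_right, show z + (w + u) = z + u + w by ring,
          show r - (w + u) = r - u - w by ring]
        ring

/-- A continuous kernel dominated by its composition with a continuous kernel vanishes. -/
theorem eq_zero_of_kcomp {L e : ℝ → ℝ → ℝ} (hL : Continuous fun q : ℝ × ℝ => L q.1 q.2)
    (he : Continuous fun q : ℝ × ℝ => e q.1 q.2)
    (h : ∀ z r, 0 ≤ z → 0 ≤ r → z + r ≤ 1 → e z r + kcomp L e z r = 0) :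
    ∀ z r, 0 ≤ z → 0 ≤ r → z + r ≤ 1 → e z r = 0 := by
  have hcomp : IsCompact (Icc (0 : ℝ) 1 ×ˢ Icc (0 : ℝ) 1) := isCompact_Icc.prod isCompact_Icc
  obtain ⟨K, hK⟩ := hcomp.exists_bound_of_continuousOn hL.continuousOn
  obtain ⟨B, hB⟩ := hcomp.exists_bound_of_continuousOn he.continuousOn
  have h00 : ((0 : ℝ), (0 : ℝ)) ∈ Icc (0 : ℝ) 1 ×ˢ Icc (0 : ℝ) 1 := by simp
  have hK0 : 0 ≤ K := (norm_nonneg _).trans (hK _ h00)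
  have hB0 : 0 ≤ B := (norm_nonneg _).trans (hB _ h00)
  -- In the weight e^{lam r} a composition with `L` costs a factor K/lam, and this is at most 1/2.
  set lam : ℝ := 2 * K + 1 with hlam
  have hl : 0 < lam := by positivity
  have h0 : ∀ z r, 0 ≤ z → 0 ≤ r → z + r ≤ 1 → |e z r| ≤ B * Real.exp (lam * r) := by
    intro z r hz hr hzr
    refine (hB (z, r) ⟨⟨hz, by linarith⟩, ⟨hr, by linarith⟩⟩).trans ?_
    exact le_mul_of_one_le_right hB0 (Real.one_le_exp (by positivity))
  have hs : ∀ B, 0 ≤ B → (∀ z r, 0 ≤ z → 0 ≤ r → z + r ≤ 1 → |e z r| ≤ B * Real.exp (lam * r)) →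
      ∀ z r, 0 ≤ z → 0 ≤ r → z + r ≤ 1 → |e z r| ≤ B / 2 * Real.exp (lam * r) := by
    intro B hB ih z r hz hr hzr
    rw [eq_neg_of_add_eq_zero_left (h z r hz hr hzr), abs_neg]
    refine (abs_integral_le_exp_sub (M := K * B) hl (by positivity) hr fun w hw => ?_).trans ?_
    · rw [abs_mul, mul_assoc]
      exact mul_le_mul (hK (z, w) ⟨⟨hz, by linarith⟩, ⟨hw.1, by linarith [hw.2]⟩⟩)
        (ih (z + w) (r - w) (by linarith [hw.1]) (by linarith [hw.2]) (by linarith))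
        (abs_nonneg _) hK0
    · refine mul_le_mul_of_nonneg_right ?_ (Real.exp_nonneg _)
      rw [div_le_iff₀ hl]
      nlinarith
  obtain ⟨B, -, hn⟩ := exists_div_two_pow ⟨B, hB0, h0⟩ hs
  exact fun z r hz hr hzr => eq_zero_of_abs_le_div_two_pow fun n => hn n z r hz hr hzr

end kcomp

/-! ### The backstepping transformation, its inverse and the transformed gain -/

/-- The kernel `f` in the coordinates `(z, s - z)`, extended to the plane. -/
noncomputable def shifted (f : ℝ → ℝ → ℝ) (z r : ℝ) : ℝ := f (clamp z) (clamp (z + r))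

theorem continuous_shifted {f : ℝ → ℝ → ℝ}
    (hf : ContinuousOn (fun q : ℝ × ℝ => f q.1 q.2) (Icc 0 1 ×ˢ Icc 0 1)) :
    Continuous fun q : ℝ × ℝ => shifted f q.1 q.2 :=
  (continuous_comp_clamp₂ hf).comp (f := fun q : ℝ × ℝ => (q.1, q.1 + q.2)) (by fun_prop)

theorem shifted_eq (f : ℝ → ℝ → ℝ) {z r : ℝ} (hz : 0 ≤ z) (hr : 0 ≤ r) (hzr : z + r ≤ 1) :
    shifted f z r = f z (z + r) := by
  rw [shifted, clamp_of_mem ⟨hz, by linarith⟩, clamp_of_mem ⟨by linarith, hzr⟩]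

/-- The dictionary between the integrals ∫_z^s A(z,w) B(w,s) dw of the kernel equations and
composition in shifted coordinates; the substitution is w ↦ z + w. -/
theorem kcomp_eq {a b A B : ℝ → ℝ → ℝ}
    (ha : ∀ z r, 0 ≤ z → 0 ≤ r → z + r ≤ 1 → a z r = A z (z + r))
    (hb : ∀ z r, 0 ≤ z → 0 ≤ r → z + r ≤ 1 → b z r = B z (z + r)) {z s : ℝ}
    (hz : 0 ≤ z) (hzs : z ≤ s) (hs : s ≤ 1) :
    kcomp a b z (s - z) = ∫ w in z..s, A z w * B w s := by
  have e := intervalIntegral.integral_comp_add_left (a := 0) (b := s - z)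
    (fun w => A z w * B w s) z
  rw [add_zero, add_sub_cancel] at e
  rw [← e]
  refine intervalIntegral.integral_congr fun w hw => ?_
  rw [uIcc_of_le (by linarith)] at hw
  rw [ha z w hz hw.1 (by linarith [hw.2]),
    hb (z + w) (s - z - w) (by linarith [hw.1]) (by linarith [hw.2]) (by linarith),
    show z + w + (s - z - w) = s by ring]

/-- Plane extensions `L`, `K` of the kernels `l`, `k` in the coordinates `(z, s - z)`. -/
structure KernelData (g : ℝ → ℝ) (f L L' K K' : ℝ → ℝ → ℝ) : Prop where
  smooth_L : SmoothKernel L L'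
  smooth_K : SmoothKernel K K'
  deriv_L : ∀ z r, 0 ≤ z → 0 ≤ r → z + r ≤ 1 →
    L' z r = shifted f z r + kcomp (shifted f) L z r
  boundary : ∀ z ∈ Icc (0 : ℝ) 1, L z (1 - z) = -g z
  inverse : ∀ z r, 0 ≤ z → 0 ≤ r → z + r ≤ 1 → L z r = K z r + kcomp L K z r

/-- The right-hand sides of the derivative equations contain the kernels themselves and must be
continuous on the whole plane for `exists_smoothKernel`. The kernels are therefore first extended by
clamping; their smooth extensions replace these afterwards on the triangle, where both agree. -/
theorem IsKernelPair.exists_kernelData {g : ℝ → ℝ} {f k l : ℝ → ℝ → ℝ} (h : IsKernelPair g f k l)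
    (hf : ContinuousOn (fun q : ℝ × ℝ => f q.1 q.2) (Icc 0 1 ×ˢ Icc 0 1)) :
    ∃ L L' K K' : ℝ → ℝ → ℝ, KernelData g f L L' K K' ∧
      (∀ z r, 0 ≤ z → 0 ≤ r → z + r ≤ 1 → L z r = l z (z + r)) ∧
      ∀ z r, 0 ≤ z → 0 ≤ r → z + r ≤ 1 → K z r = k z (z + r) := by
  have ext : ∀ a : ℝ → ℝ → ℝ, ContinuousOn (fun q : ℝ × ℝ => a q.1 q.2) kernelTriangle →
      ∃ a' : ℝ → ℝ → ℝ, (Continuous fun q : ℝ × ℝ => a' q.1 q.2) ∧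
        ∀ z r, 0 ≤ z → 0 ≤ r → z + r ≤ 1 → a' z r = a z (z + r) := fun a ha =>
    ⟨fun z r => a (min (clamp z) (clamp (z + r))) (clamp (z + r)),
      (continuous_comp_triangle ha).comp (f := fun q : ℝ × ℝ => (q.1, q.1 + q.2)) (by fun_prop),
      fun z r hz hr hzr => by
        beta_reduce
        rw [clamp_of_mem ⟨hz, by linarith⟩, clamp_of_mem ⟨by linarith, hzr⟩,
          min_eq_left (by linarith)]⟩
  obtain ⟨le, hle, hle'⟩ := ext l h.cont_l
  obtain ⟨ke, hke, hke'⟩ := ext k h.cont_k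
  have hF := continuous_shifted hf
  obtain ⟨L, hL, hL'⟩ := exists_smoothKernel
    (E := fun z r => shifted f z r + kcomp (shifted f) le z r) h.cont_l
    (hF.add (continuous_kcomp hF hle)) fun z s hzs => by
      have := h.l_pde z s hzs
      rwa [← kcomp_eq (a := shifted f) (fun z r => shifted_eq f) hle' hzs.1 hzs.2.1 hzs.2.2,
        show f z s = shifted f z (s - z) by
          rw [shifted_eq f hzs.1 (by linarith [hzs.2.1]) (by linarith [hzs.2.2]),
            add_sub_cancel]] at this
  obtain ⟨K, hK, hK'⟩ := exists_smoothKernel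
    (E := fun z r => shifted f z r - kcomp ke (shifted f) z r) h.cont_k
    (hF.sub (continuous_kcomp hke hF)) fun z s hzs => by
      have := h.k_pde z s hzs
      rwa [← kcomp_eq (b := shifted f) hke' (fun z r => shifted_eq f) hzs.1 hzs.2.1 hzs.2.2,
        show f z s = shifted f z (s - z) by
          rw [shifted_eq f hzs.1 (by linarith [hzs.2.1]) (by linarith [hzs.2.2]),
            add_sub_cancel]] at this
  refine ⟨L, _, K, _, ⟨hL, hK, fun z r hz hr hzr => ?_, fun z hz => ?_, fun z r hz hr hzr => ?_⟩,
    hL', hK'⟩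
  · rw [kcomp_congr hz hr hzr (a' := shifted f) (b' := L) (fun _ _ _ _ _ => rfl)
      fun z r hz hr hzr => (hle' z r hz hr hzr).trans (hL' z r hz hr hzr).symm]
  · rw [hL' z _ hz.1 (by linarith [hz.2]) (by linarith), add_sub_cancel, h.l_boundary z hz]
  · have := h.inverse z (z + r) ⟨hz, by linarith, hzr⟩
    rw [← kcomp_eq hL' hK' hz (by linarith) hzr, add_sub_cancel_left] at this
    rw [hL' z r hz hr hzr, hK' z r hz hr hzr, this]

section KernelData

variable {g : ℝ → ℝ} {f L L' K K' : ℝ → ℝ → ℝ}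

/-- A one-sided resolvent is two-sided. With D = L - K - K∘L, associativity and L∘K = L - K give L∘D
= K∘L - L + K = -D, and D + L∘D = 0 forces D = 0. -/
theorem KernelData.inverse_swap (h : KernelData g f L L' K K') :
    ∀ z r, 0 ≤ z → 0 ≤ r → z + r ≤ 1 → L z r = K z r + kcomp K L z r := by
  have cL := h.smooth_L.cont
  have cK := h.smooth_K.cont
  have cKL := continuous_kcomp cK cL
  have cLK := continuous_kcomp cL cK
  have key := eq_zero_of_kcomp (L := L) (e := fun z r => L z r - K z r - kcomp K L z r) cL
    ((cL.sub cK).sub cKL) fun z r hz hr hzr => by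
      rw [kcomp_sub_right (b := fun z r => L z r - K z r) (b' := kcomp K L) cL (cL.sub cK) cKL,
        kcomp_sub_right cL cL cK, ← kcomp_assoc cL cK cL hr,
        kcomp_congr hz hr hzr (a := kcomp L K) (a' := fun z r => L z r - K z r) (b' := L)
          (fun z r hz hr hzr => by rw [h.inverse z r hz hr hzr]; ring) (fun _ _ _ _ _ => rfl),
        kcomp_sub_left cL cK cL, h.inverse z r hz hr hzr]
      ring
  intro z r hz hr hzr
  linarith [key z r hz hr hzr]

/-- The second transformation undoes the first one. -/
theorem KernelData.transform_transform (h : KernelData g f L L' K K') {Y : ℝ → ℝ}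
    (hY : Continuous Y) {X : ℝ → ℝ}
    (hX : ∀ z, X z = Y z - ∫ r in (0 : ℝ)..1 - z, K z r * Y (z + r)) {z : ℝ}
    (hz : z ∈ Icc (0 : ℝ) 1) :
    X z + ∫ r in (0 : ℝ)..1 - z, L z r * X (z + r) = Y z := by
  have cL := h.smooth_L.cont
  have cK := h.smooth_K.cont
  -- A function of z is read as a kernel evaluated at r = 1 - z, that is, at s = 1. The
  -- transformations then become compositions, and associativity together with L∘K = L - K gives the
  -- cancellation.
  set c : ℝ → ℝ → ℝ := fun _ r => Y (1 - r) with hc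
  have cc : Continuous fun q : ℝ × ℝ => c q.1 q.2 := by fun_prop
  have cKc := continuous_kcomp cK cc
  have e1 : ∀ z, X z = c z (1 - z) - kcomp K c z (1 - z) := fun z => by
    rw [hX z, hc, kcomp]
    simp only [sub_sub_cancel]
    congr 1
    refine intervalIntegral.integral_congr fun r _ => ?_
    rw [show 1 - (1 - z - r) = z + r by ring]
  have e2 : ∫ r in (0 : ℝ)..1 - z, L z r * X (z + r) =
      kcomp L (fun z r => c z r - kcomp K c z r) z (1 - z) := by
    refine intervalIntegral.integral_congr fun r _ => ?_
    beta_reduce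
    rw [e1, show 1 - (z + r) = 1 - z - r by ring]
  have hr : 0 ≤ 1 - z := by linarith [hz.2]
  have hzr : z + (1 - z) ≤ 1 := by linarith
  rw [e2, e1, kcomp_sub_right cL cc cKc, ← kcomp_assoc cL cK cc hr,
    kcomp_congr hz.1 hr hzr (a := kcomp L K) (a' := fun z r => L z r - K z r) (b' := c)
      (fun z r hz hr hzr => by rw [h.inverse z r hz hr hzr]; ring) (fun _ _ _ _ _ => rfl),
    kcomp_sub_left cL cK cc, hc]
  simp only [sub_sub_cancel]
  ring

/-- Moving the transformation `x ↦ x + ∫ l x` to the other factor of a pairing. -/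
theorem integral_mul_transform {P x : ℝ → ℝ} (hP : Continuous P)
    (hL : Continuous fun q : ℝ × ℝ => L q.1 q.2) (hx : Measurable x) {M a : ℝ}
    (ha : a ∈ Icc (0 : ℝ) 1) (hM : ∀ s ∈ Icc (0 : ℝ) 1, |x s| ≤ M) :
    ∫ s in a..1, P s * (x s + ∫ r in (0 : ℝ)..1 - s, L s r * x (s + r)) =
      ∫ s in a..1, (P s + ∫ w in a..s, P w * L w (s - w)) * x s := by
  have hM0 : 0 ≤ M := (abs_nonneg _).trans (hM 0 (by simp))
  have hI : ∀ φ : ℝ → ℝ, Continuous φ →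
      IntervalIntegrable (fun s => φ s * x s) volume a 1 := fun φ hφ => by
    have : IntervalIntegrable x volume a 1 := by
      rw [intervalIntegrable_iff]
      refine Measure.integrableOn_of_bounded (M := M) (by simp [uIoc]) hx.aestronglyMeasurable ?_
      filter_upwards [ae_restrict_mem measurableSet_uIoc] with t ht
      rw [uIoc_of_le ha.2] at ht
      exact hM t ⟨ha.1.trans ht.1.le, ht.2⟩
    exact this.continuousOn_mul hφ.continuousOn
  have hG : Continuous fun q : ℝ × ℝ => P q.1 * L q.1 (q.2 - q.1) :=
    (hP.comp continuous_fst).mul (hL.comp (f := fun q : ℝ × ℝ => (q.1, q.2 - q.1)) (by fun_prop))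
  obtain ⟨N, hN⟩ := ((isCompact_Icc (a := (0 : ℝ)) (b := 1)).prod
    (isCompact_Icc (a := (0 : ℝ)) (b := 1))).exists_bound_of_continuousOn hG.continuousOn
  have hN0 : 0 ≤ N := (norm_nonneg _).trans (hN (0, 0) (by simp))
  have sw := integral_triangle_swap (G := fun u w => P u * L u (w - u) * x w) (M := N * M)
    ha.2 (hG.measurable.mul (hx.comp measurable_snd)) fun u hu w hw => by
      have hw' : w ∈ Icc (0 : ℝ) 1 := ⟨ha.1.trans hw.1, hw.2⟩
      rw [abs_mul]
      exact mul_le_mul (hN (u, w) ⟨⟨ha.1.trans hu.1, hu.2⟩, hw'⟩) (hM w hw') (abs_nonneg _) hN0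
  have hcomp : Continuous fun s => ∫ w in a..s, P w * L w (s - w) := by
    refine intervalIntegral.continuous_parametric_intervalIntegral_of_continuous (μ := volume)
      (f := fun s w => P w * L w (s - w)) ?_ continuous_id
    exact hG.comp (f := fun q : ℝ × ℝ => (q.2, q.1)) (by fun_prop)
  have inner : ∀ s, P s * (x s + ∫ r in (0 : ℝ)..1 - s, L s r * x (s + r)) =
      P s * x s + ∫ w in s..1, P s * L s (w - s) * x w := fun s => by
    have e := intervalIntegral.integral_comp_add_left (a := 0) (b := 1 - s)
      (fun w => P s * L s (w - s) * x w) s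
    rw [add_zero, add_sub_cancel] at e
    rw [← e, mul_add, ← intervalIntegral.integral_const_mul]
    congr 1
    refine intervalIntegral.integral_congr fun r _ => ?_
    rw [add_sub_cancel_left]
    ring
  have hsw : IntervalIntegrable (fun s => ∫ w in s..1, P s * L s (w - s) * x w) volume a 1 := by
    have hc : Continuous fun q : ℝ × ℝ => P q.2 * L q.2 (q.1 - q.2) :=
      hG.comp (f := fun q : ℝ × ℝ => (q.2, q.1)) (by fun_prop)
    rw [intervalIntegrable_iff]
    refine IntegrableOn.of_bound (by simp [uIoc]) ?_ (N * M) ?_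
    · have hm : StronglyMeasurable (Function.uncurry fun (s w : ℝ) =>
          (Ioc s 1).indicator (fun w => P s * L s (w - s) * x w) w) := by
        have hset : MeasurableSet {q : ℝ × ℝ | q.1 < q.2 ∧ q.2 ≤ 1} :=
          (measurableSet_lt measurable_fst measurable_snd).inter
            (measurableSet_le measurable_snd measurable_const)
        have : Measurable ({q : ℝ × ℝ | q.1 < q.2 ∧ q.2 ≤ 1}.indicator
            fun q : ℝ × ℝ => P q.1 * L q.1 (q.2 - q.1) * x q.2) :=
          (hG.measurable.mul (hx.comp measurable_snd)).indicator hset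
        exact this.stronglyMeasurable
      have hm' := hm.integral_prod_right (ν := volume)
      refine (hm'.aestronglyMeasurable (μ := volume.restrict (uIoc a 1))).congr ?_
      filter_upwards [ae_restrict_mem measurableSet_uIoc] with s hs
      rw [uIoc_of_le ha.2] at hs
      rw [intervalIntegral.integral_of_le hs.2, ← integral_indicator measurableSet_Ioc]
    · filter_upwards [ae_restrict_mem measurableSet_uIoc] with s hs
      rw [uIoc_of_le ha.2] at hs
      refine (intervalIntegral.norm_integral_le_of_norm_le_const (C := N * M) fun w hw => ?_).trans
        (mul_le_of_le_one_right (by positivity) ?_)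
      · rw [uIoc_of_le hs.2] at hw
        rw [norm_mul]
        exact mul_le_mul (hN (s, w) ⟨⟨ha.1.trans hs.1.le, hs.2⟩,
          ⟨by linarith [ha.1, hs.1, hw.1], hw.2⟩⟩)
          (hM w ⟨by linarith [ha.1, hs.1, hw.1], hw.2⟩) (norm_nonneg _) hN0
      · rw [abs_of_nonneg (by linarith [hs.2])]; linarith [hs.1, ha.1]
  simp only [inner]
  rw [intervalIntegral.integral_add (hI P hP) hsw, sw]
  rw [← intervalIntegral.integral_add (hI P hP)]
  · refine intervalIntegral.integral_congr fun s _ => ?_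
    rw [intervalIntegral.integral_mul_const, add_mul]
  · simpa only [intervalIntegral.integral_mul_const] using hI _ hcomp

/-- A continuous function on the line that agrees with the transformed gain on `[0,1]`. -/
noncomputable def gainExt (p : ℝ → ℝ) (L : ℝ → ℝ → ℝ) (s : ℝ) : ℝ :=
  p (clamp s) + L 0 s + ∫ w in (0 : ℝ)..s, p (clamp w) * L w (s - w)

theorem continuous_gainExt {p : ℝ → ℝ} (hp : ContinuousOn p (Icc 0 1))
    (hL : Continuous fun q : ℝ × ℝ => L q.1 q.2) : Continuous (gainExt p L) := by
  have hpc := continuous_comp_clamp hp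
  refine (hpc.add (hL.comp (f := fun s => (0, s)) (by fun_prop))).add ?_
  refine intervalIntegral.continuous_parametric_intervalIntegral_of_continuous (μ := volume)
    (f := fun s w => p (clamp w) * L w (s - w)) ?_ continuous_id
  exact (hpc.comp continuous_snd).mul
    (hL.comp (f := fun q : ℝ × ℝ => (q.2, q.1 - q.2)) (by fun_prop))

theorem kTilde_eq {p : ℝ → ℝ} {k l : ℝ → ℝ → ℝ}
    (hl : ∀ z r, 0 ≤ z → 0 ≤ r → z + r ≤ 1 → L z r = l z (z + r))
    (hk : ∀ z r, 0 ≤ z → 0 ≤ r → z + r ≤ 1 → K z r = k z (z + r)) {s : ℝ}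
    (hs : s ∈ Icc (0 : ℝ) 1) :
    kTilde p k l s = p (clamp s) + K 0 s + ∫ w in (0 : ℝ)..s, (p (clamp w) + K 0 w) * L w (s - w) := by
  have hk0 : ∀ w ∈ Icc (0 : ℝ) s, p w + k 0 w = p (clamp w) + K 0 w := fun w hw => by
    rw [hk 0 w le_rfl hw.1 (by linarith [hw.2, hs.2]), zero_add,
      clamp_of_mem ⟨hw.1, hw.2.trans hs.2⟩]
  rw [kTilde, hk0 s ⟨hs.1, le_rfl⟩]
  congr 1
  refine intervalIntegral.integral_congr fun w hw => ?_
  rw [uIcc_of_le hs.1] at hw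
  rw [hk0 w hw, hl w (s - w) hw.1 (by linarith [hw.2]) (by linarith [hs.2]), add_sub_cancel]

/-- By `KernelData.inverse_swap` at z = 0, k(0,s) + ∫_0^s k(0,w) l(w,s) dw = l(0,s). So k drops out,
and the regularity of the gain depends on p and l only. -/
theorem KernelData.kTilde_eq_gainExt (h : KernelData g f L L' K K') {p : ℝ → ℝ} {k l : ℝ → ℝ → ℝ}
    (hp : ContinuousOn p (Icc 0 1))
    (hl : ∀ z r, 0 ≤ z → 0 ≤ r → z + r ≤ 1 → L z r = l z (z + r))
    (hk : ∀ z r, 0 ≤ z → 0 ≤ r → z + r ≤ 1 → K z r = k z (z + r)) {s : ℝ}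
    (hs : s ∈ Icc (0 : ℝ) 1) : kTilde p k l s = gainExt p L s := by
  have cL := h.smooth_L.cont
  have cK := h.smooth_K.cont
  have hpc := continuous_comp_clamp hp
  have cL2 : Continuous fun w => L w (s - w) := cL.comp (f := fun w => (w, s - w)) (by fun_prop)
  rw [kTilde_eq hl hk hs, gainExt, h.inverse_swap 0 s le_rfl hs.1 (by linarith [hs.2]), kcomp]
  simp only [add_mul, zero_add]
  have c1 : Continuous fun w => p (clamp w) * L w (s - w) := hpc.mul cL2
  have c2 : Continuous fun w => K 0 w * L w (s - w) :=
    (cK.comp (f := fun w => ((0 : ℝ), w)) (by fun_prop)).mul cL2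
  rw [intervalIntegral.integral_add (c1.intervalIntegrable _ _) (c2.intervalIntegrable _ _)]
  ring

end KernelData

/-! ### Regularity of the transformed gain for smooth data -/

/-- The derivative is continued by its endpoint values and integrated. This keeps it bounded on the
whole line, which the free response later needs. -/
theorem exists_contDiff_extension {φ : ℝ → ℝ} {a b : ℝ} (hab : a < b)
    (h : ContDiffOn ℝ 1 φ (Icc a b)) :
    ∃ Φ Φ' : ℝ → ℝ, Continuous Φ' ∧ (∀ x, HasDerivAt Φ (Φ' x) x) ∧
      (∃ M, ∀ x, |Φ' x| ≤ M) ∧ ∀ x ∈ Icc a b, Φ x = φ x := by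
  have hd := h.continuousOn_derivWithin (uniqueDiffOn_Icc hab) le_rfl
  set Φ' : ℝ → ℝ := IccExtend hab.le ((Icc a b).domRestrict (derivWithin φ (Icc a b))) with hΦ'
  have hc : Continuous Φ' := (continuousOn_iff_continuous_domRestrict.mp hd).Icc_extend'
  obtain ⟨M, hM⟩ := isCompact_Icc.exists_bound_of_continuousOn hd
  refine ⟨fun x => φ a + ∫ t in a..x, Φ' t, Φ', hc, fun x => ?_, ⟨M, fun x => ?_⟩, fun x hx => ?_⟩
  · exact (hc.integral_hasStrictDerivAt a x).hasDerivAt.const_add (φ a)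
  · exact hM _ (projIcc a b hab.le x).2
  · have : ∫ t in a..x, Φ' t = φ x - φ a := by
      refine intervalIntegral.integral_eq_sub_of_hasDerivAt_of_le hx.1
        (h.continuousOn.mono (Icc_subset_Icc_right hx.2)) (fun t ht => ?_)
        (hc.intervalIntegrable _ _)
      have ht' : t ∈ Icc a b := ⟨ht.1.le, (ht.2.trans_le hx.2).le⟩
      have hΦt : Φ' t = derivWithin φ (Icc a b) t := by
        rw [hΦ', IccExtend_of_mem _ _ ht', domRestrict_apply]
      rw [hΦt]
      exact ((h.differentiableOn one_ne_zero) t ht').hasDerivWithinAt.hasDerivAt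
        (Icc_mem_nhds ht.1 (ht.2.trans_le hx.2))
    beta_reduce
    rw [this]
    ring

/-- Only ∂_z f is extended, by clamping, and integrated in z: a `SmoothKernel` requires no
derivative in its second variable. -/
theorem exists_smooth_extension₂ {f : ℝ → ℝ → ℝ}
    (h : ContDiffOn ℝ 1 (fun q : ℝ × ℝ => f q.1 q.2) (Icc 0 1 ×ˢ Icc 0 1)) :
    ∃ F F' : ℝ → ℝ → ℝ, SmoothKernel F F' ∧
      ∀ z ∈ Icc (0 : ℝ) 1, ∀ s ∈ Icc (0 : ℝ) 1, F z s = f z s := by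
  set S : Set (ℝ × ℝ) := Icc 0 1 ×ˢ Icc 0 1
  have hS : UniqueDiffOn ℝ S := (uniqueDiffOn_Icc one_pos).prod (uniqueDiffOn_Icc one_pos)
  have hd := h.continuousOn_fderivWithin hS le_rfl
  set G : ℝ → ℝ → ℝ := fun z s =>
    fderivWithin ℝ (fun q : ℝ × ℝ => f q.1 q.2) S (clamp z, clamp s) (1, 0) with hG
  have cG : Continuous fun q : ℝ × ℝ => G q.1 q.2 :=
    (hd.comp_continuous (f := fun q : ℝ × ℝ => (clamp q.1, clamp q.2)) (by fun_prop)
      fun q => ⟨clamp_mem _, clamp_mem _⟩).clm_apply continuous_const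
  have c0 := continuous_comp_clamp₂ h.continuousOn
  refine ⟨fun z s => f (clamp 0) (clamp s) + ∫ t in (0 : ℝ)..z, G t s, G, ⟨?_, cG, ?_⟩, ?_⟩
  · refine (c0.comp (f := fun q : ℝ × ℝ => (0, q.2)) (by fun_prop)).add ?_
    refine intervalIntegral.continuous_parametric_intervalIntegral_of_continuous (μ := volume)
      (f := fun (q : ℝ × ℝ) t => G t q.2) ?_ continuous_fst
    exact cG.comp (f := fun p : (ℝ × ℝ) × ℝ => (p.2, p.1.2)) (by fun_prop)
  · intro z s
    have hc : Continuous fun t => G t s := cG.comp (f := fun t => (t, s)) (by fun_prop)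
    exact (hc.integral_hasStrictDerivAt 0 z).hasDerivAt.const_add (f (clamp 0) (clamp s))
  · intro z hz s hs
    have hc : Continuous fun t => G t s := cG.comp (f := fun t => (t, s)) (by fun_prop)
    have : ∫ t in (0 : ℝ)..z, G t s = f z s - f 0 s := by
      refine intervalIntegral.integral_eq_sub_of_hasDerivAt_of_le (f := fun t => f t s) hz.1
        ?_ (fun t ht => ?_) (hc.intervalIntegrable _ _)
      · exact h.continuousOn.comp (f := fun t : ℝ => (t, s)) (by fun_prop)
          fun t ht => ⟨⟨ht.1, ht.2.trans hz.2⟩, hs⟩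
      · have ht' : t ∈ Icc (0 : ℝ) 1 := ⟨ht.1.le, (ht.2.trans_le hz.2).le⟩
        have h1 := ((h.differentiableOn one_ne_zero) (t, s) ⟨ht', hs⟩).hasFDerivWithinAt
        have h2 : HasDerivWithinAt (fun t : ℝ => (t, s)) ((1 : ℝ), (0 : ℝ)) (Icc 0 1) t :=
          (hasDerivWithinAt_id t _).prodMk (hasDerivWithinAt_const t _ s)
        have h3 := HasFDerivWithinAt.comp_hasDerivWithinAt t h1 h2 (t := S) fun x hx => ⟨hx, hs⟩
        have h4 := h3.hasDerivAt (Icc_mem_nhds ht.1 (ht.2.trans_le hz.2))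
        simp only [hG, clamp_of_mem ht', clamp_of_mem hs]
        exact h4
    beta_reduce
    rw [this, clamp_of_mem hs, clamp_of_mem (by simp)]
    ring

theorem SmoothKernel.mul {A A' B B' : ℝ → ℝ → ℝ} (hA : SmoothKernel A A') (hB : SmoothKernel B B') :
    SmoothKernel (fun z r => A z r * B z r) (fun z r => A' z r * B z r + A z r * B' z r) where
  cont := hA.cont.mul hB.cont
  cont_deriv := (hA.cont_deriv.mul hB.cont).add (hA.cont.mul hB.cont_deriv)
  hasDerivAt z r := (hA.hasDerivAt z r).mul (hB.hasDerivAt z r)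

theorem SmoothKernel.comp_sub {A A' : ℝ → ℝ → ℝ} (hA : SmoothKernel A A') :
    SmoothKernel (fun z r => A (z - r) r) (fun z r => A' (z - r) r) where
  cont := hA.cont.comp (f := fun q : ℝ × ℝ => (q.1 - q.2, q.2)) (by fun_prop)
  cont_deriv := hA.cont_deriv.comp (f := fun q : ℝ × ℝ => (q.1 - q.2, q.2)) (by fun_prop)
  hasDerivAt z r := (hA.hasDerivAt (z - r) r).comp_sub_const z r

theorem SmoothKernel.comp_sub_left {A A' : ℝ → ℝ → ℝ} (hA : SmoothKernel A A') :
    SmoothKernel (fun z r => A (r - z) r) (fun z r => -A' (r - z) r) where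
  cont := hA.cont.comp (f := fun q : ℝ × ℝ => (q.2 - q.1, q.2)) (by fun_prop)
  cont_deriv := (hA.cont_deriv.comp (f := fun q : ℝ × ℝ => (q.2 - q.1, q.2)) (by fun_prop)).neg
  hasDerivAt z r := (hA.hasDerivAt (r - z) r).comp_const_sub r z

theorem SmoothKernel.contDiff_integral {A A' : ℝ → ℝ → ℝ} (hA : SmoothKernel A A') :
    ContDiff ℝ 1 fun q : ℝ × ℝ => ∫ r in (0 : ℝ)..q.2, A q.1 r := by
  have := hA.contDiff_conv (IsPrimitive.of_hasDerivAt (B := fun _ => 1) (b := fun _ => 0)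
    continuous_const fun x => hasDerivAt_const x 1)
  simp only [mul_one] at this
  exact this.comp (f := fun q : ℝ × ℝ => ((0 : ℝ), q.1, q.2)) (by fun_prop)

theorem SmoothKernel.hasDerivAt_diag {A A' : ℝ → ℝ → ℝ} (hA : SmoothKernel A A') (a : ℝ) :
    HasDerivAt (fun a => ∫ r in (0 : ℝ)..a, A a r) (A a a + ∫ r in (0 : ℝ)..a, A' a r) a := by
  -- Reflecting the first variable reduces the claim to `SmoothKernel.hasDerivAt_shift` at z = -a:
  -- the argument -(-a + h) = a - h then moves together with the upper limit a - h.
  have hn : SmoothKernel (fun z r => A (-z) r) (fun z r => -A' (-z) r) :=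
    ⟨hA.cont.comp (f := fun q : ℝ × ℝ => (-q.1, q.2)) (by fun_prop),
      (hA.cont_deriv.comp (f := fun q : ℝ × ℝ => (-q.1, q.2)) (by fun_prop)).neg,
      fun z r => by
        have := HasDerivAt.scomp z (hA.hasDerivAt (-z) r) (hasDerivAt_neg z)
        rw [neg_smul, one_smul] at this
        exact this⟩
  have h1 := hn.hasDerivAt_shift (PiecewiseCont.of_continuous (b := fun _ => 1) continuous_const)
    (-a) a 0 (by simp)
  have h2 : HasDerivAt (fun x : ℝ => a - x) (-1) a := by simpa using (hasDerivAt_id a).const_sub a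
  have h3 := HasDerivAt.scomp_of_eq a h1 h2 (by simp)
  simp only [mul_one, neg_neg, neg_add_rev, intervalIntegral.integral_neg, smul_eq_mul] at h3
  refine (h3.congr_deriv (by ring)).congr_of_eventuallyEq (Eventually.of_forall fun x => ?_)
  simp

/-- The transformed gain is of class `C¹` when the data are. -/
theorem KernelData.contDiffOn_gainExt {g p : ℝ → ℝ} {f L L' K K' : ℝ → ℝ → ℝ}
    (h : KernelData g f L L' K K') (hp : ContDiffOn ℝ 1 p (Icc 0 1))
    (hg : ContDiffOn ℝ 1 g (Icc 0 1))
    (hf : ContDiffOn ℝ 1 (fun q : ℝ × ℝ => f q.1 q.2) (Icc 0 1 ×ˢ Icc 0 1)) :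
    ContDiffOn ℝ 1 (gainExt p L) (Icc 0 1) := by
  have cL := h.smooth_L.cont
  obtain ⟨P, P', hP', hP, -, hPp⟩ := exists_contDiff_extension one_pos hp
  obtain ⟨F, F', hF, hFf⟩ := exists_smooth_extension₂ hf
  have hPc : Continuous P := (continuous_iff_continuousAt.mpr fun x => (hP x).continuousAt)
  -- The Volterra term.
  have hPk : SmoothKernel (fun z _ => P z) (fun z _ => P' z) :=
    ⟨hPc.comp continuous_fst, hP'.comp continuous_fst, fun z _ => hP z⟩
  have t1 : ContDiff ℝ 1 fun s => ∫ r in (0 : ℝ)..s, P (s - r) * L (s - r) r :=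
    (hPk.mul h.smooth_L).comp_sub.contDiff_integral.comp (f := fun s : ℝ => (s, s)) (by fun_prop)
  -- The value of the kernel at `z = 0`, as an integral along the characteristic.
  have hLs : Continuous fun q : ℝ × ℝ × ℝ => L q.2.2 (q.2.1 - q.2.2) :=
    cL.comp (f := fun q : ℝ × ℝ × ℝ => (q.2.2, q.2.1 - q.2.2)) (by fun_prop)
  have hΘ : ∀ σ, SmoothKernel (fun a u => F a u * L u (σ - u)) (fun a u => F' a u * L u (σ - u)) :=
    fun σ => by
      have := hLs.comp (f := fun q : ℝ × ℝ => (0, σ, q.2)) (by fun_prop)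
      exact ⟨hF.cont.mul this, hF.cont_deriv.mul this, fun z r => (hF.hasDerivAt z r).mul_const _⟩
  have cint : ∀ H : ℝ → ℝ → ℝ, (Continuous fun q : ℝ × ℝ => H q.1 q.2) →
      Continuous fun q : ℝ × ℝ => (∫ u in (0 : ℝ)..q.2, H q.1 u * L u (q.2 - u)) -
        ∫ u in (0 : ℝ)..q.1, H q.1 u * L u (q.2 - u) := by
    intro H hH
    have hc : Continuous (Function.uncurry fun (q : ℝ × ℝ) u => H q.1 u * L u (q.2 - u)) :=
      (hH.comp (f := fun p : (ℝ × ℝ) × ℝ => (p.1.1, p.2)) (by fun_prop)).mul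
        (hLs.comp (f := fun p : (ℝ × ℝ) × ℝ => (p.1.1, p.1.2, p.2)) (by fun_prop))
    exact (intervalIntegral.continuous_parametric_intervalIntegral_of_continuous (μ := volume) hc
      continuous_snd).sub (intervalIntegral.continuous_parametric_intervalIntegral_of_continuous
        (μ := volume) hc continuous_fst)
  -- With σ = z + s as integration variable, L(0,s) = -g(1-s) - ∫_s^1 Ψ(σ-s, σ) dσ, where Ψ(a,σ) =
  -- F(a,σ) + ∫_a^σ F(a,u) L(u,σ-u) du. Now s enters only through a = σ - s and the lower limit, and
  -- L(u,σ-u) does not involve a. Only ∂_z f is used, never a derivative of L in its second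
  -- variable.
  have hΨ : SmoothKernel
      (fun a σ => F a σ + ((∫ u in (0 : ℝ)..σ, F a u * L u (σ - u)) -
        ∫ u in (0 : ℝ)..a, F a u * L u (σ - u)))
      (fun a σ => F' a σ + (((∫ u in (0 : ℝ)..σ, F' a u * L u (σ - u)) -
        ∫ u in (0 : ℝ)..a, F' a u * L u (σ - u)) - F a a * L a (σ - a))) := by
    refine ⟨hF.cont.add (cint F hF.cont), hF.cont_deriv.add ((cint F' hF.cont_deriv).sub ?_), ?_⟩
    · exact (hF.cont.comp (f := fun q : ℝ × ℝ => (q.1, q.1)) (by fun_prop)).mul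
        (cL.comp (f := fun q : ℝ × ℝ => (q.1, q.2 - q.1)) (by fun_prop))
    · intro a σ
      have d1 := (hΘ σ).hasDerivAt_integral (w := fun _ => 1) measurable_const
        (fun R => ⟨1, fun x _ => by simp⟩) a σ
      have d2 := (hΘ σ).hasDerivAt_diag a
      simp only [mul_one] at d1
      refine ((hF.hasDerivAt a σ).add (d1.sub d2)).congr_deriv ?_
      ring
  have t2 : ContDiff ℝ 1 fun s =>
      (∫ σ in (0 : ℝ)..1, (fun a σ => F a σ + ((∫ u in (0 : ℝ)..σ, F a u * L u (σ - u)) -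
        ∫ u in (0 : ℝ)..a, F a u * L u (σ - u))) (σ - s) σ) -
      ∫ σ in (0 : ℝ)..s, (fun a σ => F a σ + ((∫ u in (0 : ℝ)..σ, F a u * L u (σ - u)) -
        ∫ u in (0 : ℝ)..a, F a u * L u (σ - u))) (σ - s) σ :=
    (hΨ.comp_sub_left.contDiff_integral.comp (f := fun s : ℝ => (s, 1)) (by fun_prop)).sub
      (hΨ.comp_sub_left.contDiff_integral.comp (f := fun s : ℝ => (s, s)) (by fun_prop))
  have hg1 : ContDiffOn ℝ 1 (fun s => g (1 - s)) (Icc 0 1) :=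
    hg.comp (f := fun s : ℝ => 1 - s) (by fun_prop) fun s hs =>
      ⟨by linarith [hs.2], by linarith [hs.1]⟩
  refine ((hp.add (hg1.neg.sub t2.contDiffOn)).add t1.contDiffOn).congr fun s hs => ?_
  rw [gainExt, clamp_of_mem hs]
  congr 1
  · congr 1
    have cL' : Continuous fun z => L' z s :=
      h.smooth_L.cont_deriv.comp (f := fun z => (z, s)) (by fun_prop)
    have e1 : ∫ z in (0 : ℝ)..1 - s, L' z s = L (1 - s) s - L 0 s :=
      intervalIntegral.integral_eq_sub_of_hasDerivAt (fun z _ => h.smooth_L.hasDerivAt z s)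
        (cL'.intervalIntegrable _ _)
    have e2 := h.boundary (1 - s) ⟨by linarith [hs.2], by linarith [hs.1]⟩
    rw [sub_sub_cancel] at e2
    have hΨs : Continuous fun σ => (fun a σ => F a σ + ((∫ u in (0 : ℝ)..σ, F a u * L u (σ - u)) -
        ∫ u in (0 : ℝ)..a, F a u * L u (σ - u))) (σ - s) σ :=
      hΨ.cont.comp (f := fun σ : ℝ => (σ - s, σ)) (by fun_prop)
    rw [intervalIntegral.integral_interval_sub_left (hΨs.intervalIntegrable _ _)
      (hΨs.intervalIntegrable _ _)]
    have e3 : ∫ z in (0 : ℝ)..1 - s, L' z s = ∫ σ in s..1, (fun a σ => F a σ +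
        ((∫ u in (0 : ℝ)..σ, F a u * L u (σ - u)) -
        ∫ u in (0 : ℝ)..a, F a u * L u (σ - u))) (σ - s) σ := by
      have e4 := intervalIntegral.integral_comp_sub_right (a := s) (b := 1)
        (fun z => L' z s) s
      rw [sub_self] at e4
      rw [← e4]
      refine intervalIntegral.integral_congr fun σ hσ => ?_
      rw [uIcc_of_le hs.2] at hσ
      have hz : 0 ≤ σ - s := by linarith [hσ.1]
      have hzr : σ - s + s ≤ 1 := by linarith [hσ.2]
      have cFL : Continuous fun u => F (σ - s) u * L u (σ - u) :=
        (hΘ σ).cont.comp (f := fun u => (σ - s, u)) (by fun_prop)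
      beta_reduce
      rw [h.deriv_L (σ - s) s hz hs.1 hzr, shifted_eq f hz hs.1 hzr, sub_add_cancel,
        hFf (σ - s) ⟨hz, by linarith [hs.1, hσ.2]⟩ σ ⟨hs.1.trans hσ.1, hσ.2⟩,
        intervalIntegral.integral_interval_sub_left (cFL.intervalIntegrable _ _)
          (cFL.intervalIntegrable _ _)]
      have e5 := kcomp_eq (a := shifted f) (b := L) (A := f) (B := fun w s => L w (s - w))
        (fun z r => shifted_eq f) (fun z r _ _ _ => by rw [add_sub_cancel_left]) hz
        (show σ - s ≤ σ by linarith [hs.1]) hσ.2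
      rw [sub_sub_cancel] at e5
      rw [e5]
      congr 1
      refine intervalIntegral.integral_congr fun u hu => ?_
      rw [uIcc_of_le (by linarith [hs.1])] at hu
      rw [hFf (σ - s) ⟨hz, by linarith [hs.1, hσ.2]⟩ u ⟨hz.trans hu.1, hu.2.trans hσ.2⟩]
    rw [← e3, e1, e2]
    ring
  · have e := intervalIntegral.integral_comp_sub_left (a := 0) (b := s)
      (fun w => p (clamp w) * L w (s - w)) s
    rw [sub_self, sub_zero] at e
    rw [← e]
    refine intervalIntegral.integral_congr fun r hr => ?_
    rw [uIcc_of_le hs.1] at hr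
    have hm : s - r ∈ Icc (0 : ℝ) 1 := ⟨by linarith [hr.2], by linarith [hr.1, hs.2]⟩
    rw [clamp_of_mem hm, hPp _ hm, sub_sub_cancel]

/-! ### Existence of a kernel pair -/

section bounds

variable {a b : ℝ → ℝ → ℝ} {C δ lam z r : ℝ}

/-- Whichever factor carries the weight e^{λr}, composition gains 1/λ. This and its mirror image
make the kernel equations contractive for large λ. -/
theorem abs_kcomp_le_right (hl : 0 < lam) (hC : 0 ≤ C) (hδ : 0 ≤ δ) (hr : 0 ≤ r)
    (ha : ∀ w ∈ Icc 0 r, |a z w| ≤ C)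
    (hb : ∀ w ∈ Icc 0 r, |b (z + w) (r - w)| ≤ δ * Real.exp (lam * (r - w))) :
    |kcomp a b z r| ≤ C * δ / lam * Real.exp (lam * r) := by
  refine abs_integral_le_exp_sub hl (by positivity) hr fun w hw => ?_
  rw [abs_mul, mul_assoc]
  exact mul_le_mul (ha w hw) (hb w hw) (abs_nonneg _) hC

theorem abs_kcomp_le_left (hl : 0 < lam) (hC : 0 ≤ C) (hδ : 0 ≤ δ) (hr : 0 ≤ r)
    (ha : ∀ w ∈ Icc 0 r, |a z w| ≤ δ * Real.exp (lam * w))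
    (hb : ∀ w ∈ Icc 0 r, |b (z + w) (r - w)| ≤ C) :
    |kcomp a b z r| ≤ C * δ / lam * Real.exp (lam * r) := by
  refine abs_integral_le_exp hl (by positivity) hr fun w hw => ?_
  have hw' : w ∈ Icc 0 r := ⟨hw.1.le, hw.2⟩
  rw [abs_mul, mul_comm C δ, mul_right_comm]
  exact mul_le_mul (ha w hw') (hb w hw') (abs_nonneg _) (by positivity)

end bounds

theorem abs_integral_le_of_unit {φ : ℝ → ℝ} {x y M : ℝ} (hx : x ∈ Icc (0 : ℝ) 1)
    (hy : y ∈ Icc (0 : ℝ) 1) (hM : 0 ≤ M) (h : ∀ t ∈ Icc (0 : ℝ) 1, |φ t| ≤ M) :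
    |∫ t in x..y, φ t| ≤ M := by
  refine (intervalIntegral.norm_integral_le_of_norm_le_const (f := φ) (C := M) fun t ht => h t ?_).trans
    (mul_le_of_le_one_right hM ?_)
  · rcases le_total x y with hxy | hxy
    · rw [uIoc_of_le hxy] at ht
      exact ⟨hx.1.trans ht.1.le, ht.2.trans hy.2⟩
    · rw [uIoc_of_ge hxy] at ht
      exact ⟨hy.1.trans ht.1.le, ht.2.trans hx.2⟩
  · exact abs_le.mpr ⟨by linarith [hy.1, hx.2], by linarith [hx.1, hy.2]⟩

/-- The restriction of a continuous function to the unit square, extended by clamping. -/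
noncomputable def clampBCF (G : ℝ × ℝ → ℝ) (hG : Continuous G) :
    BoundedContinuousFunction (ℝ × ℝ) ℝ :=
  have hb := (isCompact_Icc.prod isCompact_Icc :
    IsCompact (Icc (0 : ℝ) 1 ×ˢ Icc (0 : ℝ) 1)).exists_bound_of_continuousOn hG.continuousOn
  .ofNormedAddCommGroup (fun q => G (clamp q.1, clamp q.2)) (by fun_prop) hb.choose
    fun _ => hb.choose_spec _ ⟨clamp_mem _, clamp_mem _⟩

/-- The linear part of the integral equations satisfied by the kernels. -/
noncomputable def kernelOp (F₁ F₂ c N : ℝ → ℝ → ℝ) (z r : ℝ) : ℝ :=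
  kcomp N c (1 - r) r - ∫ h in z..1 - r, (kcomp F₁ N h r - kcomp N F₂ h r)

section kernelOp

variable {F₁ F₂ c : ℝ → ℝ → ℝ}

theorem continuous_kernelOp (h₁ : Continuous fun q : ℝ × ℝ => F₁ q.1 q.2)
    (h₂ : Continuous fun q : ℝ × ℝ => F₂ q.1 q.2) (hc : Continuous fun q : ℝ × ℝ => c q.1 q.2)
    {N : ℝ → ℝ → ℝ} (hN : Continuous fun q : ℝ × ℝ => N q.1 q.2) :
    Continuous fun q : ℝ × ℝ => kernelOp F₁ F₂ c N q.1 q.2 :=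
  (smoothKernel_primitive (β := fun r => kcomp N c (1 - r) r)
    (E := fun h r => kcomp F₁ N h r - kcomp N F₂ h r)
    ((continuous_kcomp hN hc).comp (f := fun r : ℝ => (1 - r, r)) (by fun_prop))
    ((continuous_kcomp h₁ hN).sub (continuous_kcomp hN h₂))).cont

theorem kernelOp_sub (h₁ : Continuous fun q : ℝ × ℝ => F₁ q.1 q.2)
    (h₂ : Continuous fun q : ℝ × ℝ => F₂ q.1 q.2) (hc : Continuous fun q : ℝ × ℝ => c q.1 q.2)
    {N N' : ℝ → ℝ → ℝ} (hN : Continuous fun q : ℝ × ℝ => N q.1 q.2)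
    (hN' : Continuous fun q : ℝ × ℝ => N' q.1 q.2) (z r : ℝ) :
    kernelOp F₁ F₂ c N z r - kernelOp F₁ F₂ c N' z r =
      kernelOp F₁ F₂ c (fun z r => N z r - N' z r) z r := by
  have hi : ∀ N : ℝ → ℝ → ℝ, (Continuous fun q : ℝ × ℝ => N q.1 q.2) →
      IntervalIntegrable (fun h => kcomp F₁ N h r - kcomp N F₂ h r) volume z (1 - r) :=
    fun N hN => Continuous.intervalIntegrable
      (((continuous_kcomp h₁ hN).sub (continuous_kcomp hN h₂)).comp
        (f := fun h => (h, r)) (by fun_prop)) _ _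
  unfold kernelOp
  rw [kcomp_sub_left hN hN' hc, sub_sub_sub_comm, ← intervalIntegral.integral_sub (hi N hN)
    (hi N' hN')]
  simp only [kcomp_sub_left hN hN' h₂, kcomp_sub_right h₁ hN hN']
  congr 1
  refine intervalIntegral.integral_congr fun h _ => ?_
  ring

/-- The contraction principle for e^{-λr} N(z,r) in the sup norm: every term of `kernelOp` is a
composition and gains 1/λ. Clamping both variables gives a self-map of the bounded continuous
functions on the plane whose fixed point solves the equation on the unit square. -/
theorem exists_kernel_fixedPoint {b : ℝ → ℝ → ℝ}
    (h₁ : Continuous fun q : ℝ × ℝ => F₁ q.1 q.2)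
    (h₂ : Continuous fun q : ℝ × ℝ => F₂ q.1 q.2) (hc : Continuous fun q : ℝ × ℝ => c q.1 q.2)
    (hb : Continuous fun q : ℝ × ℝ => b q.1 q.2) :
    ∃ N : ℝ → ℝ → ℝ, (Continuous fun q : ℝ × ℝ => N q.1 q.2) ∧
      ∀ z ∈ Icc (0 : ℝ) 1, ∀ r ∈ Icc (0 : ℝ) 1, N z r = b z r + kernelOp F₁ F₂ c N z r := by
  -- Away from the triangle the first argument h + w of a composed kernel can reach 2.
  have hcomp : IsCompact (Icc (0 : ℝ) 2 ×ˢ Icc (0 : ℝ) 2) := isCompact_Icc.prod isCompact_Icc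
  obtain ⟨C₁, hC₁⟩ := hcomp.exists_bound_of_continuousOn h₁.continuousOn
  obtain ⟨C₂, hC₂⟩ := hcomp.exists_bound_of_continuousOn h₂.continuousOn
  obtain ⟨C₃, hC₃⟩ := hcomp.exists_bound_of_continuousOn hc.continuousOn
  have h00 : ((0 : ℝ), (0 : ℝ)) ∈ Icc (0 : ℝ) 2 ×ˢ Icc (0 : ℝ) 2 := by simp
  have p₁ : 0 ≤ C₁ := (norm_nonneg _).trans (hC₁ _ h00)
  have p₂ : 0 ≤ C₂ := (norm_nonneg _).trans (hC₂ _ h00)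
  have p₃ : 0 ≤ C₃ := (norm_nonneg _).trans (hC₃ _ h00)
  set lam : ℝ := 2 * (C₁ + C₂ + C₃) + 1 with hlam
  have hl : 0 < lam := by positivity
  have est : ∀ (m : ℝ → ℝ → ℝ) (δ : ℝ), 0 ≤ δ →
      (∀ z r, 0 ≤ r → r ≤ 1 → |m z r| ≤ δ * Real.exp (lam * r)) →
      ∀ z ∈ Icc (0 : ℝ) 1, ∀ r ∈ Icc (0 : ℝ) 1,
        |kernelOp F₁ F₂ c m z r| ≤ δ / 2 * Real.exp (lam * r) := by
    intro m δ hδ hm z hz r hr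
    have b1 : |kcomp m c (1 - r) r| ≤ C₃ * δ / lam * Real.exp (lam * r) :=
      abs_kcomp_le_left hl p₃ hδ hr.1 (fun w hw => hm _ w hw.1 (hw.2.trans hr.2)) fun w hw =>
        hC₃ (1 - r + w, r - w) ⟨⟨by linarith [hw.1, hr.2], by linarith [hw.2]⟩,
          ⟨by linarith [hw.2], by linarith [hw.1, hr.2]⟩⟩
    have b2 : |∫ h in z..1 - r, (kcomp F₁ m h r - kcomp m F₂ h r)| ≤
        C₁ * δ / lam * Real.exp (lam * r) + C₂ * δ / lam * Real.exp (lam * r) := by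
      refine abs_integral_le_of_unit hz ⟨by linarith [hr.2], by linarith [hr.1]⟩ (by positivity)
        fun h hh => (abs_sub _ _).trans (add_le_add ?_ ?_)
      · exact abs_kcomp_le_right hl p₁ hδ hr.1
          (fun w hw => hC₁ (h, w) ⟨⟨hh.1, by linarith [hh.2]⟩, ⟨hw.1, by linarith [hw.2, hr.2]⟩⟩)
          fun w hw => hm _ _ (by linarith [hw.2]) (by linarith [hw.1, hr.2])
      · exact abs_kcomp_le_left hl p₂ hδ hr.1 (fun w hw => hm _ w hw.1 (hw.2.trans hr.2))
          fun w hw => hC₂ (h + w, r - w) ⟨⟨by linarith [hh.1, hw.1], by linarith [hw.2, hr.2, hh.2]⟩,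
            ⟨by linarith [hw.2], by linarith [hw.1, hr.2]⟩⟩
    refine (abs_sub _ _).trans ((add_le_add b1 b2).trans ?_)
    rw [← add_mul, ← add_mul, ← add_div, ← add_div]
    refine mul_le_mul_of_nonneg_right ?_ (Real.exp_nonneg _)
    rw [div_le_iff₀ hl]
    nlinarith
  have cw : ∀ N : BoundedContinuousFunction (ℝ × ℝ) ℝ,
      Continuous fun q : ℝ × ℝ => Real.exp (lam * q.2) * N (q.1, q.2) := fun N => by fun_prop
  have cG : ∀ N : BoundedContinuousFunction (ℝ × ℝ) ℝ, Continuous fun q : ℝ × ℝ =>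
      Real.exp (-(lam * q.2)) * (b q.1 q.2 +
        kernelOp F₁ F₂ c (fun z r => Real.exp (lam * r) * N (z, r)) q.1 q.2) := fun N =>
    (by fun_prop : Continuous fun q : ℝ × ℝ => Real.exp (-(lam * q.2))).mul
      (hb.add (continuous_kernelOp h₁ h₂ hc (cw N)))
  set Ψ : BoundedContinuousFunction (ℝ × ℝ) ℝ → BoundedContinuousFunction (ℝ × ℝ) ℝ :=
    fun N => clampBCF _ (cG N) with hΨ
  have hcontr : ContractingWith (1 / 2) Ψ := by
    refine ⟨by rw [← NNReal.coe_lt_coe]; norm_num, LipschitzWith.of_dist_le_mul fun N N' => ?_⟩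
    rw [BoundedContinuousFunction.dist_le (by positivity)]
    rintro ⟨z, r⟩
    change |Real.exp (-(lam * clamp r)) * (b (clamp z) (clamp r) + _) -
      Real.exp (-(lam * clamp r)) * (b (clamp z) (clamp r) + _)| ≤ _
    rw [← mul_sub, add_sub_add_left_eq_sub, kernelOp_sub h₁ h₂ hc (cw N) (cw N'), abs_mul,
      abs_of_pos (Real.exp_pos _)]
    have := est (fun z r => Real.exp (lam * r) * N (z, r) - Real.exp (lam * r) * N' (z, r))
      (dist N N') dist_nonneg (fun z r _ _ => ?_) _ (clamp_mem z) _ (clamp_mem r)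
    · calc _ ≤ Real.exp (-(lam * clamp r)) * (dist N N' / 2 * Real.exp (lam * clamp r)) :=
            mul_le_mul_of_nonneg_left this (Real.exp_nonneg _)
        _ = _ := by
            rw [mul_comm, mul_assoc, ← Real.exp_add, add_neg_cancel, Real.exp_zero]
            push_cast
            ring
    · rw [← mul_sub, abs_mul, abs_of_pos (Real.exp_pos _), mul_comm]
      exact mul_le_mul_of_nonneg_right (BoundedContinuousFunction.dist_coe_le_dist (f := N) (g := N') (z, r))
        (Real.exp_nonneg _)
  set N := hcontr.fixedPoint Ψ
  have hN : Ψ N = N := hcontr.fixedPoint_isFixedPt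
  refine ⟨fun z r => Real.exp (lam * r) * N (z, r), cw N, fun z hz r hr => ?_⟩
  have e : N (z, r) = Real.exp (-(lam * clamp r)) * (b (clamp z) (clamp r) +
      kernelOp F₁ F₂ c (fun z r => Real.exp (lam * r) * N (z, r)) (clamp z) (clamp r)) := by
    conv_lhs => rw [← hN]
    rfl
  rw [clamp_of_mem hz, clamp_of_mem hr] at e
  beta_reduce
  conv_lhs => rw [e, ← mul_assoc, ← Real.exp_add, add_neg_cancel, Real.exp_zero, one_mul]

end kernelOp

/-- A Leibniz rule without boundary terms, since at fixed r the limits of integration do not depend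
on z. -/
theorem SmoothKernel.kcomp {A A' B B' : ℝ → ℝ → ℝ} (hA : SmoothKernel A A')
    (hB : SmoothKernel B B') :
    SmoothKernel (_root_.kcomp A B)
      (fun z r => _root_.kcomp A' B z r + _root_.kcomp A B' z r) where
  cont := continuous_kcomp hA.cont hB.cont
  cont_deriv := (continuous_kcomp hA.cont_deriv hB.cont).add
    (continuous_kcomp hA.cont hB.cont_deriv)
  hasDerivAt z r := by
    have hs : SmoothKernel (fun z w => B (z + w) (r - w)) (fun z w => B' (z + w) (r - w)) :=
      ⟨hB.cont.comp (f := fun q : ℝ × ℝ => (q.1 + q.2, r - q.2)) (by fun_prop),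
        hB.cont_deriv.comp (f := fun q : ℝ × ℝ => (q.1 + q.2, r - q.2)) (by fun_prop),
        fun z w => (hB.hasDerivAt (z + w) (r - w)).comp_add_const z w⟩
    have := (hA.mul hs).hasDerivAt_integral (w := fun _ => 1) measurable_const
      (fun R => ⟨1, fun x _ => by simp⟩) z r
    simp only [mul_one] at this
    refine this.congr_deriv ?_
    exact intervalIntegral.integral_add (kcomp_integrable hA.cont_deriv hB.cont z r _ _)
      (kcomp_integrable hA.cont hB.cont_deriv z r _ _)

/-- The homogeneous kernel equation has only the trivial solution. -/
theorem eq_zero_of_kernelOp {F₁ F₂ c m : ℝ → ℝ → ℝ}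
    (h₁ : Continuous fun q : ℝ × ℝ => F₁ q.1 q.2)
    (h₂ : Continuous fun q : ℝ × ℝ => F₂ q.1 q.2) (hc : Continuous fun q : ℝ × ℝ => c q.1 q.2)
    (hm : Continuous fun q : ℝ × ℝ => m q.1 q.2)
    (h : ∀ z r, 0 ≤ z → 0 ≤ r → z + r ≤ 1 → m z r = kernelOp F₁ F₂ c m z r) :
    ∀ z r, 0 ≤ z → 0 ≤ r → z + r ≤ 1 → m z r = 0 := by
  have hcomp : IsCompact (Icc (0 : ℝ) 1 ×ˢ Icc (0 : ℝ) 1) := isCompact_Icc.prod isCompact_Icc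
  obtain ⟨C₁, hC₁⟩ := hcomp.exists_bound_of_continuousOn h₁.continuousOn
  obtain ⟨C₂, hC₂⟩ := hcomp.exists_bound_of_continuousOn h₂.continuousOn
  obtain ⟨C₃, hC₃⟩ := hcomp.exists_bound_of_continuousOn hc.continuousOn
  obtain ⟨B, hB⟩ := hcomp.exists_bound_of_continuousOn hm.continuousOn
  have h00 : ((0 : ℝ), (0 : ℝ)) ∈ Icc (0 : ℝ) 1 ×ˢ Icc (0 : ℝ) 1 := by simp
  have p₁ : 0 ≤ C₁ := (norm_nonneg _).trans (hC₁ _ h00)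
  have p₂ : 0 ≤ C₂ := (norm_nonneg _).trans (hC₂ _ h00)
  have p₃ : 0 ≤ C₃ := (norm_nonneg _).trans (hC₃ _ h00)
  have hB0 : 0 ≤ B := (norm_nonneg _).trans (hB _ h00)
  set lam : ℝ := 2 * (C₁ + C₂ + C₃) + 1 with hlam
  have hl : 0 < lam := by positivity
  have h0 : ∀ z r, 0 ≤ z → 0 ≤ r → z + r ≤ 1 → |m z r| ≤ B * Real.exp (lam * r) := by
    intro z r hz hr hzr
    refine (hB (z, r) ⟨⟨hz, by linarith⟩, ⟨hr, by linarith⟩⟩).trans ?_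
    exact le_mul_of_one_le_right hB0 (Real.one_le_exp (by positivity))
  have hs : ∀ δ, 0 ≤ δ → (∀ z r, 0 ≤ z → 0 ≤ r → z + r ≤ 1 → |m z r| ≤ δ * Real.exp (lam * r)) →
      ∀ z r, 0 ≤ z → 0 ≤ r → z + r ≤ 1 → |m z r| ≤ δ / 2 * Real.exp (lam * r) := by
    intro δ hδ ih z r hz hr hzr
    have b1 : |kcomp m c (1 - r) r| ≤ C₃ * δ / lam * Real.exp (lam * r) :=
      abs_kcomp_le_left hl p₃ hδ hr (fun w hw => ih _ w (by linarith) hw.1 (by linarith [hw.2]))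
        fun w hw => hC₃ (1 - r + w, r - w) ⟨⟨by linarith [hw.1], by linarith [hw.2]⟩,
          ⟨by linarith [hw.2], by linarith [hw.1]⟩⟩
    have b2 : |∫ h in z..1 - r, (kcomp F₁ m h r - kcomp m F₂ h r)| ≤
        C₁ * δ / lam * Real.exp (lam * r) + C₂ * δ / lam * Real.exp (lam * r) := by
      refine (intervalIntegral.norm_integral_le_of_norm_le_const
        (f := fun h => kcomp F₁ m h r - kcomp m F₂ h r) (C := C₁ * δ / lam * Real.exp (lam * r) + C₂ * δ / lam * Real.exp (lam * r))
        fun h hh => ?_).trans (mul_le_of_le_one_right (by positivity)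
          (abs_le.mpr ⟨by linarith, by linarith⟩))
      rw [uIoc_of_le (by linarith)] at hh
      have h0 : 0 ≤ h := hz.trans hh.1.le
      refine (abs_sub _ _).trans (add_le_add ?_ ?_)
      · exact abs_kcomp_le_right hl p₁ hδ hr
          (fun w hw => hC₁ (h, w) ⟨⟨h0, by linarith [hh.2]⟩, ⟨hw.1, by linarith [hw.2]⟩⟩)
          fun w hw => ih _ _ (by linarith [hw.1]) (by linarith [hw.2]) (by linarith [hh.2])
      · exact abs_kcomp_le_left hl p₂ hδ hr
          (fun w hw => ih _ w h0 hw.1 (by linarith [hw.2, hh.2]))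
          fun w hw => hC₂ (h + w, r - w) ⟨⟨by linarith [hw.1], by linarith [hw.2, hh.2]⟩,
            ⟨by linarith [hw.2], by linarith [hw.1]⟩⟩
    rw [h z r hz hr hzr]
    refine (abs_sub _ _).trans ((add_le_add b1 b2).trans ?_)
    rw [← add_mul, ← add_mul, ← add_div, ← add_div]
    refine mul_le_mul_of_nonneg_right ?_ (Real.exp_nonneg _)
    rw [div_le_iff₀ hl]
    nlinarith
  obtain ⟨B, -, hn⟩ := exists_div_two_pow ⟨B, hB0, h0⟩ hs
  exact fun z r hz hr hzr => eq_zero_of_abs_le_div_two_pow fun n => hn n z r hz hr hzr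

/-- Integrating along r = const from the point z = 1 - r of the side s = 1 turns both problems into
N = b + `kernelOp` N with the same b. For l the linear part has F₁ = f, F₂ = c = 0; for k it has F₁
= 0, F₂ = f, c = g. The inverse relation is then proved, not built in. -/
theorem exists_isKernelPair {g : ℝ → ℝ} {f : ℝ → ℝ → ℝ} (hg : ContinuousOn g (Icc 0 1))
    (hf : ContinuousOn (fun q : ℝ × ℝ => f q.1 q.2) (Icc 0 1 ×ˢ Icc 0 1)) :
    ∃ k l : ℝ → ℝ → ℝ, IsKernelPair g f k l := by
  have hF := continuous_shifted hf
  have hgc := continuous_comp_clamp hg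
  set F := shifted f with hFdef
  set c : ℝ → ℝ → ℝ := fun z _ => g (clamp z) with hcdef
  have hc : Continuous fun q : ℝ × ℝ => c q.1 q.2 := hgc.comp continuous_fst
  have h0 : Continuous fun q : ℝ × ℝ => (fun _ _ => 0 : ℝ → ℝ → ℝ) q.1 q.2 := continuous_const
  have hgr : Continuous fun r : ℝ => -g (clamp (1 - r)) :=
    (hgc.comp (f := fun r : ℝ => 1 - r) (by fun_prop)).neg
  have hb := smoothKernel_primitive (β := fun r => -g (clamp (1 - r))) hgr hF
  obtain ⟨L₀, cL₀, hL₀⟩ := exists_kernel_fixedPoint (F₁ := F) (F₂ := fun _ _ => 0)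
    (c := fun _ _ => 0) (b := fun z r => -g (clamp (1 - r)) - ∫ h in z..1 - r, F h r) hF h0 h0 hb.cont
  obtain ⟨K₀, cK₀, hK₀⟩ := exists_kernel_fixedPoint (F₁ := fun _ _ => 0) (F₂ := F) (c := c)
    (b := fun z r => -g (clamp (1 - r)) - ∫ h in z..1 - r, F h r) h0 hF hc hb.cont
  have cFL := continuous_kcomp hF cL₀
  have cKF := continuous_kcomp cK₀ hF
  -- The fixed points are merely continuous. Reinserting them into their equations yields kernels
  -- differentiable in z that agree with them on the triangle.
  have hL := smoothKernel_primitive (β := fun r => -g (clamp (1 - r)))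
    (E := fun z r => F z r + kcomp F L₀ z r) hgr (hF.add cFL)
  have hK := smoothKernel_primitive (β := fun r => -g (clamp (1 - r)) + kcomp K₀ c (1 - r) r)
    (E := fun z r => F z r - kcomp K₀ F z r)
    (hgr.add ((continuous_kcomp cK₀ hc).comp (f := fun r : ℝ => (1 - r, r)) (by fun_prop)))
    (hF.sub cKF)
  have z1 : ∀ a z r, kcomp a (fun _ _ => 0) z r = 0 := fun a z r => by simp [kcomp]
  have z2 : ∀ a z r, kcomp (fun _ _ => 0) a z r = 0 := fun a z r => by simp [kcomp]
  have sl : ∀ E : ℝ → ℝ → ℝ, (Continuous fun q : ℝ × ℝ => E q.1 q.2) → ∀ r,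
      Continuous fun h => E h r := fun E hE r => hE.comp (f := fun h => (h, r)) (by fun_prop)
  set L : ℝ → ℝ → ℝ := fun z r => -g (clamp (1 - r)) - ∫ h in z..1 - r, (F h r + kcomp F L₀ h r)
    with hLdef
  set K : ℝ → ℝ → ℝ := fun z r => -g (clamp (1 - r)) + kcomp K₀ c (1 - r) r -
    ∫ h in z..1 - r, (F h r - kcomp K₀ F h r) with hKdef
  have eL : ∀ z r, 0 ≤ z → 0 ≤ r → z + r ≤ 1 → L₀ z r = L z r := fun z r hz hr hzr => by
    rw [hL₀ z ⟨hz, by linarith⟩ r ⟨hr, by linarith⟩, kernelOp, hLdef]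
    simp only [z1, sub_zero]
    rw [intervalIntegral.integral_add ((sl _ hF r).intervalIntegrable _ _)
      ((sl _ cFL r).intervalIntegrable _ _)]
    ring
  have eK : ∀ z r, 0 ≤ z → 0 ≤ r → z + r ≤ 1 → K₀ z r = K z r := fun z r hz hr hzr => by
    rw [hK₀ z ⟨hz, by linarith⟩ r ⟨hr, by linarith⟩, kernelOp, hKdef]
    simp only [z2, zero_sub, intervalIntegral.integral_neg]
    rw [intervalIntegral.integral_sub ((sl _ hF r).intervalIntegrable _ _)
      ((sl _ cKF r).intervalIntegrable _ _)]
    ring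
  have cL := hL.cont
  have cK := hK.cont
  have dL : ∀ z r, 0 ≤ z → 0 ≤ r → z + r ≤ 1 → F z r + kcomp F L₀ z r = F z r + kcomp F L z r :=
    fun z r hz hr hzr => by rw [kcomp_congr hz hr hzr (a' := F) (fun _ _ _ _ _ => rfl) eL]
  have dK : ∀ z r, 0 ≤ z → 0 ≤ r → z + r ≤ 1 → F z r - kcomp K₀ F z r = F z r - kcomp K F z r :=
    fun z r hz hr hzr => by rw [kcomp_congr hz hr hzr (b' := F) eK (fun _ _ _ _ _ => rfl)]
  have bL : ∀ z r, 0 ≤ z → 0 ≤ r → z + r = 1 → L z r = -c z r := fun z r hz hr hzr => by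
    rw [hLdef, hcdef, ← hzr]
    simp
  have bK : ∀ z r, 0 ≤ z → 0 ≤ r → z + r = 1 → K z r = -c z r + kcomp K c z r :=
    fun z r hz hr hzr => by
      rw [← kcomp_congr hz hr hzr.le (b := c) eK (fun _ _ _ _ _ => rfl), hKdef, hcdef, ← hzr]
      simp
  have cLK := continuous_kcomp cL cK
  have cFLc := continuous_kcomp hF cL
  have cKFc := continuous_kcomp cK hF
  -- The defect of the inverse relation. The Leibniz rule and associativity give ∂_z m = F∘m - m∘F.
  set m : ℝ → ℝ → ℝ := fun z r => K z r + kcomp L K z r - L z r with hmdef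
  have cKLK : Continuous fun q : ℝ × ℝ => K q.1 q.2 + kcomp L K q.1 q.2 := cK.add cLK
  have hm : Continuous fun q : ℝ × ℝ => m q.1 q.2 := cKLK.sub cL
  have mz : ∀ z r, 0 ≤ z → 0 ≤ r → z + r ≤ 1 → m z r = 0 := by
    refine eq_zero_of_kernelOp (F₁ := F) (F₂ := F) (c := c) hF hF hc hm fun z r hz hr hzr => ?_
    have hd : ∀ h, HasDerivAt (fun z => m z r) ((F h r - kcomp K₀ F h r) +
        (kcomp (fun z r => F z r + kcomp F L₀ z r) K h r +
          kcomp L (fun z r => F z r - kcomp K₀ F z r) h r) - (F h r + kcomp F L₀ h r)) h :=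
      fun h => ((hK.hasDerivAt h r).add ((hL.kcomp hK).hasDerivAt h r)).sub (hL.hasDerivAt h r)
    have cd : Continuous fun q : ℝ × ℝ => (F q.1 q.2 - kcomp K₀ F q.1 q.2) +
        (kcomp (fun z r => F z r + kcomp F L₀ z r) K q.1 q.2 +
          kcomp L (fun z r => F z r - kcomp K₀ F z r) q.1 q.2) - (F q.1 q.2 + kcomp F L₀ q.1 q.2) :=
      (hK.cont_deriv.add (hL.kcomp hK).cont_deriv).sub hL.cont_deriv
    have hint := intervalIntegral.integral_eq_sub_of_hasDerivAt (a := z) (b := 1 - r)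
      (fun h _ => hd h) ((cd.comp (f := fun h => (h, r)) (by fun_prop)).intervalIntegrable _ _)
    -- On s = 1, L = -c and K = -c + K∘c. The second factor of L∘K is evaluated on s = 1 as well, so
    -- m = K∘c + L∘K∘c - L∘c = m∘c there.
    have hbd : m (1 - r) r = kcomp m c (1 - r) r := by
      have h1r : 0 ≤ 1 - r := by linarith
      have e1 : kcomp L K (1 - r) r = kcomp L (fun z r => kcomp K c z r - c z r) (1 - r) r := by
        refine intervalIntegral.integral_congr fun w hw => ?_
        rw [uIcc_of_le hr] at hw
        beta_reduce
        rw [bK (1 - r + w) (r - w) (by linarith [hw.1]) (by linarith [hw.2]) (by ring)]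
        ring
      rw [hmdef, kcomp_sub_left (a := fun z r => K z r + kcomp L K z r) cKLK cL hc,
        kcomp_add_left cK cLK hc, kcomp_assoc cL cK hc hr]
      beta_reduce
      rw [e1, kcomp_sub_right cL (continuous_kcomp cK hc) hc, bK _ _ h1r hr (by ring),
        bL _ _ h1r hr (by ring)]
      ring
    have hin : ∀ h ∈ uIcc z (1 - r), ((F h r - kcomp K₀ F h r) +
        (kcomp (fun z r => F z r + kcomp F L₀ z r) K h r +
          kcomp L (fun z r => F z r - kcomp K₀ F z r) h r) - (F h r + kcomp F L₀ h r)) =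
        kcomp F m h r - kcomp m F h r := by
      intro h hh
      rw [uIcc_of_le (by linarith)] at hh
      have hz' : 0 ≤ h := hz.trans hh.1
      have hzr' : h + r ≤ 1 := by linarith [hh.2]
      rw [dK h r hz' hr hzr', dL h r hz' hr hzr', kcomp_congr hz' hr hzr' (b' := K) dL
        (fun _ _ _ _ _ => rfl), kcomp_congr hz' hr hzr' (a' := L) (fun _ _ _ _ _ => rfl) dK,
        kcomp_add_left hF cFLc cK, kcomp_sub_right cL hF cKFc, hmdef,
        kcomp_sub_left (a := fun z r => K z r + kcomp L K z r) cKLK cL hF,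
        kcomp_add_left cK cLK hF,
        kcomp_sub_right (b := fun z r => K z r + kcomp L K z r) hF cKLK cL,
        kcomp_add_right hF cK cLK, kcomp_assoc cL cK hF hr, kcomp_assoc hF cL cK hr]
      ring
    rw [kernelOp, ← hbd, ← intervalIntegral.integral_congr hin, hint]
    ring
  have fc : ∀ z s : ℝ, (z, s) ∈ kernelTriangle → F z (s - z) = f z s := fun z s hzs => by
    rw [hFdef, shifted_eq f hzs.1 (by linarith [hzs.2.1]) (by linarith [hzs.2.2]), add_sub_cancel]
  have cz : ∀ z r, z ∈ Icc (0 : ℝ) 1 → c z r = g z := fun z r hz => by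
    simp only [hcdef, clamp_of_mem hz]
  have sh : ∀ A : ℝ → ℝ → ℝ, ∀ z r, 0 ≤ z → 0 ≤ r → z + r ≤ 1 →
      A z r = (fun z s => A z (s - z)) z (z + r) := fun A z r _ _ _ => by
    beta_reduce; rw [add_sub_cancel_left]
  have dir : ∀ A A' : ℝ → ℝ → ℝ, SmoothKernel A A' → ∀ z s : ℝ,
      HasDerivAt (fun h => A (z + h) (s + h - (z + h))) (A' z (s - z)) 0 := fun A A' hA z s => by
    have := hA.hasDerivAt (z + 0) (s - z)
    have := this.comp_const_add z 0
    simpa using this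
  refine ⟨fun z s => K z (s - z), fun z s => L z (s - z), ⟨?_, ?_, ?_, ?_, ?_, ?_, ?_⟩⟩
  · exact (cK.comp (f := fun q : ℝ × ℝ => (q.1, q.2 - q.1)) (by fun_prop)).continuousOn
  · exact (cL.comp (f := fun q : ℝ × ℝ => (q.1, q.2 - q.1)) (by fun_prop)).continuousOn
  · intro z hz
    rw [bL z (1 - z) hz.1 (by linarith [hz.2]) (by ring), cz z (1 - z) hz]
  · intro z s hzs
    have e := kcomp_eq (a := F) (A := f) (b := L) (B := fun z s => L z (s - z))
      (fun z r => shifted_eq f) (sh L) hzs.1 hzs.2.1 hzs.2.2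
    rw [← e, ← fc z s hzs, ← dL z (s - z) hzs.1 (by linarith [hzs.2.1]) (by linarith [hzs.2.2])]
    exact (dir L _ hL z s).hasDerivWithinAt
  · intro z hz
    have e := kcomp_eq (a := K) (A := fun z s => K z (s - z)) (b := c)
      (B := fun z _ => g z) (sh K)
      (fun z r hz hr hzr => cz z r ⟨hz, by linarith⟩) hz.1 hz.2 le_rfl
    rw [← e]
    rw [bK z (1 - z) hz.1 (by linarith [hz.2]) (by ring), cz z (1 - z) hz]
  · intro z s hzs
    have e := kcomp_eq (a := K) (A := fun z s => K z (s - z)) (b := F) (B := f)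
      (sh K) (fun z r => shifted_eq f) hzs.1 hzs.2.1 hzs.2.2
    rw [← e, ← fc z s hzs, ← dK z (s - z) hzs.1 (by linarith [hzs.2.1]) (by linarith [hzs.2.2])]
    exact (dir K _ hK z s).hasDerivWithinAt
  · intro z s hzs
    have e := kcomp_eq (a := L) (A := fun z s => L z (s - z)) (b := K)
      (B := fun z s => K z (s - z)) (sh L) (sh K) hzs.1 hzs.2.1 hzs.2.2
    have := mz z (s - z) hzs.1 (by linarith [hzs.2.1]) (by linarith [hzs.2.2])
    rw [← e]
    rw [hmdef] at this
    beta_reduce at this ⊢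
    linarith

/-! ### The delay equation for the inlet values -/

theorem integral_mul_indicator_sub (κ m : ℝ → ℝ) {t a : ℝ} (ht : 0 ≤ t) (ha : 0 ≤ a) :
    ∫ s in (0 : ℝ)..a, κ s * (Ici (0 : ℝ)).indicator m (t - s) =
      ∫ s in (0 : ℝ)..min t a, κ s * m (t - s) := by
  rw [intervalIntegral.integral_of_le ha, intervalIntegral.integral_of_le (le_min ht ha)]
  have : ∀ s, κ s * (Ici (0 : ℝ)).indicator m (t - s) =
      (Iic t).indicator (fun s => κ s * m (t - s)) s := fun s => by
    by_cases h : s ≤ t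
    · rw [indicator_of_mem (show s ∈ Iic t from h), indicator_of_mem (show t - s ∈ Ici 0 by simpa)]
    · rw [indicator_of_notMem (show s ∉ Iic t from h),
        indicator_of_notMem (show t - s ∉ Ici 0 by simpa using h), mul_zero]
  simp only [this]
  rw [setIntegral_indicator measurableSet_Iic, Ioc_inter_Iic, min_comm]

/-- The Volterra equation `m(t) + ∫_0^{min(t,1)} κ(s) m(t-s) ds = h(t)` on the half-line. -/
theorem exists_volterra {κ h : ℝ → ℝ} (hκ : Continuous κ) (hh : Continuous h) {H : ℝ}
    (hH : ∀ t, 0 ≤ t → |h t| ≤ H) :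
    ∃ m : ℝ → ℝ, Continuous m ∧ ∀ t, 0 ≤ t →
      m t + ∫ s in (0 : ℝ)..1, κ s * (Ici (0 : ℝ)).indicator m (t - s) = h t := by
  obtain ⟨C, hC⟩ := (isCompact_Icc (a := (0 : ℝ)) (b := 1)).exists_bound_of_continuousOn
    hκ.continuousOn
  have hC0 : 0 ≤ C := (norm_nonneg _).trans (hC 0 (by simp))
  -- The fixed point is sought for e^{-lam t} m(t), for which the convolution contracts by C/lam ≤
  -- 1/2 uniformly on the half-line.
  set lam : ℝ := 2 * C + 1 with hlam
  have hl : 0 < lam := by positivity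
  have est : ∀ (N : ℝ → ℝ) (δ : ℝ), 0 ≤ δ → (∀ t, |N t| ≤ δ) → ∀ t, 0 ≤ t →
      |∫ s in (0 : ℝ)..min t 1, κ s * (Real.exp (-(lam * s)) * N (t - s))| ≤ C * δ / lam := by
    intro N δ hδ hN t ht
    have := abs_integral_le_exp_sub (r := min t 1)
      (φ := fun s => κ s * (Real.exp (-(lam * s)) * N (t - s)))
      (M := C * δ * Real.exp (-(lam * min t 1))) hl (by positivity) (le_min ht zero_le_one)
      fun s hs => ?_
    · refine this.trans_eq ?_
      rw [mul_div_right_comm, mul_assoc, ← Real.exp_add, neg_add_cancel, Real.exp_zero, mul_one]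
    · rw [mul_assoc (C * δ), ← Real.exp_add, show -(lam * min t 1) + lam * (min t 1 - s) =
        -(lam * s) by ring, abs_mul, abs_mul, abs_of_pos (Real.exp_pos _), mul_assoc C,
        mul_comm δ]
      exact mul_le_mul (hC s ⟨hs.1, hs.2.trans (min_le_right _ _)⟩)
        (mul_le_mul_of_nonneg_left (hN _) (Real.exp_nonneg _)) (by positivity) hC0
  set Φ : (ℝ → ℝ) → ℝ → ℝ := fun N t => Real.exp (-(lam * max t 0)) * h (max t 0) -
    ∫ s in (0 : ℝ)..min (max t 0) 1, κ s * (Real.exp (-(lam * s)) * N (max t 0 - s)) with hΦ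
  have cΦ : ∀ N : BoundedContinuousFunction ℝ ℝ, Continuous (Φ N) := fun N => by
    refine Continuous.sub (by fun_prop) ?_
    refine intervalIntegral.continuous_parametric_intervalIntegral_of_continuous (μ := volume)
      (f := fun t s => κ s * (Real.exp (-(lam * s)) * N (max t 0 - s))) ?_ (by fun_prop)
    simp only [Function.uncurry_def]
    fun_prop
  have bΦ : ∀ (N : BoundedContinuousFunction ℝ ℝ) (t : ℝ), ‖Φ N t‖ ≤ H + C * ‖N‖ / lam := by
    intro N t
    refine (abs_sub _ _).trans (add_le_add ?_ (est N ‖N‖ (norm_nonneg _) N.norm_coe_le_norm _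
      (le_max_right _ _)))
    rw [abs_mul, abs_of_pos (Real.exp_pos _)]
    refine (mul_le_of_le_one_left (abs_nonneg _) (Real.exp_le_one_iff.mpr ?_)).trans
      (hH _ (le_max_right _ _))
    rw [neg_nonpos]
    positivity
  set Ψ : BoundedContinuousFunction ℝ ℝ → BoundedContinuousFunction ℝ ℝ :=
    fun N => .ofNormedAddCommGroup (Φ N) (cΦ N) _ (bΦ N) with hΨ
  have hcontr : ContractingWith (1 / 2) Ψ := by
    refine ⟨by rw [← NNReal.coe_lt_coe]; norm_num, LipschitzWith.of_dist_le_mul fun N N' => ?_⟩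
    rw [BoundedContinuousFunction.dist_le (by positivity)]
    intro t
    change |Φ N t - Φ N' t| ≤ _
    have hi : ∀ N : BoundedContinuousFunction ℝ ℝ, IntervalIntegrable
        (fun s => κ s * (Real.exp (-(lam * s)) * N (max t 0 - s))) volume 0 (min (max t 0) 1) :=
      fun N => (by fun_prop : Continuous fun s =>
        κ s * (Real.exp (-(lam * s)) * N (max t 0 - s))).intervalIntegrable _ _
    have e : Φ N t - Φ N' t = -∫ s in (0 : ℝ)..min (max t 0) 1,
        κ s * (Real.exp (-(lam * s)) * (N - N') (max t 0 - s)) := by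
      rw [hΦ]
      beta_reduce
      rw [sub_sub_sub_cancel_left, ← neg_sub, ← intervalIntegral.integral_sub (hi N) (hi N')]
      congr 1
      refine intervalIntegral.integral_congr fun s _ => ?_
      simp only [BoundedContinuousFunction.coe_sub, Pi.sub_apply]
      ring
    rw [e, abs_neg]
    refine (est (N - N') (dist N N') dist_nonneg (fun t => ?_) _ (le_max_right _ _)).trans ?_
    · exact BoundedContinuousFunction.dist_coe_le_dist (f := N) (g := N') t
    · rw [div_le_iff₀ hl]
      push_cast
      nlinarith [dist_nonneg (x := N) (y := N')]
  set N := hcontr.fixedPoint Ψ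
  have hN : Ψ N = N := hcontr.fixedPoint_isFixedPt
  refine ⟨fun t => Real.exp (lam * t) * N t, by fun_prop, fun t ht => ?_⟩
  have e : N t = Φ N t := by
    conv_lhs => rw [← hN]
    rfl
  rw [integral_mul_indicator_sub _ _ ht zero_le_one]
  beta_reduce
  rw [e, hΦ]
  beta_reduce
  rw [max_eq_left ht, mul_sub, ← mul_assoc, ← Real.exp_add, add_neg_cancel, Real.exp_zero, one_mul,
    ← intervalIntegral.integral_const_mul, sub_add_eq_add_sub, sub_eq_iff_eq_add]
  congr 1
  refine intervalIntegral.integral_congr fun s _ => ?_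
  rw [show lam * (t - s) = lam * t + -(lam * s) by ring, Real.exp_add]
  ring

/-- Integrated form of an equation `b(t) + ∫_0^1 κ(s) b(t-s) ds = e(t)`. -/
theorem IsPrimitive.add_conv_eq {B b κ e : ℝ → ℝ} {C : Set ℝ} (hB : IsPrimitive B b C)
    (hκ : Continuous κ) {t : ℝ} (ht : 0 ≤ t)
    (h : ∀ x, 0 ≤ x → b x + ∫ s in (0 : ℝ)..1, κ s * b (x - s) = e x) :
    B t + ∫ s in (0 : ℝ)..1, κ s * B (t - s) =
      B 0 + (∫ s in (0 : ℝ)..1, κ s * B (0 - s)) + ∫ x in (0 : ℝ)..t, e x := by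
  have hc : Continuous fun x => ∫ s in (0 : ℝ)..1, κ s * b (x - s) := by
    have := continuous_conv hB.pc (G := fun _ r => κ r) (by fun_prop)
    exact this.comp (f := fun x : ℝ => (x, (0 : ℝ), (1 : ℝ))) (by fun_prop)
  have h1 := intervalIntegral.integral_eq_sub_of_hasDerivAt (a := 0) (b := t)
    (fun x _ => hasDerivAt_conv hB hκ 1 x) (hc.intervalIntegrable _ _)
  have h2 : ∫ x in (0 : ℝ)..t, e x =
      (∫ x in (0 : ℝ)..t, b x) + ∫ x in (0 : ℝ)..t, ∫ s in (0 : ℝ)..1, κ s * b (x - s) := by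
    rw [← intervalIntegral.integral_add (hB.pc.intervalIntegrable _ _) (hc.intervalIntegrable _ _)]
    refine intervalIntegral.integral_congr fun x hx => ?_
    rw [uIcc_of_le ht] at hx
    exact (h x hx.1).symm
  rw [h2, h1, ← hB.sub_eq 0 t]
  ring

theorem PiecewiseCont.intervalIntegrable_mul_comp_sub {b : ℝ → ℝ} {C : Set ℝ}
    (h : PiecewiseCont b C) {κ : ℝ → ℝ} (hκ : Continuous κ) (c x y : ℝ) :
    IntervalIntegrable (fun s => κ s * b (c - s)) volume x y :=
  (h.intervalIntegrable_comp_sub c x y).continuousOn_mul hκ.continuousOn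

/-- The unit step. -/
noncomputable def step : ℝ → ℝ := (Ici (0 : ℝ)).indicator fun _ => 1

theorem step_of_nonneg {t : ℝ} (h : 0 ≤ t) : step t = 1 := indicator_of_mem (s := Ici 0) h _

theorem step_of_neg {t : ℝ} (h : t < 0) : step t = 0 :=
  indicator_of_notMem (s := Ici 0) (by simpa using h) _

theorem piecewiseCont_step : PiecewiseCont step {0} := .indicator_Ici continuous_const 0

/-- The step response of `v(t) + ∫_0^1 κ(s) v(t-s) ds` is a unit step plus a primitive. -/
theorem exists_stepResponse {κ : ℝ → ℝ} (hκ : Continuous κ) :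
    ∃ B b : ℝ → ℝ, IsPrimitive B b {0, 1} ∧ (∀ t ≤ 0, B t = 0) ∧
      ∀ t, 0 ≤ t → step t + B t + ∫ s in (0 : ℝ)..1, κ s * (step (t - s) + B (t - s)) = 1 := by
  -- κ₁ is κ cut off to [0,1), the derivative of ∫ κ(s) step(t-s) ds = ∫_0^{min(t,1)} κ.
  -- Differentiating the step response equation therefore asks for b + κ*b = -κ₁.
  set κ₁ : ℝ → ℝ := fun x => (Ici (0 : ℝ)).indicator κ x + (-1) * (Ici (1 : ℝ)).indicator κ x
    with hκ₁
  have pκ₁ : PiecewiseCont κ₁ ({0} ∪ {1}) :=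
    (PiecewiseCont.indicator_Ici hκ 0).add ((PiecewiseCont.indicator_Ici hκ 1).const_mul (-1))
  have κ₁_neg : ∀ x < 0, κ₁ x = 0 := fun x hx => by
    simp only [hκ₁]
    rw [indicator_of_notMem (by simpa using hx), indicator_of_notMem (by
      simp only [mem_Ici, not_le]; linarith)]
    ring
  have κ₁_mid : ∀ x, 0 ≤ x → x < 1 → κ₁ x = κ x := fun x h0 h1 => by
    simp only [hκ₁]
    rw [indicator_of_mem (by simpa using h0), indicator_of_notMem (by simpa using h1)]
    ring
  have κ₁_big : ∀ x, 1 ≤ x → κ₁ x = 0 := fun x h1 => by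
    simp only [hκ₁]
    rw [indicator_of_mem (by simp only [mem_Ici]; linarith), indicator_of_mem (by simpa using h1)]
    ring
  have ch : Continuous fun x => ∫ s in (0 : ℝ)..1, κ s * κ₁ (x - s) := by
    have := continuous_conv pκ₁ (G := fun _ r => κ r) (by fun_prop)
    exact this.comp (f := fun x : ℝ => (x, (0 : ℝ), (1 : ℝ))) (by fun_prop)
  obtain ⟨H, hH⟩ := (isCompact_Icc (a := (0 : ℝ)) (b := 2)).exists_bound_of_continuousOn
    ch.continuousOn
  obtain ⟨m, hm, hmeq⟩ := exists_volterra hκ ch (H := H) fun t ht => by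
    rcases le_total t 2 with h2 | h2
    · exact hH t ⟨ht, h2⟩
    · have : ∫ s in (0 : ℝ)..1, κ s * κ₁ (t - s) = ∫ s in (0 : ℝ)..1, (0 : ℝ) := by
        refine intervalIntegral.integral_congr fun s hs => ?_
        rw [uIcc_of_le zero_le_one] at hs
        rw [κ₁_big _ (by linarith [hs.2]), mul_zero]
      rw [this]
      simpa using (norm_nonneg _).trans (hH 0 (by simp))
  have pm := PiecewiseCont.indicator_Ici hm 0
  -- Splitting off -κ₁ leaves m + κ*m = κ*κ₁, whose right-hand side and solution are continuous. So
  -- `b` can jump only at 0 and 1, which is the origin of the singular characteristics t - z = τ j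
  -- and t - z = 1 + τ j.
  set b : ℝ → ℝ := fun x => (Ici (0 : ℝ)).indicator m x + (-1) * κ₁ x with hb
  have pb : PiecewiseCont b {0, 1} :=
    (pm.add (pκ₁.const_mul (-1))).mono (by rintro x (rfl | rfl | rfl) <;> simp) (by simp)
  have b_neg : ∀ x < 0, b x = 0 := fun x hx => by
    simp only [hb]
    rw [indicator_of_notMem (by simpa using hx), κ₁_neg x hx]
    ring
  set B : ℝ → ℝ := fun t => ∫ x in (0 : ℝ)..t, b x with hBdef
  have hB : IsPrimitive B b {0, 1} := ⟨pb, fun c => by simp [hBdef]⟩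
  have B_nonpos : ∀ t ≤ 0, B t = 0 := fun t ht => by
    rw [hBdef]
    beta_reduce
    rw [intervalIntegral.integral_symm, intervalIntegral.integral_of_le ht,
      integral_Ioc_eq_integral_Ioo, setIntegral_congr_fun (g := fun _ => 0) measurableSet_Ioo
      fun x hx => b_neg x hx.2]
    simp
  refine ⟨B, b, hB, B_nonpos, fun t ht => ?_⟩
  have eqb : ∀ x, 0 ≤ x → b x + ∫ s in (0 : ℝ)..1, κ s * b (x - s) = (-1) * κ₁ x := fun x hx => by
    have : ∫ s in (0 : ℝ)..1, κ s * b (x - s) =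
        (∫ s in (0 : ℝ)..1, κ s * (Ici (0 : ℝ)).indicator m (x - s)) -
          ∫ s in (0 : ℝ)..1, κ s * κ₁ (x - s) := by
      rw [← intervalIntegral.integral_sub (pm.intervalIntegrable_mul_comp_sub hκ _ _ _)
        (pκ₁.intervalIntegrable_mul_comp_sub hκ _ _ _)]
      refine intervalIntegral.integral_congr fun s _ => ?_
      simp only [hb]
      ring
    rw [this, ← hmeq x hx]
    simp only [hb]
    rw [indicator_of_mem (show x ∈ Ici 0 from hx)]
    ring
  have e1 := hB.add_conv_eq hκ ht eqb
  have e0 : ∫ s in (0 : ℝ)..1, κ s * B (0 - s) = 0 := by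
    rw [intervalIntegral.integral_congr (g := fun _ => 0)]
    · simp
    · intro s hs
      rw [uIcc_of_le zero_le_one] at hs
      beta_reduce
      rw [B_nonpos _ (by linarith [hs.1]), mul_zero]
  have e2 : ∫ s in (0 : ℝ)..1, κ s * step (t - s) = ∫ s in (0 : ℝ)..min t 1, κ s := by
    have := integral_mul_indicator_sub κ (fun _ => 1) ht zero_le_one
    simp only [mul_one] at this
    exact this
  have e3 : ∫ x in (0 : ℝ)..t, κ₁ x = ∫ s in (0 : ℝ)..min t 1, κ s := by
    have hmid : ∀ u, 0 ≤ u → u ≤ 1 → ∫ x in (0 : ℝ)..u, κ₁ x = ∫ s in (0 : ℝ)..u, κ s := by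
      intro u h0 h1
      rw [intervalIntegral.integral_of_le h0, intervalIntegral.integral_of_le h0,
        integral_Ioc_eq_integral_Ioo, integral_Ioc_eq_integral_Ioo]
      exact setIntegral_congr_fun measurableSet_Ioo fun x hx =>
        κ₁_mid x hx.1.le (hx.2.trans_le h1)
    rcases le_total t 1 with h1 | h1
    · rw [min_eq_left h1, hmid t ht h1]
    · rw [min_eq_right h1, ← hmid 1 zero_le_one le_rfl,
        ← intervalIntegral.integral_add_adjacent_intervals (pκ₁.intervalIntegrable 0 1)
          (pκ₁.intervalIntegrable 1 t), add_eq_left,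
        intervalIntegral.integral_congr (g := fun _ => 0)]
      · simp
      · intro x hx
        rw [uIcc_of_le h1] at hx
        exact κ₁_big x hx.1
  have e4 : ∫ s in (0 : ℝ)..1, κ s * (step (t - s) + B (t - s)) =
      (∫ s in (0 : ℝ)..1, κ s * step (t - s)) + ∫ s in (0 : ℝ)..1, κ s * B (t - s) := by
    rw [← intervalIntegral.integral_add
      (piecewiseCont_step.intervalIntegrable_mul_comp_sub hκ _ _ _)
      ((PiecewiseCont.of_continuous hB.continuous).intervalIntegrable_mul_comp_sub hκ _ _ _)]
    simp only [mul_add]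
  rw [intervalIntegral.integral_const_mul, e3, e0, B_nonpos 0 le_rfl] at e1
  rw [e4, e2, step_of_nonneg ht]
  linarith

/-- The free response: a `C¹` history on `(-∞, 0]` continued so that
`v(t) + ∫_0^1 κ(s) v(t-s) ds` is constant for `t ≥ 0`. -/
theorem exists_freeResponse {κ ξ η : ℝ → ℝ} (hκ : Continuous κ) (hη : Continuous η)
    (hξ : ∀ x, HasDerivAt ξ (η x) x) {M : ℝ} (hM : ∀ x, |η x| ≤ M) :
    ∃ W w : ℝ → ℝ, ∃ ω : ℝ, IsPrimitive W w {0} ∧ (∀ t ≤ 0, W t = ξ t) ∧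
      ∀ t, 0 ≤ t → W t + ∫ s in (0 : ℝ)..1, κ s * W (t - s) = ω := by
  obtain ⟨C, hC⟩ := (isCompact_Icc (a := (0 : ℝ)) (b := 1)).exists_bound_of_continuousOn
    hκ.continuousOn
  have hC0 : 0 ≤ C := (norm_nonneg _).trans (hC 0 (by simp))
  have pη := PiecewiseCont.of_continuous hη
  have ch : Continuous fun x => ∫ s in (0 : ℝ)..1, κ s * η (x - s) := by
    have := continuous_conv pη (G := fun _ r => κ r) (by fun_prop)
    exact this.comp (f := fun x : ℝ => (x, (0 : ℝ), (1 : ℝ))) (by fun_prop)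
  -- Differentiating the required constancy gives w + κ*w = 0 for t ≥ 0. With w = η + m on t ≥ 0 and
  -- w = η before, this is a Volterra equation for m with bounded forcing.
  obtain ⟨m, hm, hmeq⟩ := exists_volterra hκ
    (h := fun x => -(η x + ∫ s in (0 : ℝ)..1, κ s * η (x - s))) (hη.add ch).neg
    (H := M + C * M) fun t _ => by
      rw [abs_neg]
      refine (abs_add_le _ _).trans (add_le_add (hM t) ?_)
      have := intervalIntegral.norm_integral_le_of_norm_le_const (a := 0) (b := 1)
        (f := fun s => κ s * η (t - s)) (C := C * M) fun s hs => by
          rw [uIoc_of_le zero_le_one] at hs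
          rw [norm_mul]
          exact mul_le_mul (hC s ⟨hs.1.le, hs.2⟩) (hM _) (norm_nonneg _) hC0
      simpa using this
  have pm := PiecewiseCont.indicator_Ici hm 0
  set w : ℝ → ℝ := fun x => η x + (Ici (0 : ℝ)).indicator m x with hw
  have pw : PiecewiseCont w {0} := (pη.add pm).mono (by simp) (by simp)
  set W : ℝ → ℝ := fun t => ξ 0 + ∫ x in (0 : ℝ)..t, w x with hWdef
  have hW : IsPrimitive W w {0} := ⟨pw, fun c => by simp [hWdef]⟩
  refine ⟨W, w, W 0 + ∫ s in (0 : ℝ)..1, κ s * W (0 - s), hW, fun t ht => ?_, fun t ht => ?_⟩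
  rotate_left
  · have := hW.add_conv_eq (e := fun _ => 0) hκ ht fun x hx => ?_
    · rw [this, intervalIntegral.integral_zero, add_zero]
    · have e : ∫ s in (0 : ℝ)..1, κ s * w (x - s) = (∫ s in (0 : ℝ)..1, κ s * η (x - s)) +
          ∫ s in (0 : ℝ)..1, κ s * (Ici (0 : ℝ)).indicator m (x - s) := by
        rw [← intervalIntegral.integral_add (pη.intervalIntegrable_mul_comp_sub hκ _ _ _)
          (pm.intervalIntegrable_mul_comp_sub hκ _ _ _)]
        simp only [hw, mul_add]
      have h1 := hmeq x hx
      rw [e]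
      simp only [hw]
      rw [indicator_of_mem (show x ∈ Ici 0 from hx)]
      linarith
  · have e := (IsPrimitive.of_hasDerivAt hη hξ).sub_eq 0 t
    have e' : ∫ x in (0 : ℝ)..t, w x = ∫ x in (0 : ℝ)..t, η x := by
      rw [intervalIntegral.integral_symm, intervalIntegral.integral_symm t 0,
        intervalIntegral.integral_of_le ht, intervalIntegral.integral_of_le ht,
        integral_Ioc_eq_integral_Ioo, integral_Ioc_eq_integral_Ioo]
      congr 1
      refine setIntegral_congr_fun measurableSet_Ioo fun x hx => ?_
      simp only [hw]
      rw [indicator_of_notMem (by simpa using hx.2), add_zero]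
    rw [hWdef]
    beta_reduce
    rw [e', ← e]
    ring

theorem exists_strong_rec (G : ℕ → (ℕ → ℝ) → ℝ)
    (hG : ∀ i β β', (∀ j < i, β j = β' j) → G i β = G i β') :
    ∃ β : ℕ → ℝ, ∀ i, β i = G i β := by
  classical
  let F : ∀ i : ℕ, (∀ j, j < i → ℝ) → ℝ := fun i ih => G i fun j => if h : j < i then ih j h else 0
  refine ⟨Nat.lt_wfRel.wf.fix F, fun i => ?_⟩
  rw [WellFounded.fix_eq]
  refine hG i _ _ fun j hj => ?_
  exact dif_pos hj

/-- Inlet values `v(t) = x(t, 0)` of the transformed closed loop: `v n` is the solution in which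
only the first `n` sampling instants act. The jump at `τ j` is `β j`. -/
structure InletData (κ ξ : ℝ → ℝ) (τ : ℕ → ℝ) (β : ℕ → ℝ) (B b v : ℕ → ℝ → ℝ)
    (C : ℕ → Set ℝ) : Prop where
  prim : ∀ n, IsPrimitive (B n) (b n) (C n)
  sing : ∀ n, ∀ x ∈ C n, ∃ j, x = τ j ∨ x = 1 + τ j
  eq : ∀ n t, v n t = B n t + ∑ j ∈ Finset.range n, β j * step (t - τ j)
  history : ∀ n, ∀ t < 0, v n t = ξ t
  agree : ∀ m n t, t < τ m → t < τ n → v m t = v n t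
  closed_loop : ∀ n i t, i < n → t ∈ Ico (τ i) (τ (i + 1)) →
    v n t + ∫ s in (0 : ℝ)..1, κ s * v n (t - s) = ∫ s in (0 : ℝ)..1, κ s * v n (τ i - s)

/-- On [τ i, τ (i+1)) the sum v + κ*v has to be a constant fixed by the state at τ i. The free
response supplies a constant ω, and adding β j times the step response started at τ j raises it by β
j from then on. -/
theorem exists_inletData {κ ξ η : ℝ → ℝ} (hκ : Continuous κ) (hη : Continuous η)
    (hξ : ∀ x, HasDerivAt ξ (η x) x) {M : ℝ} (hM : ∀ x, |η x| ≤ M) {τ : ℕ → ℝ}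
    (hτ : StrictMono τ) (hτ0 : τ 0 = 0) :
    ∃ (β : ℕ → ℝ) (B b v : ℕ → ℝ → ℝ) (C : ℕ → Set ℝ), InletData κ ξ τ β B b v C := by
  obtain ⟨S, s', hS, hS0, hSeq⟩ := exists_stepResponse hκ
  obtain ⟨W, w, ω, hW, hW0, hWeq⟩ := exists_freeResponse hκ hη hξ hM
  set R : ℝ → ℝ := fun t => step t + S t with hR
  have R_neg : ∀ t < 0, R t = 0 := fun t ht => by
    simp only [hR, step_of_neg ht, hS0 t ht.le, add_zero]
  have pR : ∀ c, PiecewiseCont (fun t => R (t - c)) ((fun x => x + c) '' ({0} ∪ ∅)) := fun c =>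
    (piecewiseCont_step.add (.of_continuous hS.continuous)).comp_sub c
  have iR : ∀ c t, IntervalIntegrable (fun s => κ s * R (t - s - c)) volume 0 1 := fun c t =>
    (pR c).intervalIntegrable_mul_comp_sub hκ t 0 1
  have iW : ∀ t, IntervalIntegrable (fun s => κ s * W (t - s)) volume 0 1 := fun t =>
    (PiecewiseCont.of_continuous hW.continuous).intervalIntegrable_mul_comp_sub hκ t 0 1
  set V : (ℕ → ℝ) → ℕ → ℝ → ℝ := fun β n t =>
    W t + ∑ j ∈ Finset.range n, β j * R (t - τ j) with hV
  -- β i is the height by which the level ω + ∑_{j<i} β j must be raised to equal the sampled value.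
  -- That value involves only the history before τ i, hence only β j with j < i.
  obtain ⟨β, hβ⟩ := exists_strong_rec
    (fun i β => (∫ s in (0 : ℝ)..1, κ s * V β i (τ i - s)) - ω - ∑ j ∈ Finset.range i, β j)
    fun i β β' h => by
      have h1 : V β i = V β' i := by
        funext t
        simp only [hV]
        congr 1
        exact Finset.sum_congr rfl fun j hj => by rw [h j (Finset.mem_range.mp hj)]
      rw [h1, Finset.sum_congr rfl fun j hj => h j (Finset.mem_range.mp hj)]
  have agree : ∀ m n t, m ≤ n → t < τ m → V β n t = V β m t := by
    intro m n t hmn ht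
    simp only [hV]
    congr 1
    refine (Finset.sum_subset (Finset.range_mono hmn) fun j _ hj => ?_).symm
    rw [R_neg, mul_zero]
    have : τ m ≤ τ j := hτ.monotone (by simpa using hj)
    linarith
  have conv : ∀ n t, 0 ≤ t → V β n t + ∫ s in (0 : ℝ)..1, κ s * V β n (t - s) =
      ω + ∑ j ∈ Finset.range n, if τ j ≤ t then β j else 0 := by
    intro n t ht
    have e1 : ∫ s in (0 : ℝ)..1, κ s * V β n (t - s) = (∫ s in (0 : ℝ)..1, κ s * W (t - s)) +
        ∑ j ∈ Finset.range n, β j * ∫ s in (0 : ℝ)..1, κ s * R (t - s - τ j) := by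
      simp only [← intervalIntegral.integral_const_mul]
      rw [← intervalIntegral.integral_finsetSum fun j _ => (iR (τ j) t).const_mul (β j),
        ← intervalIntegral.integral_add (iW t)]
      · refine intervalIntegral.integral_congr fun s _ => ?_
        simp only [hV]
        rw [mul_add, Finset.mul_sum]
        congr 1
        exact Finset.sum_congr rfl fun j _ => by ring
      · have := IntervalIntegrable.sum (μ := volume) (a := 0) (b := 1) (Finset.range n)
          (f := fun j s => β j * (κ s * R (t - s - τ j))) fun j _ => (iR (τ j) t).const_mul (β j)
        simpa only [Finset.sum_fn] using this
    rw [e1]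
    simp only [hV]
    rw [add_add_add_comm, hWeq t ht, ← Finset.sum_add_distrib]
    congr 1
    refine Finset.sum_congr rfl fun j _ => ?_
    split_ifs with h
    · have := hSeq (t - τ j) (by linarith)
      rw [← mul_add]
      simp only [hR]
      simp only [sub_right_comm t _ (τ j)]
      rw [this, mul_one]
    · push Not at h
      rw [R_neg _ (by linarith), intervalIntegral.integral_congr (g := fun _ => 0)]
      · simp
      · intro s hs
        rw [uIcc_of_le zero_le_one] at hs
        beta_reduce
        rw [R_neg _ (by linarith [hs.1]), mul_zero]
  refine ⟨β, fun n t => W t + ∑ j ∈ Finset.range n, β j * S (t - τ j),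
    fun n t => w t + ∑ j ∈ Finset.range n, β j * s' (t - τ j), V β,
    fun n => {0} ∪ ⋃ j ∈ Finset.range n, (fun x => x + τ j) '' {0, 1}, ⟨fun n => ?_, fun n x hx => ?_,
      fun n t => ?_, fun n t ht => ?_, fun m n t hm hn => ?_, fun n i t hi ht => ?_⟩⟩
  · exact hW.add (.sum _ fun j _ => (hS.comp_sub (τ j)).const_mul (β j))
  · rcases hx with hx | hx
    · exact ⟨0, Or.inl (by rw [hτ0]; exact hx)⟩
    · simp only [mem_iUnion, mem_image, mem_insert_iff, mem_singleton_iff] at hx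
      obtain ⟨j, -, y, rfl | rfl, rfl⟩ := hx
      · exact ⟨j, Or.inl (by ring)⟩
      · exact ⟨j, Or.inr rfl⟩
  · simp only [hV, hR, mul_add, Finset.sum_add_distrib]
    ring
  · simp only [hV]
    rw [hW0 t ht.le, Finset.sum_eq_zero, add_zero]
    intro j _
    have : 0 ≤ τ j := hτ0 ▸ hτ.monotone (Nat.zero_le j)
    rw [R_neg _ (by linarith), mul_zero]
  · rcases le_total m n with h | h
    · exact (agree m n t h hm).symm
    · exact agree n m t h hn
  · have h0 : 0 ≤ t := (hτ0 ▸ hτ.monotone (Nat.zero_le i) : 0 ≤ τ i).trans ht.1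
    have e1 : ∑ j ∈ Finset.range n, (if τ j ≤ t then β j else 0) =
        ∑ j ∈ Finset.range (i + 1), β j := by
      rw [← Finset.sum_filter]
      refine Finset.sum_congr ?_ fun _ _ => rfl
      ext j
      simp only [Finset.mem_filter, Finset.mem_range]
      constructor
      · rintro ⟨-, h⟩
        exact hτ.lt_iff_lt.mp (h.trans_lt ht.2)
      · intro h
        exact ⟨by omega, (hτ.monotone (by omega : j ≤ i)).trans ht.1⟩
    -- The jumps from τ i on are invisible here: the integration variable satisfies s > 0 almost
    -- everywhere, and all later terms vanish before τ i.
    have e2 : ∫ s in (0 : ℝ)..1, κ s * V β n (τ i - s) =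
        ∫ s in (0 : ℝ)..1, κ s * V β i (τ i - s) := by
      rw [intervalIntegral.integral_of_le zero_le_one, intervalIntegral.integral_of_le zero_le_one]
      refine setIntegral_congr_fun measurableSet_Ioc fun s hs => ?_
      rw [agree i n _ hi.le (by linarith [hs.1])]
    rw [conv n t h0, e1, e2, Finset.sum_range_succ, hβ i]
    ring

/-! ### Piecewise regular functions of (t, z) -/

/-- Functions of `(t, z)` that are continuous on `Θ` and of class `C¹` with locally bounded
gradient on `G`, and have the one-sided limits and derivatives of a right continuous function of
`t` and a left continuous function of `z`. -/
structure PieceRegular (Φ : ℝ → ℝ → ℝ) (Θ G : Set (ℝ × ℝ)) : Prop where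
  cont : ∀ q ∈ Θ, ContinuousAt (fun q : ℝ × ℝ => Φ q.1 q.2) q
  smooth : ∀ q ∈ G, ContDiffAt ℝ 1 (fun q : ℝ × ℝ => Φ q.1 q.2) q
  bdd : ∀ R : ℝ, ∃ M : ℝ, 0 ≤ M ∧ ∀ q : ℝ × ℝ, ‖q‖ ≤ R → |Φ q.1 q.2| ≤ M
  bdd_fderiv : ∀ R : ℝ, ∃ M : ℝ, 0 ≤ M ∧ ∀ q ∈ G, ‖q‖ ≤ R →
    ‖fderiv ℝ (fun q : ℝ × ℝ => Φ q.1 q.2) q‖ ≤ M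
  right_t : ∀ t z, ∃ d, HasDerivWithinAt (fun r => Φ r z) d (Ici t) t
  left_z : ∀ t z, ∃ d, HasDerivWithinAt (Φ t) d (Iic z) z
  lim_t : ∀ t z, ∃ l, Tendsto (fun r => Φ r z) (𝓝[<] t) (𝓝 l)
  lim_z : ∀ t z, ∃ l, Tendsto (Φ t) (𝓝[>] z) (𝓝 l)

namespace PieceRegular

variable {Φ Ψ : ℝ → ℝ → ℝ} {Θ Θ' G G' : Set (ℝ × ℝ)}

theorem mono (h : PieceRegular Φ Θ G) (hΘ : Θ' ⊆ Θ) (hG : G' ⊆ G) : PieceRegular Φ Θ' G' where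
  cont q hq := h.cont q (hΘ hq)
  smooth q hq := h.smooth q (hG hq)
  bdd := h.bdd
  bdd_fderiv R := let ⟨M, h0, hM⟩ := h.bdd_fderiv R; ⟨M, h0, fun q hq => hM q (hG hq)⟩
  right_t := h.right_t
  left_z := h.left_z
  lim_t := h.lim_t
  lim_z := h.lim_z

theorem add (h : PieceRegular Φ Θ G) (h' : PieceRegular Ψ Θ G) :
    PieceRegular (fun t z => Φ t z + Ψ t z) Θ G where
  cont q hq := (h.cont q hq).add (h'.cont q hq)
  smooth q hq := (h.smooth q hq).add (h'.smooth q hq)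
  bdd R := by
    obtain ⟨M, h0, hM⟩ := h.bdd R
    obtain ⟨N, h1, hN⟩ := h'.bdd R
    exact ⟨M + N, by positivity, fun q hq => (abs_add_le _ _).trans (add_le_add (hM q hq) (hN q hq))⟩
  bdd_fderiv R := by
    obtain ⟨M, h0, hM⟩ := h.bdd_fderiv R
    obtain ⟨N, h1, hN⟩ := h'.bdd_fderiv R
    refine ⟨M + N, by positivity, fun q hq hR => ?_⟩
    rw [fderiv_fun_add ((h.smooth q hq).differentiableAt one_ne_zero)
      ((h'.smooth q hq).differentiableAt one_ne_zero)]
    exact (norm_add_le _ _).trans (add_le_add (hM q hq hR) (hN q hq hR))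
  right_t t z := let ⟨_, hd⟩ := h.right_t t z; let ⟨_, he⟩ := h'.right_t t z; ⟨_, hd.add he⟩
  left_z t z := let ⟨_, hd⟩ := h.left_z t z; let ⟨_, he⟩ := h'.left_z t z; ⟨_, hd.add he⟩
  lim_t t z := let ⟨_, hd⟩ := h.lim_t t z; let ⟨_, he⟩ := h'.lim_t t z; ⟨_, hd.add he⟩
  lim_z t z := let ⟨_, hd⟩ := h.lim_z t z; let ⟨_, he⟩ := h'.lim_z t z; ⟨_, hd.add he⟩

theorem mul (h : PieceRegular Φ Θ G) (h' : PieceRegular Ψ Θ G) :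
    PieceRegular (fun t z => Φ t z * Ψ t z) Θ G where
  cont q hq := (h.cont q hq).mul (h'.cont q hq)
  smooth q hq := (h.smooth q hq).mul (h'.smooth q hq)
  bdd R := by
    obtain ⟨M, h0, hM⟩ := h.bdd R
    obtain ⟨N, h1, hN⟩ := h'.bdd R
    refine ⟨M * N, by positivity, fun q hq => ?_⟩
    rw [abs_mul]
    exact mul_le_mul (hM q hq) (hN q hq) (abs_nonneg _) h0
  bdd_fderiv R := by
    obtain ⟨M, h0, hM⟩ := h.bdd_fderiv R
    obtain ⟨N, h1, hN⟩ := h'.bdd_fderiv R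
    obtain ⟨M', h2, hM'⟩ := h.bdd R
    obtain ⟨N', h3, hN'⟩ := h'.bdd R
    refine ⟨M' * N + N' * M, by positivity, fun q hq hR => ?_⟩
    rw [fderiv_fun_mul ((h.smooth q hq).differentiableAt one_ne_zero)
      ((h'.smooth q hq).differentiableAt one_ne_zero)]
    refine (norm_add_le _ _).trans ?_
    rw [norm_smul, norm_smul]
    exact add_le_add (mul_le_mul (hM' q hR) (hN q hq hR) (norm_nonneg _) h2)
      (mul_le_mul (hN' q hR) (hM q hq hR) (norm_nonneg _) h3)
  right_t t z := let ⟨_, hd⟩ := h.right_t t z; let ⟨_, he⟩ := h'.right_t t z; ⟨_, hd.mul he⟩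
  left_z t z := let ⟨_, hd⟩ := h.left_z t z; let ⟨_, he⟩ := h'.left_z t z; ⟨_, hd.mul he⟩
  lim_t t z := let ⟨_, hd⟩ := h.lim_t t z; let ⟨_, he⟩ := h'.lim_t t z; ⟨_, hd.mul he⟩
  lim_z t z := let ⟨_, hd⟩ := h.lim_z t z; let ⟨_, he⟩ := h'.lim_z t z; ⟨_, hd.mul he⟩

theorem of_contDiff (h : ContDiff ℝ 1 fun q : ℝ × ℝ => Φ q.1 q.2) : PieceRegular Φ Θ G := by
  have ht : ∀ t z, DifferentiableAt ℝ (fun r => Φ r z) t := fun t z =>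
    (h.comp (contDiff_id.prodMk contDiff_const : ContDiff ℝ 1 fun r : ℝ => (r, z))).differentiable
      one_ne_zero t
  have hz : ∀ t z, DifferentiableAt ℝ (Φ t) z := fun t z =>
    (h.comp (contDiff_const.prodMk contDiff_id : ContDiff ℝ 1 fun r : ℝ => (t, r))).differentiable
      one_ne_zero z
  have hb : ∀ {F : Type} [NormedAddCommGroup F] (u : ℝ × ℝ → F), Continuous u → ∀ R : ℝ,
      ∃ M : ℝ, 0 ≤ M ∧ ∀ q : ℝ × ℝ, ‖q‖ ≤ R → ‖u q‖ ≤ M := fun u hu R => by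
    obtain ⟨M, hM⟩ := (isCompact_closedBall (0 : ℝ × ℝ) R).exists_bound_of_continuousOn
      hu.continuousOn
    exact ⟨max M 0, le_max_right _ _, fun q hq =>
      (hM q (by simpa using hq)).trans (le_max_left _ _)⟩
  exact
  { cont := fun q _ => h.continuous.continuousAt
    smooth := fun q _ => h.contDiffAt
    bdd := hb _ h.continuous
    bdd_fderiv := fun R => let ⟨M, h0, hM⟩ := hb _ (h.continuous_fderiv one_ne_zero) R
      ⟨M, h0, fun q _ => hM q⟩
    right_t := fun t z => ⟨_, (ht t z).hasDerivAt.hasDerivWithinAt⟩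
    left_z := fun t z => ⟨_, (hz t z).hasDerivAt.hasDerivWithinAt⟩
    lim_t := fun t z => ⟨_, (ht t z).continuousAt.tendsto.mono_left nhdsWithin_le_nhds⟩
    lim_z := fun t z => ⟨_, (hz t z).continuousAt.tendsto.mono_left nhdsWithin_le_nhds⟩ }

theorem sum {ι : Type*} (s : Finset ι) {Φ : ι → ℝ → ℝ → ℝ}
    (h : ∀ i ∈ s, PieceRegular (Φ i) Θ G) :
    PieceRegular (fun t z => ∑ i ∈ s, Φ i t z) Θ G := by
  classical
  induction s using Finset.induction_on with
  | empty => exact of_contDiff (by simpa using contDiff_const)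
  | insert a s ha ih =>
    simp only [Finset.sum_insert ha]
    exact (h a (Finset.mem_insert_self a s)).add
      (ih fun i hi => h i (Finset.mem_insert_of_mem hi))

theorem const_mul (h : PieceRegular Φ Θ G) (c : ℝ) :
    PieceRegular (fun t z => c * Φ t z) Θ G :=
  (of_contDiff (Φ := fun _ _ => c) contDiff_const).mul h

end PieceRegular

/-- The argument t - z increases with t and decreases with z, so the right derivative of `B`, which
exists everywhere because `b` is right continuous, serves both as a right derivative in t and as a
left derivative in z. -/
theorem IsPrimitive.pieceRegular {B b : ℝ → ℝ} {C : Set ℝ} (hB : IsPrimitive B b C) :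
    PieceRegular (fun t z => B (t - z)) univ {q | q.1 - q.2 ∉ C} := by
  have hc : Continuous fun q : ℝ × ℝ => B (q.1 - q.2) := hB.continuous.comp (by fun_prop)
  have hsub : ∀ q : ℝ × ℝ, HasFDerivAt (fun q : ℝ × ℝ => q.1 - q.2)
      (ContinuousLinearMap.fst ℝ ℝ ℝ - ContinuousLinearMap.snd ℝ ℝ ℝ) q := fun q =>
    hasFDerivAt_fst.sub hasFDerivAt_snd
  exact
  { cont := fun q _ => hc.continuousAt
    smooth := fun q hq => (hB.contDiffAt hq).comp q (by fun_prop)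
    bdd := fun R => by
      obtain ⟨M, hM⟩ := (isCompact_closedBall (0 : ℝ × ℝ) R).exists_bound_of_continuousOn
        hc.continuousOn
      exact ⟨max M 0, le_max_right _ _, fun q hq =>
        (hM q (by simpa using hq)).trans (le_max_left _ _)⟩
    bdd_fderiv := fun R => by
      obtain ⟨M, hM⟩ := hB.pc.bdd (2 * R)
      refine ⟨max M 0 * ‖ContinuousLinearMap.fst ℝ ℝ ℝ - ContinuousLinearMap.snd ℝ ℝ ℝ‖,
        by positivity, fun q hq hR => ?_⟩
      have h1 : |q.1| ≤ R := (norm_fst_le q).trans hR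
      have h2 : |q.2| ≤ R := (norm_snd_le q).trans hR
      have := ((hB.hasDerivAt hq).comp_hasFDerivAt q (hsub q)).fderiv
      rw [show (fun q : ℝ × ℝ => B (q.1 - q.2)) = B ∘ fun q : ℝ × ℝ => q.1 - q.2 from rfl, this,
        norm_smul]
      gcongr
      exact (hM _ ((abs_sub _ _).trans (by linarith))).trans (le_max_left _ _)
    right_t := fun t z => by
      have h := (hB.hasDerivWithinAt_Ici (t - z)).scomp t (t' := Ici (t - z)) (h := fun r => r - z)
        ((hasDerivWithinAt_id t (Ici t)).sub_const z) fun r hr => sub_le_sub_right hr z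
      exact ⟨_, h⟩
    left_z := fun t z => by
      have h := (hB.hasDerivWithinAt_Ici (t - z)).scomp z (t' := Ici (t - z)) (h := fun r => t - r)
        ((hasDerivWithinAt_id z (Iic z)).const_sub t) fun r hr => sub_le_sub_left hr t
      exact ⟨_, h⟩
    lim_t := fun t z => ⟨_, (hB.continuous.comp
      (continuous_sub_right z)).continuousAt.tendsto.mono_left nhdsWithin_le_nhds⟩
    lim_z := fun t z => ⟨_, (hB.continuous.comp
      (continuous_sub_left t)).continuousAt.tendsto.mono_left nhdsWithin_le_nhds⟩ }

theorem pieceRegular_step (θ : ℝ) : PieceRegular (fun t z => step (t - z - θ))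
    {q | q.1 - q.2 ≠ θ} {q | q.1 - q.2 ≠ θ} := by
  have hc : ∀ q ∈ {q : ℝ × ℝ | q.1 - q.2 ≠ θ}, ∃ c : ℝ,
      (fun q : ℝ × ℝ => step (q.1 - q.2 - θ)) =ᶠ[𝓝 q] fun _ => c := by
    intro q hq
    have hcont : Continuous fun q : ℝ × ℝ => q.1 - q.2 := by fun_prop
    rcases lt_or_gt_of_ne hq with h | h
    · exact ⟨0, (hcont.continuousAt.eventually_lt_const h).mono fun x hx =>
        step_of_neg (by linarith)⟩
    · exact ⟨1, (hcont.continuousAt.eventually_const_lt h).mono fun x hx =>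
        step_of_nonneg (by linarith)⟩
  have htop : ∀ r, θ ≤ r → step (r - θ) = 1 := fun r hr => step_of_nonneg (by linarith)
  have hbot : ∀ r, r < θ → step (r - θ) = 0 := fun r hr => step_of_neg (by linarith)
  exact
  { cont := fun q hq => let ⟨_, h⟩ := hc q hq; continuousAt_const.congr h.symm
    smooth := fun q hq => let ⟨_, h⟩ := hc q hq; contDiffAt_const.congr_of_eventuallyEq h
    bdd := fun R => ⟨1, one_pos.le, fun q _ => by
      rcases lt_or_ge (q.1 - q.2) θ with h | h
      · simp [hbot _ h]
      · simp [htop _ h]⟩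
    bdd_fderiv := fun R => ⟨0, le_rfl, fun q hq _ => by
      obtain ⟨c, h⟩ := hc q hq
      rw [h.fderiv_eq]; simp⟩
    right_t := fun t z => by
      refine ⟨0, ?_⟩
      rcases lt_or_ge (t - z) θ with h | h
      · have hcont : Continuous fun r : ℝ => r - z := by fun_prop
        refine ((hasDerivAt_const t (0 : ℝ)).congr_of_eventuallyEq ?_).hasDerivWithinAt
        exact (hcont.continuousAt.eventually_lt_const h).mono fun x hx => hbot _ hx
      · refine (hasDerivWithinAt_const t (Ici t) (1 : ℝ)).congr (fun r hr => htop _ ?_) (htop _ h)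
        have : t ≤ r := hr
        linarith
    left_z := fun t z => by
      refine ⟨0, ?_⟩
      rcases lt_or_ge (t - z) θ with h | h
      · have hcont : Continuous fun r : ℝ => t - r := by fun_prop
        refine ((hasDerivAt_const z (0 : ℝ)).congr_of_eventuallyEq ?_).hasDerivWithinAt
        exact (hcont.continuousAt.eventually_lt_const h).mono fun x hx => hbot _ hx
      · refine (hasDerivWithinAt_const z (Iic z) (1 : ℝ)).congr (fun r hr => htop _ ?_) (htop _ h)
        have : r ≤ z := hr
        linarith
    lim_t := fun t z => by
      rcases le_or_gt (t - z) θ with h | h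
      · refine ⟨0, tendsto_const_nhds.congr' ?_⟩
        filter_upwards [self_mem_nhdsWithin] with r hr
        have : r < t := hr
        exact (hbot _ (by linarith)).symm
      · have hcont : Continuous fun r : ℝ => r - z := by fun_prop
        refine ⟨1, (tendsto_const_nhds.congr' ?_ : Tendsto _ (𝓝 t) _).mono_left
          nhdsWithin_le_nhds⟩
        exact (hcont.continuousAt.eventually_const_lt h).mono fun x hx => (htop _ (le_of_lt hx)).symm
    lim_z := fun t z => by
      rcases le_or_gt (t - z) θ with h | h
      · refine ⟨0, tendsto_const_nhds.congr' ?_⟩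
        filter_upwards [self_mem_nhdsWithin] with r hr
        have : z < r := hr
        exact (hbot _ (by linarith)).symm
      · have hcont : Continuous fun r : ℝ => t - r := by fun_prop
        refine ⟨1, (tendsto_const_nhds.congr' ?_ : Tendsto _ (𝓝 z) _).mono_left
          nhdsWithin_le_nhds⟩
        exact (hcont.continuousAt.eventually_const_lt h).mono fun x hx =>
          (htop _ (le_of_lt hx)).symm }

/-- Two C¹ functions glued across t = c, for the kinks of `profile`. Agreement at t = c gives
continuity; on that line the right derivative in t comes from Ψ and the derivative in z from Φ. -/
theorem pieceRegular_ite {Φ Ψ : ℝ → ℝ → ℝ} (h : ContDiff ℝ 1 fun q : ℝ × ℝ => Φ q.1 q.2)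
    (h' : ContDiff ℝ 1 fun q : ℝ × ℝ => Ψ q.1 q.2) {c : ℝ} (hc : ∀ z, Φ c z = Ψ c z) :
    PieceRegular (fun t z => if t ≤ c then Φ t z else Ψ t z) univ {q | q.1 ≠ c} := by
  have hΦ : PieceRegular Φ univ univ := .of_contDiff h
  have hΨ : PieceRegular Ψ univ univ := .of_contDiff h'
  have hcont : Continuous fun q : ℝ × ℝ => if q.1 ≤ c then Φ q.1 q.2 else Ψ q.1 q.2 :=
    h.continuous.if_le h'.continuous continuous_fst continuous_const fun q hq => by
      rw [hq]; exact hc q.2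
  have hlt : ∀ q : ℝ × ℝ, q.1 < c → (fun q : ℝ × ℝ => if q.1 ≤ c then Φ q.1 q.2 else Ψ q.1 q.2)
      =ᶠ[𝓝 q] fun q => Φ q.1 q.2 := fun q hq =>
    (continuous_fst.continuousAt.eventually_lt_const hq).mono fun x hx => if_pos (le_of_lt hx)
  have hgt : ∀ q : ℝ × ℝ, c < q.1 → (fun q : ℝ × ℝ => if q.1 ≤ c then Φ q.1 q.2 else Ψ q.1 q.2)
      =ᶠ[𝓝 q] fun q => Ψ q.1 q.2 := fun q hq =>
    (continuous_fst.continuousAt.eventually_const_lt hq).mono fun x hx => if_neg (not_le.2 hx)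
  exact
  { cont := fun q _ => hcont.continuousAt
    smooth := fun q hq => by
      rcases lt_or_gt_of_ne hq with h1 | h1
      · exact h.contDiffAt.congr_of_eventuallyEq (hlt q h1)
      · exact h'.contDiffAt.congr_of_eventuallyEq (hgt q h1)
    bdd := fun R => by
      obtain ⟨M, hM⟩ := (isCompact_closedBall (0 : ℝ × ℝ) R).exists_bound_of_continuousOn
        hcont.continuousOn
      exact ⟨max M 0, le_max_right _ _, fun q hq =>
        (hM q (by simpa using hq)).trans (le_max_left _ _)⟩
    bdd_fderiv := fun R => by
      obtain ⟨M, h0, hM⟩ := hΦ.bdd_fderiv R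
      obtain ⟨N, h1, hN⟩ := hΨ.bdd_fderiv R
      refine ⟨max M N, h0.trans (le_max_left _ _), fun q hq hR => ?_⟩
      rcases lt_or_gt_of_ne hq with h1 | h1
      · rw [(hlt q h1).fderiv_eq]
        exact (hM q trivial hR).trans (le_max_left _ _)
      · rw [(hgt q h1).fderiv_eq]
        exact (hN q trivial hR).trans (le_max_right _ _)
    right_t := fun t z => by
      rcases lt_or_ge t c with h1 | h1
      · obtain ⟨d, hd⟩ := hΦ.right_t t z
        refine ⟨d, hd.congr_of_eventuallyEq ?_ (if_pos h1.le)⟩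
        filter_upwards [mem_nhdsWithin_of_mem_nhds (Iio_mem_nhds h1)] with r hr
        exact if_pos (le_of_lt hr)
      · obtain ⟨d, hd⟩ := hΨ.right_t t z
        have : ∀ r ∈ Ici t, (if r ≤ c then Φ r z else Ψ r z) = Ψ r z := fun r hr => by
          have hr' : t ≤ r := hr
          split_ifs with h2
          · rw [show r = c by linarith, hc z]
          · rfl
        exact ⟨d, hd.congr this (this t self_mem_Ici)⟩
    left_z := fun t z => by
      by_cases h1 : t ≤ c
      · simpa only [if_pos h1] using hΦ.left_z t z
      · simpa only [if_neg h1] using hΨ.left_z t z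
    lim_t := fun t z => ⟨_, (hcont.comp (by fun_prop :
      Continuous fun r : ℝ => (r, z))).continuousAt.tendsto.mono_left nhdsWithin_le_nhds⟩
    lim_z := fun t z => ⟨_, (hcont.comp (by fun_prop :
      Continuous fun r : ℝ => (t, r))).continuousAt.tendsto.mono_left nhdsWithin_le_nhds⟩ }

/-! ### From inlet values to a solution of the partial differential equation -/

/-- The function of `(t, z)` whose backstepping transform is `(t, z) ↦ v (t - z)`. -/
noncomputable def charSolution (L : ℝ → ℝ → ℝ) (v : ℝ → ℝ) (t z : ℝ) : ℝ :=
  v (t - z) + ∫ r in (0 : ℝ)..1 - z, L z r * v (t - z - r)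

/-- Causality: the state at time t uses only inlet values up to t, so the approximations `v n` can
be glued over growing strips. -/
theorem charSolution_congr {L : ℝ → ℝ → ℝ} {v w : ℝ → ℝ} {t z : ℝ} (hz : z ∈ Icc (0 : ℝ) 1)
    (h : ∀ s ≤ t, v s = w s) : charSolution L v t z = charSolution L w t z := by
  unfold charSolution
  rw [h _ (by linarith [hz.1])]
  congr 1
  refine intervalIntegral.integral_congr fun r hr => ?_
  rw [uIcc_of_le (by linarith [hz.2])] at hr
  rw [h _ (by linarith [hz.1, hr.1])]

theorem charSolution_one (L : ℝ → ℝ → ℝ) (v : ℝ → ℝ) (t : ℝ) :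
    charSolution L v t 1 = v (t - 1) := by
  simp [charSolution]

/-- `charSolution` of the sum of a primitive and finitely many steps, continued from `z ≤ 1` to
all `z` in such a way that it is piecewise smooth. -/
noncomputable def profile (L : ℝ → ℝ → ℝ) (B : ℝ → ℝ) (τ β : ℕ → ℝ) (n : ℕ) (t z : ℝ) : ℝ :=
  B (t - z) + (∫ r in (0 : ℝ)..1 - z, L z r * B (t - z - r)) +
    ∑ j ∈ Finset.range n, β j *
      (step (t - z - τ j) * (1 + ∫ r in (0 : ℝ)..min (t - τ j) 1 - z, L z r))

theorem step_mul_integral (κ : ℝ → ℝ) (t a : ℝ) (ha : 0 ≤ a) :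
    step t + ∫ r in (0 : ℝ)..a, κ r * step (t - r) =
      step t * (1 + ∫ r in (0 : ℝ)..min t a, κ r) := by
  rcases lt_or_ge t 0 with h | h
  · rw [step_of_neg h, zero_mul, zero_add, intervalIntegral.integral_congr (g := fun _ => 0),
      intervalIntegral.integral_zero]
    intro r hr
    rw [uIcc_of_le ha] at hr
    beta_reduce
    rw [step_of_neg (by linarith [hr.1]), mul_zero]
  · rw [step_of_nonneg h, one_mul]
    congr 1
    have := integral_mul_indicator_sub κ (fun _ => 1) h ha
    simpa only [mul_one, step] using this

/-- Integrating `L` against a shifted step truncates the range at t - z - τ j. The step then factors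
out by `step_mul_integral`, leaving an integral with upper limit min (t - τ j) 1 - z. -/
theorem profile_eq {L : ℝ → ℝ → ℝ} (hL : Continuous fun q : ℝ × ℝ => L q.1 q.2) {B v : ℝ → ℝ}
    {τ β : ℕ → ℝ} {n : ℕ} (hB : Continuous B)
    (hv : ∀ t, v t = B t + ∑ j ∈ Finset.range n, β j * step (t - τ j)) (t : ℝ) {z : ℝ}
    (hz : z ≤ 1) : profile L B τ β n t z = charSolution L v t z := by
  have hLz : Continuous (L z) := hL.comp (f := fun r : ℝ => (z, r)) (by fun_prop)
  have i1 : IntervalIntegrable (fun r => L z r * B (t - z - r)) volume 0 (1 - z) :=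
    (hLz.mul (hB.comp (by fun_prop))).intervalIntegrable _ _
  have i2 : ∀ j ∈ Finset.range n, IntervalIntegrable
      (fun r => β j * (L z r * step (t - z - τ j - r))) volume 0 (1 - z) := fun j _ =>
    (piecewiseCont_step.intervalIntegrable_mul_comp_sub hLz (t - z - τ j) 0 (1 - z)).const_mul _
  have e1 : ∀ r, L z r * v (t - z - r) = L z r * B (t - z - r) +
      ∑ j ∈ Finset.range n, β j * (L z r * step (t - z - τ j - r)) := fun r => by
    rw [hv, mul_add, Finset.mul_sum]
    congr 1
    refine Finset.sum_congr rfl fun j _ => ?_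
    rw [show t - z - r - τ j = t - z - τ j - r by ring]
    ring
  have i3 := IntervalIntegrable.sum (Finset.range n) i2
  have e0 : (∑ j ∈ Finset.range n, fun r => β j * (L z r * step (t - z - τ j - r))) =
      fun r => ∑ j ∈ Finset.range n, β j * (L z r * step (t - z - τ j - r)) := by
    funext r; simp
  rw [e0] at i3
  unfold charSolution profile
  simp only [e1]
  rw [intervalIntegral.integral_add i1 i3, intervalIntegral.integral_finsetSum i2, hv (t - z)]
  have e2 : ∀ j ∈ Finset.range n, β j *
      (step (t - z - τ j) * (1 + ∫ r in (0 : ℝ)..min (t - τ j) 1 - z, L z r)) =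
      β j * step (t - z - τ j) +
        ∫ r in (0 : ℝ)..1 - z, β j * (L z r * step (t - z - τ j - r)) := fun j _ => by
    rw [intervalIntegral.integral_const_mul, ← mul_add,
      step_mul_integral _ _ _ (by linarith : 0 ≤ 1 - z), ← min_sub_sub_right,
      show t - τ j - z = t - z - τ j by ring]
  rw [Finset.sum_congr rfl e2, Finset.sum_add_distrib]
  ring

/-- Each kind of singularity has its own source: the steps jump on t - z = τ j, the primitive has
kinks where t - z lies in `C`, and the minimum in the upper limit has a kink on t = 1 + τ j. The
convolution with the primitive is C¹ everywhere. -/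
theorem pieceRegular_profile {L L' : ℝ → ℝ → ℝ} (hL : SmoothKernel L L') {B b : ℝ → ℝ}
    {C : Set ℝ} (hB : IsPrimitive B b C) (τ β : ℕ → ℝ) (n : ℕ)
    (hC : ∀ x ∈ C, ∃ j, x = τ j ∨ x = 1 + τ j) :
    PieceRegular (profile L B τ β n) {q | ∀ j, q.1 - q.2 ≠ τ j}
      {q | ∀ j, q.1 - q.2 ≠ τ j ∧ q.1 - q.2 ≠ 1 + τ j ∧ q.1 ≠ 1 + τ j} := by
  refine ((hB.pieceRegular.mono (subset_univ _) ?_).add (.of_contDiff ?_)).add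
    (PieceRegular.sum _ fun j _ => ((PieceRegular.mul
      ((pieceRegular_step (τ j)).mono ?_ ?_) ?_).const_mul (β j)))
  · intro q hq h
    obtain ⟨j, h | h⟩ := hC _ h
    exacts [(hq j).1 h, (hq j).2.1 h]
  · exact (hL.contDiff_conv hB).comp (f := fun q : ℝ × ℝ => (q.1 - q.2, q.2, 1 - q.2))
      (by fun_prop)
  · exact fun q hq => hq j
  · exact fun q hq => (hq j).1
  · have h1 : ContDiff ℝ 1 fun q : ℝ × ℝ => 1 + ∫ r in (0 : ℝ)..q.1 - τ j - q.2, L q.2 r :=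
      contDiff_const.add (hL.contDiff_integral.comp
        (f := fun q : ℝ × ℝ => (q.2, q.1 - τ j - q.2)) (by fun_prop))
    have h2 : ContDiff ℝ 1 fun q : ℝ × ℝ => 1 + ∫ r in (0 : ℝ)..1 - q.2, L q.2 r :=
      contDiff_const.add (hL.contDiff_integral.comp
        (f := fun q : ℝ × ℝ => (q.2, 1 - q.2)) (by fun_prop))
    have := pieceRegular_ite (Φ := fun t z => 1 + ∫ r in (0 : ℝ)..t - τ j - z, L z r)
      (Ψ := fun t z => 1 + ∫ r in (0 : ℝ)..1 - z, L z r) h1 h2 (c := 1 + τ j) fun z => by simp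
    have e : (fun t z : ℝ => 1 + ∫ r in (0 : ℝ)..min (t - τ j) 1 - z, L z r) = fun t z =>
        if t ≤ 1 + τ j then 1 + ∫ r in (0 : ℝ)..t - τ j - z, L z r
          else 1 + ∫ r in (0 : ℝ)..1 - z, L z r := by
      funext t z
      split_ifs with h
      · rw [min_eq_left (by linarith)]
      · rw [min_eq_right (by linarith)]
    rw [e]
    exact this.mono (subset_univ _) fun q hq => (hq j).2.2

/-- The characteristic derivative of `charSolution`. -/
theorem KernelData.fderiv_diag {g : ℝ → ℝ} {f L L' K K' : ℝ → ℝ → ℝ}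
    (h : KernelData g f L L' K K')
    (hf : ContinuousOn (fun q : ℝ × ℝ => f q.1 q.2) (Icc 0 1 ×ˢ Icc 0 1))
    {v : ℝ → ℝ} {C : Set ℝ} (hv : PiecewiseCont v C) {Φ : ℝ → ℝ → ℝ}
    (hΦ : ∀ t z, z ≤ 1 → Φ t z = charSolution L v t z) {t z : ℝ} (hz : z ∈ Icc (0 : ℝ) 1)
    (ht : t - 1 ∉ C) (hd : DifferentiableAt ℝ (fun q : ℝ × ℝ => Φ q.1 q.2) (t, z)) :
    fderiv ℝ (fun q : ℝ × ℝ => Φ q.1 q.2) (t, z) (1, 1) =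
      g z * Φ t 1 + ∫ s in z..1, f z s * Φ t s := by
  have cL := h.smooth_L.cont
  have h1 : HasDerivAt (fun x : ℝ => Φ (t + x) (z + x))
      (fderiv ℝ (fun q : ℝ × ℝ => Φ q.1 q.2) (t, z) (1, 1)) 0 := by
    have e : HasDerivAt (fun x : ℝ => (t + x, z + x)) ((1 : ℝ), (1 : ℝ)) 0 :=
      ((hasDerivAt_id (0 : ℝ)).const_add t).prodMk ((hasDerivAt_id (0 : ℝ)).const_add z)
    have hd' : HasFDerivAt (fun q : ℝ × ℝ => Φ q.1 q.2)
        (fderiv ℝ (fun q : ℝ × ℝ => Φ q.1 q.2) (t, z)) ((fun x : ℝ => (t + x, z + x)) 0) := by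
      simpa using hd.hasFDerivAt
    exact hd'.comp_hasDerivAt 0 e
  have h2 := (h.smooth_L.hasDerivAt_shift hv z (1 - z) (t - z)
    (by rwa [sub_sub_sub_cancel_right])).const_add (v (t - z))
  -- Φ equals `charSolution` only for z ≤ 1, so at z = 1 the two are compared from one side;
  -- differentiability of Φ makes this enough. The boundary term -L(z,1-z) v(t-1) is g(z) y(t,1).
  have h3 := h1.hasDerivWithinAt (s := Iic (1 - z))
  have h4 := h2.hasDerivWithinAt (s := Iic (1 - z))
  have h5 := h4.congr (f₁ := fun x : ℝ => Φ (t + x) (z + x)) (fun x hx => by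
    have hx' : x ≤ 1 - z := hx
    rw [hΦ _ _ (by linarith), charSolution, add_sub_add_right_eq_sub, sub_sub]) (by
    rw [hΦ _ _ (by linarith [hz.2]), charSolution, add_sub_add_right_eq_sub, sub_sub])
  have hu : UniqueDiffWithinAt ℝ (Iic (1 - z)) 0 := uniqueDiffOn_Iic _ _ (by simpa using hz.2)
  have h6 := (h3.derivWithin hu).symm.trans (h5.derivWithin hu)
  rw [h6, h.boundary z hz, sub_sub_sub_cancel_right, hΦ t 1 le_rfl, charSolution_one, neg_mul,
    neg_neg]
  congr 1
  obtain ⟨M, hM⟩ := hv.bdd (|t| + 1)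
  -- ∫ f y is rewritten as an integral against v by moving the inverse transformation onto f(z,·).
  -- The resulting weight f + f∘l is the characteristic derivative of `L`.
  have h7 := integral_mul_transform (P := fun s => f (clamp z) (clamp s)) (x := fun s => v (t - s))
    ((continuous_comp_clamp₂ hf).comp (f := fun s : ℝ => (z, s)) (by fun_prop)) cL
    (hv.meas_comp_sub t) hz (M := M) fun s hs => hM _ (by
      refine (abs_sub _ _).trans ?_
      rw [abs_of_nonneg hs.1]
      linarith [hs.2])
  have h8 := intervalIntegral.integral_comp_add_left (a := 0) (b := 1 - z)
    (fun s => (f (clamp z) (clamp s) + ∫ w in z..s, f (clamp z) (clamp w) * L w (s - w)) *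
      v (t - s)) z
  rw [add_zero, add_sub_cancel] at h8
  rw [← h8] at h7
  have h9 : ∫ s in z..1, f z s * Φ t s = ∫ s in z..1, f (clamp z) (clamp s) *
      (v (t - s) + ∫ r in (0 : ℝ)..1 - s, L s r * v (t - (s + r))) := by
    refine intervalIntegral.integral_congr fun s hs => ?_
    rw [uIcc_of_le hz.2] at hs
    rw [hΦ t s hs.2, charSolution, clamp_of_mem hz, clamp_of_mem ⟨hz.1.trans hs.1, hs.2⟩]
    simp only [sub_sub]
  rw [h9, h7]
  refine intervalIntegral.integral_congr fun r hr => ?_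
  rw [uIcc_of_le (by linarith [hz.2])] at hr
  have e := kcomp_eq (a := shifted f) (b := L) (A := fun z w => f (clamp z) (clamp w))
    (B := fun w s => L w (s - w)) (z := z) (s := z + r) (fun z r _ _ _ => rfl)
    (fun z r _ _ _ => by rw [add_sub_cancel_left]) hz.1 (by linarith [hr.1]) (by linarith [hr.2])
  rw [add_sub_cancel_left] at e
  rw [h.deriv_L z r hz.1 hr.1 (by linarith [hr.2]), sub_sub, e, shifted]

/-- On the strip `t < τ n`, `y` coincides with the `n`-th of a sequence of piecewise regular
functions whose singularities lie on the lines excluded from `contRegion` and `regRegion`. -/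
structure Glued (τ : ℕ → ℝ) (Φ : ℕ → ℝ → ℝ → ℝ) (y : ℝ → ℝ → ℝ) : Prop where
  tendsto : Tendsto τ atTop atTop
  regular : ∀ n, PieceRegular (Φ n) {q | ∀ j, q.1 - q.2 ≠ τ j}
      {q | ∀ j, q.1 - q.2 ≠ τ j ∧ q.1 - q.2 ≠ 1 + τ j ∧ q.1 ≠ 1 + τ j}
  eq : ∀ n t z, t < τ n → z ∈ Icc (0 : ℝ) 1 → y t z = Φ n t z

namespace Glued

variable {τ : ℕ → ℝ} {Φ : ℕ → ℝ → ℝ → ℝ} {y : ℝ → ℝ → ℝ}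

theorem exists_lt (h : Glued τ Φ y) (t : ℝ) : ∃ n, t < τ n :=
  (h.tendsto.eventually_gt_atTop t).exists

theorem finite_le (h : Glued τ Φ y) (t : ℝ) : {j | τ j ≤ t}.Finite := by
  have := h.tendsto.eventually_gt_atTop t
  rw [← Nat.cofinite_eq_atTop, eventually_cofinite] at this
  simpa using this

theorem eventuallyEq_t (h : Glued τ Φ y) {n : ℕ} {t z : ℝ} (ht : t < τ n)
    (hz : z ∈ Icc (0 : ℝ) 1) : (fun r => y r z) =ᶠ[𝓝 t] fun r => Φ n r z :=
  (eventually_lt_nhds ht).mono fun r hr => h.eq n r z hr hz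

theorem eventuallyEq (h : Glued τ Φ y) {n : ℕ} {t z : ℝ} (ht : t < τ n) {s : Set (ℝ × ℝ)}
    (hs : ∀ q ∈ s, q.2 ∈ Icc (0 : ℝ) 1) :
    (fun q : ℝ × ℝ => y q.1 q.2) =ᶠ[𝓝[s] (t, z)] fun q => Φ n q.1 q.2 := by
  filter_upwards [self_mem_nhdsWithin, mem_nhdsWithin_of_mem_nhds
    (continuous_fst.continuousAt.eventually_lt_const ht)] with q hq hq'
  exact h.eq n _ _ hq' (hs q hq)

theorem piecewise_t (h : Glued τ Φ y) {z : ℝ} (hz : z ∈ Icc (0 : ℝ) 1) :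
    PiecewiseContOn (fun t => y t z) (Ici 0) := by
  refine ⟨fun K hK hc => ?_, fun t _ => ?_⟩
  · obtain ⟨r, hr⟩ := hc.bddAbove
    refine ((h.finite_le r).image fun j => τ j + z).subset fun t ht => ?_
    by_contra hne
    refine ht.2 (ContinuousAt.continuousWithinAt ?_)
    obtain ⟨n, hn⟩ := h.exists_lt t
    refine ContinuousAt.congr ?_ (h.eventuallyEq_t hn hz).symm
    refine ((h.regular n).cont (t, z) fun j hj => hne ⟨j, ?_, ?_⟩).comp
      (f := fun r : ℝ => (r, z)) (by fun_prop)
    · have := hr ht.1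
      simp only [mem_ofPred_eq] at hj ⊢
      linarith [hz.1]
    · simp only at hj ⊢
      linarith
  · obtain ⟨n, hn⟩ := h.exists_lt t
    have he := h.eventuallyEq_t hn hz
    obtain ⟨d, hd⟩ := (h.regular n).right_t t z
    obtain ⟨l, hl⟩ := (h.regular n).lim_t t z
    exact ⟨⟨_, (hd.continuousWithinAt.tendsto.mono_left
        (nhdsWithin_mono _ (inter_subset_right.trans Ioi_subset_Ici_self))).congr'
        (he.symm.filter_mono nhdsWithin_le_nhds)⟩,
      l, (hl.mono_left (nhdsWithin_mono _ inter_subset_right)).congr'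
        (he.symm.filter_mono nhdsWithin_le_nhds)⟩

theorem right_diff_t (h : Glued τ Φ y) {z : ℝ} (hz : z ∈ Icc (0 : ℝ) 1) (t : ℝ) :
    ∃ d : ℝ, HasDerivWithinAt (fun r => y r z) d (Ici t) t := by
  obtain ⟨n, hn⟩ := h.exists_lt t
  obtain ⟨d, hd⟩ := (h.regular n).right_t t z
  exact ⟨d, hd.congr_of_eventuallyEq ((h.eventuallyEq_t hn hz).filter_mono nhdsWithin_le_nhds)
    (h.eq n t z hn hz)⟩

theorem left_diff_z (h : Glued τ Φ y) (t : ℝ) {z : ℝ} (hz : z ∈ Icc (0 : ℝ) 1) :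
    ∃ d : ℝ, HasDerivWithinAt (y t) d (Icc 0 z) z := by
  obtain ⟨n, hn⟩ := h.exists_lt t
  obtain ⟨d, hd⟩ := (h.regular n).left_z t z
  exact ⟨d, (hd.mono Icc_subset_Iic_self).congr
    (fun x hx => h.eq n t x hn ⟨hx.1, hx.2.trans hz.2⟩) (h.eq n t z hn hz)⟩

theorem piecewise_z (h : Glued τ Φ y) (t : ℝ) : PiecewiseContOn (y t) (Icc 0 1) := by
  obtain ⟨n, hn⟩ := h.exists_lt t
  refine ⟨fun K hK _ => ?_, fun z hz => ?_⟩
  · refine ((h.finite_le t).image fun j => t - τ j).subset fun z hz => ?_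
    by_contra hne
    refine hz.2 (ContinuousWithinAt.congr (f := Φ n t) (ContinuousAt.continuousWithinAt ?_)
      (fun x hx => h.eq n t x hn hx) (h.eq n t z hn (hK hz.1)))
    refine ((h.regular n).cont (t, z) fun j hj => hne ⟨j, ?_, ?_⟩).comp
      (f := fun r : ℝ => (t, r)) (by fun_prop)
    · simp only [mem_ofPred_eq] at hj ⊢
      linarith [(hK hz.1).1]
    · simp only at hj ⊢
      linarith
  · obtain ⟨d, hd⟩ := (h.regular n).left_z t z
    obtain ⟨l, hl⟩ := (h.regular n).lim_z t z
    refine ⟨⟨l, (hl.mono_left (nhdsWithin_mono _ inter_subset_right)).congr' ?_⟩,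
      _, (hd.continuousWithinAt.tendsto.mono_left
        (nhdsWithin_mono _ (inter_subset_right.trans Iio_subset_Iic_self))).congr' ?_⟩
    all_goals
      filter_upwards [self_mem_nhdsWithin] with x hx
      exact (h.eq n t x hn hx.1).symm

theorem continuousOn (h : Glued τ Φ y) :
    ContinuousOn (fun q : ℝ × ℝ => y q.1 q.2) (contRegion τ) := fun q hq => by
  obtain ⟨n, hn⟩ := h.exists_lt q.1
  exact (((h.regular n).cont q hq.2.2).continuousWithinAt).congr_of_eventuallyEq
    (h.eventuallyEq hn fun q hq => hq.2.1) (h.eq n _ _ hn hq.2.1)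

theorem contDiffOn (h : Glued τ Φ y) :
    ContDiffOn ℝ 1 (fun q : ℝ × ℝ => y q.1 q.2) (regRegion τ) := fun q hq => by
  obtain ⟨n, hn⟩ := h.exists_lt q.1
  exact (((h.regular n).smooth q hq.2.2).contDiffWithinAt).congr_of_eventuallyEq
    (h.eventuallyEq hn fun q hq => hq.2.1) (h.eq n _ _ hn hq.2.1)

theorem partialT_eq (h : Glued τ Φ y) {n : ℕ} {t z : ℝ} (hq : (t, z) ∈ regRegion τ)
    (hn : t < τ n) :
    partialT y t z = fderiv ℝ (fun q : ℝ × ℝ => Φ n q.1 q.2) (t, z) (1, 0) := by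
  have hd := (((h.regular n).smooth (t, z) hq.2.2).differentiableAt one_ne_zero).hasFDerivAt
  have := hd.comp_hasDerivAt t ((hasDerivAt_id t).prodMk (hasDerivAt_const t z))
  exact (this.congr_of_eventuallyEq (h.eventuallyEq_t hn hq.2.1)).hasDerivWithinAt.derivWithin
    (uniqueDiffOn_Ici 0 t hq.1)

theorem partialZ_eq (h : Glued τ Φ y) {n : ℕ} {t z : ℝ} (hq : (t, z) ∈ regRegion τ)
    (hn : t < τ n) :
    partialZ y t z = fderiv ℝ (fun q : ℝ × ℝ => Φ n q.1 q.2) (t, z) (0, 1) := by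
  have hd := (((h.regular n).smooth (t, z) hq.2.2).differentiableAt one_ne_zero).hasFDerivAt
  have := hd.comp_hasDerivAt z ((hasDerivAt_const z t).prodMk (hasDerivAt_id z))
  exact (this.hasDerivWithinAt.congr (fun x hx => h.eq n t x hn hx)
    (h.eq n t z hn hq.2.1)).derivWithin (uniqueDiffOn_Icc one_pos z hq.2.1)

theorem bounded_partials (h : Glued τ Φ y) (r : ℝ) : ∃ C : ℝ, ∀ t z : ℝ,
    (t, z) ∈ regRegion τ → t ≤ r → |partialT y t z| ≤ C ∧ |partialZ y t z| ≤ C := by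
  obtain ⟨n, hn⟩ := h.exists_lt r
  obtain ⟨M, h0, hM⟩ := (h.regular n).bdd_fderiv (max r 1)
  refine ⟨M, fun t z hq ht => ?_⟩
  have hb : ‖(t, z)‖ ≤ max r 1 := by
    rw [Prod.norm_def]
    refine max_le_max ?_ ?_ <;> rw [Real.norm_eq_abs, abs_of_nonneg]
    exacts [ht, hq.1, hq.2.1.2, hq.2.1.1]
  have := hM (t, z) hq.2.2 hb
  rw [h.partialT_eq hq (ht.trans_lt hn), h.partialZ_eq hq (ht.trans_lt hn)]
  refine ⟨(ContinuousLinearMap.le_of_opNorm_le _ this _).trans_eq ?_,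
    (ContinuousLinearMap.le_of_opNorm_le _ this _).trans_eq ?_⟩ <;> simp [Prod.norm_def]

theorem partialT_add_partialZ (h : Glued τ Φ y) {n : ℕ} {t z : ℝ} (hq : (t, z) ∈ regRegion τ)
    (hn : t < τ n) : partialT y t z + partialZ y t z =
      fderiv ℝ (fun q : ℝ × ℝ => Φ n q.1 q.2) (t, z) (1, 1) := by
  rw [h.partialT_eq hq hn, h.partialZ_eq hq hn, ← map_add]
  simp

end Glued

/-! ### Existence of the closed-loop solution -/

section ClosedLoop

variable {g p : ℝ → ℝ} {f k l L L' K K' : ℝ → ℝ → ℝ}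

/-- The integral of a weight against `charSolution` in terms of the inlet values `v`. -/
theorem integral_mul_charSolution {P v : ℝ → ℝ} {C : Set ℝ} (hP : Continuous P)
    (hL : Continuous fun q : ℝ × ℝ => L q.1 q.2) (hv : PiecewiseCont v C) (t : ℝ) :
    ∫ s in (0 : ℝ)..1, P s * charSolution L v t s =
      ∫ s in (0 : ℝ)..1, (P s + ∫ w in (0 : ℝ)..s, P w * L w (s - w)) * v (t - s) := by
  obtain ⟨M, hM⟩ := hv.bdd (|t| + 1)
  have := integral_mul_transform (x := fun s => v (t - s)) hP hL (hv.meas_comp_sub t)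
    (left_mem_Icc.2 zero_le_one) (M := M) fun s hs => hM _ (by
      refine (abs_sub _ _).trans ?_
      rw [abs_of_nonneg hs.1]
      linarith [hs.2])
  simpa only [charSolution, sub_sub] using this

/-- The two terms are the ones by which the boundary condition differs from v(t): y(t,0) = v(t) + ∫
l(0,r) v(t-r) dr, and ∫ p y. The inlet delay equation is thus equivalent to the boundary condition.
-/
theorem integral_gainExt_mul (hp : ContinuousOn p (Icc 0 1))
    (hL : Continuous fun q : ℝ × ℝ => L q.1 q.2) {v : ℝ → ℝ} {C : Set ℝ}
    (hv : PiecewiseCont v C) (t : ℝ) :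
    ∫ s in (0 : ℝ)..1, gainExt p L s * v (t - s) =
      (∫ r in (0 : ℝ)..1, L 0 r * v (t - r)) +
        ∫ s in (0 : ℝ)..1, p (clamp s) * charSolution L v t s := by
  have hpc := continuous_comp_clamp hp
  have hL0 : Continuous (L 0) := hL.comp (f := fun s : ℝ => (0, s)) (by fun_prop)
  have hg : Continuous fun s => p (clamp s) + ∫ w in (0 : ℝ)..s, p (clamp w) * L w (s - w) := by
    refine ((continuous_gainExt hp hL).sub hL0).congr fun s => ?_
    simp only [Pi.sub_apply, gainExt]
    ring
  rw [integral_mul_charSolution hpc hL hv, ← intervalIntegral.integral_add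
    (hv.intervalIntegrable_mul_comp_sub hL0 t 0 1) (hv.intervalIntegrable_mul_comp_sub hg t 0 1)]
  refine intervalIntegral.integral_congr fun s _ => ?_
  unfold gainExt
  ring

/-- An extension of the transformed initial datum, as a function of `-z`. -/
theorem KernelData.exists_history (h : KernelData g f L L' K K') {y₀ : ℝ → ℝ}
    (hy : ContDiffOn ℝ 1 y₀ (Icc 0 1)) :
    ∃ ξ η : ℝ → ℝ, Continuous η ∧ (∀ x, HasDerivAt ξ (η x) x) ∧ (∃ M, ∀ x, |η x| ≤ M) ∧
      (∀ z ∈ Icc (0 : ℝ) 1, ξ (-z) = y₀ z - ∫ r in (0 : ℝ)..1 - z, K z r * y₀ (z + r)) ∧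
      ∀ z ∈ Icc (0 : ℝ) 1, ξ (-z) + ∫ r in (0 : ℝ)..1 - z, L z r * ξ (-z - r) = y₀ z := by
  obtain ⟨Y, Y', hY', hY, -, hYy⟩ := exists_contDiff_extension one_pos hy
  have cY : Continuous Y := continuous_iff_continuousAt.2 fun x => (hY x).continuousAt
  have hB : IsPrimitive (fun c => Y (-c)) (fun c => -Y' (-c)) ∅ :=
    .of_hasDerivAt (by fun_prop) fun x => by
      have := (hY (-x)).scomp x (hasDerivAt_neg x)
      rwa [neg_one_smul] at this
  have hYc : ContDiff ℝ 1 fun c => Y (-c) := contDiff_iff_contDiffAt.2 fun x =>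
    hB.contDiffAt (notMem_empty x)
  have hX : ContDiff ℝ 1 fun x : ℝ => Y (-x) - ∫ r in (0 : ℝ)..1 - -x, K (-x) r * Y (-(x - r)) :=
    hYc.sub ((h.smooth_K.contDiff_conv hB).comp (f := fun x : ℝ => (x, -x, 1 - -x)) (by fun_prop))
  -- At t = 0 the transformed state x(0,z) is v(-z), so the transformed datum is the history of v on
  -- [-1,0].
  obtain ⟨ξ, η, hη, hξ, hM, hξX⟩ := exists_contDiff_extension
    (show (-1 : ℝ) < 0 by norm_num) (hX.contDiffOn (s := Icc (-1) 0))
  have e1 : ∀ z ∈ Icc (0 : ℝ) 1, ξ (-z) = Y z - ∫ r in (0 : ℝ)..1 - z, K z r * Y (z + r) :=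
    fun z hz => by
      rw [hξX (-z) ⟨by linarith [hz.2], by linarith [hz.1]⟩]
      simp only [neg_neg, neg_sub, sub_neg_eq_add]
      simp only [add_comm]
  refine ⟨ξ, η, hη, hξ, hM, fun z hz => ?_, fun z hz => ?_⟩
  · rw [e1 z hz, hYy z hz]
    congr 1
    refine intervalIntegral.integral_congr fun r hr => ?_
    rw [uIcc_of_le (by linarith [hz.2])] at hr
    rw [hYy _ ⟨by linarith [hz.1, hr.1], by linarith [hr.2]⟩]
  · rw [← hYy z hz, ← h.transform_transform cY (X := fun z =>
      Y z - ∫ r in (0 : ℝ)..1 - z, K z r * Y (z + r)) (fun _ => rfl) hz, ← e1 z hz]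
    congr 1
    refine intervalIntegral.integral_congr fun r hr => ?_
    rw [uIcc_of_le (by linarith [hz.2])] at hr
    rw [← e1 (z + r) ⟨by linarith [hz.1, hr.1], by linarith [hr.2]⟩, neg_add']

/-- The closed loop solution `y` is the inverse transform of a delayed inlet value `v`; on
`t < τ n`, `v` coincides with the `n`-th of a sequence of piecewise continuous functions. -/
structure InletRepresentation (p : ℝ → ℝ) (L K : ℝ → ℝ → ℝ) (τ : ℕ → ℝ) (y₀ : ℝ → ℝ)
    (v : ℕ → ℝ → ℝ) (y : ℝ → ℝ → ℝ) : Prop where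
  piecewise : ∀ n, ∃ C, PiecewiseCont (v n) C
  history : ∀ n, ∀ z ∈ Ioc (0 : ℝ) 1,
    v n (-z) = y₀ z - ∫ r in (0 : ℝ)..1 - z, K z r * y₀ (z + r)
  closed_loop : ∀ n i t, i < n → t ∈ Ico (τ i) (τ (i + 1)) →
    v n t + ∫ s in (0 : ℝ)..1, gainExt p L s * v n (t - s) =
      ∫ s in (0 : ℝ)..1, gainExt p L s * v n (τ i - s)
  eq : ∀ n t z, t < τ n → z ∈ Icc (0 : ℝ) 1 → y t z = charSolution L (v n) t z

/-- y is defined as the inverse transform of the inlet values, so only l enters the differential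
equation; k enters through the history and the sampled feedback. -/
theorem KernelData.exists_closedLoopSolution (h : KernelData g f L L' K K')
    (hp : ContinuousOn p (Icc 0 1))
    (hf : ContinuousOn (fun q : ℝ × ℝ => f q.1 q.2) (Icc 0 1 ×ˢ Icc 0 1))
    (hl : ∀ z r, 0 ≤ z → 0 ≤ r → z + r ≤ 1 → L z r = l z (z + r))
    (hk : ∀ z r, 0 ≤ z → 0 ≤ r → z + r ≤ 1 → K z r = k z (z + r)) {y₀ : ℝ → ℝ}
    (hy : ContDiffOn ℝ 1 y₀ (Icc 0 1)) {τ : ℕ → ℝ} (hτ : StrictMono τ) (hτ0 : τ 0 = 0)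
    (hτt : Tendsto τ atTop atTop) :
    ∃ (y : ℝ → ℝ → ℝ) (v : ℕ → ℝ → ℝ), IsClosedLoopSolution g p f k τ y₀ y ∧
      InletRepresentation p L K τ y₀ v y := by
  have cL := h.smooth_L.cont
  obtain ⟨ξ, η, hη, hξ, ⟨M, hM⟩, hξ1, hξ2⟩ := h.exists_history hy
  obtain ⟨β, B, b, v, C, hv⟩ := exists_inletData (continuous_gainExt hp cL) hη hξ hM hτ hτ0
  -- Any approximation whose active sampling instants go beyond t may be used; by `hv.agree` and
  -- causality the choice does not matter.
  choose N hN using fun t => (hτt.eventually_gt_atTop t).exists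
  set y : ℝ → ℝ → ℝ := fun t z => charSolution L (v (N t)) t z with hydef
  have hyeq : ∀ n t z, t < τ n → z ∈ Icc (0 : ℝ) 1 → y t z = charSolution L (v n) t z :=
    fun n t z ht hz => charSolution_congr hz fun s hs =>
      hv.agree _ _ _ (hs.trans_lt (hN t)) (hs.trans_lt ht)
  have hprof : ∀ n t z, z ≤ 1 → profile L (B n) τ β n t z = charSolution L (v n) t z :=
    fun n t z hz => profile_eq cL (hv.prim n).continuous (hv.eq n) t hz
  have hpc : ∀ n, PiecewiseCont (v n) (∅ ∪ ⋃ j ∈ Finset.range n, (fun x => x + τ j) '' {0}) :=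
    fun n => by
      have := (PiecewiseCont.of_continuous (hv.prim n).continuous).add
        (.sum (Finset.range n) fun j _ => (piecewiseCont_step.comp_sub (τ j)).const_mul (β j))
      rwa [show v n = fun t => B n t + ∑ j ∈ Finset.range n, β j * step (t - τ j) from
        funext (hv.eq n)]
  have G : Glued τ (fun n => profile L (B n) τ β n) y :=
    { tendsto := hτt
      regular := fun n => pieceRegular_profile h.smooth_L (hv.prim n) τ β n (hv.sing n)
      eq := fun n t z ht hz => (hyeq n t z ht hz).trans (hprof n t z hz.2).symm }
  have hyint : ∀ (P Q : ℝ → ℝ) n t, t < τ n → (∀ s ∈ Icc (0 : ℝ) 1, P s = Q s) →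
      ∫ s in (0 : ℝ)..1, P s * y t s = ∫ s in (0 : ℝ)..1, Q s * charSolution L (v n) t s :=
    fun P Q n t ht hPQ => intervalIntegral.integral_congr fun s hs => by
      rw [uIcc_of_le zero_le_one] at hs
      rw [hPQ s hs, hyeq n t s ht hs]
  refine ⟨y, v, ⟨fun z hz => G.piecewise_t hz, fun z hz t _ => G.right_diff_t hz t,
    fun t _ => G.piecewise_z t, fun t _ z hz => ?_, G.continuousOn, G.contDiffOn,
    fun t _ z hz => G.left_diff_z t (Ioc_subset_Icc_self hz), fun r _ => G.bounded_partials r,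
    fun t z hq => ?_, fun i t ht => ?_, fun z hz => ?_⟩, fun n => ⟨_, hpc n⟩, fun n z hz => ?_,
    hv.closed_loop, hyeq⟩
  · obtain ⟨d, hd⟩ := G.left_diff_z t hz
    exact hd.continuousWithinAt
  · rw [G.partialT_add_partialZ hq (hN t), h.fderiv_diag hf (hpc (N t)) (hprof (N t)) hq.2.1 ?_
      (((G.regular (N t)).smooth (t, z) hq.2.2).differentiableAt one_ne_zero),
      ← G.eq (N t) t 1 (hN t) (by simp)]
    · congr 1
      refine intervalIntegral.integral_congr fun s hs => ?_
      rw [uIcc_of_le hq.2.1.2] at hs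
      rw [G.eq (N t) t s (hN t) ⟨hq.2.1.1.trans hs.1, hs.2⟩]
    · simp only [image_singleton, zero_add, empty_union, mem_iUnion, not_exists]
      intro j _ hj
      exact (hq.2.2 j).2.2 (by linarith [show t - 1 = τ j from hj])
  · have hi : τ i < τ (i + 1) := hτ i.lt_succ_self
    have e1 := hv.closed_loop (i + 1) i t i.lt_succ_self ht
    have e2 : feedbackInput p k τ y i = ∫ s in (0 : ℝ)..1, gainExt p L s * v (i + 1) (τ i - s) := by
      have hK0 : Continuous (K 0) := h.smooth_K.cont.comp (f := fun s : ℝ => (0, s)) (by fun_prop)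
      rw [feedbackInput, hyint (fun s => p s + k 0 s) (fun s => p (clamp s) + K 0 s) (i + 1) (τ i) hi
        fun s hs => by rw [clamp_of_mem hs, hk 0 s le_rfl hs.1 (by linarith [hs.2]), zero_add],
        integral_mul_charSolution (P := fun s => p (clamp s) + K 0 s)
          ((continuous_comp_clamp hp).add hK0) cL (hpc (i + 1))]
      refine intervalIntegral.integral_congr fun s hs => ?_
      rw [uIcc_of_le zero_le_one] at hs
      rw [← h.kTilde_eq_gainExt hp hl hk hs, kTilde_eq hl hk hs]
    rw [integral_gainExt_mul hp cL (hpc (i + 1))] at e1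
    rw [e2, ← e1, hyeq (i + 1) t 0 ht.2 (by simp), hyint p (fun s => p (clamp s)) (i + 1) t ht.2
      fun s hs => by rw [clamp_of_mem hs]]
    simp only [charSolution, sub_zero]
    ring
  · rw [← hξ2 z (Ioc_subset_Icc_self hz)]
    simp only [hydef, charSolution, zero_sub]
    rw [hv.history _ (-z) (by linarith [hz.1])]
    congr 1
    refine intervalIntegral.integral_congr fun r hr => ?_
    rw [uIcc_of_le (by linarith [hz.2])] at hr
    rw [hv.history _ (-z - r) (by linarith [hz.1, hr.1])]
  · rw [hv.history n (-z) (by linarith [hz.1]), hξ1 z (Ioc_subset_Icc_self hz)]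

end ClosedLoop

/-! ### Uniqueness by integration along characteristics -/

/-- One-sided limits bound the function near each point, and compactness makes the bound uniform. -/
theorem PiecewiseContOn.exists_bound {φ : ℝ → ℝ} {I K : Set ℝ} (h : PiecewiseContOn φ I)
    (hK : K ⊆ I) (hc : IsCompact K) : ∃ M, ∀ x ∈ K, |φ x| ≤ M := by
  refine hc.induction_on (p := fun s => ∃ M, ∀ x ∈ s, |φ x| ≤ M) ⟨0, by simp⟩
    (fun s t hst ⟨M, hM⟩ => ⟨M, fun x hx => hM x (hst hx)⟩) ?_ ?_
  · rintro s t ⟨M, hM⟩ ⟨N, hN⟩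
    exact ⟨max M N, fun x hx => hx.elim (fun hx => (hM x hx).trans (le_max_left _ _))
      fun hx => (hN x hx).trans (le_max_right _ _)⟩
  · intro x hx
    obtain ⟨⟨l, hl⟩, ⟨l', hl'⟩⟩ := h.2 x (hK hx)
    have e1 : ∀ᶠ r in 𝓝[I ∩ Ioi x] x, |φ r| < |l| + 1 :=
      hl.abs.eventually_lt_const (lt_add_one _)
    have e2 : ∀ᶠ r in 𝓝[I ∩ Iio x] x, |φ r| < |l'| + 1 :=
      hl'.abs.eventually_lt_const (lt_add_one _)
    rw [eventually_nhdsWithin_iff] at e1 e2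
    refine ⟨{r | r ∈ K ∧ |φ r| ≤ max (|φ x|) (max (|l| + 1) (|l'| + 1))}, ?_, _, fun r hr => hr.2⟩
    rw [mem_nhdsWithin_iff_eventually]
    filter_upwards [e1, e2] with r h1 h2 hr
    refine ⟨hr, ?_⟩
    rcases lt_trichotomy r x with h3 | rfl | h3
    · exact (h2 ⟨hK hr, h3⟩).le.trans ((le_max_right _ _).trans (le_max_right _ _))
    · exact le_max_left _ _
    · exact (h1 ⟨hK hr, h3⟩).le.trans ((le_max_left _ _).trans (le_max_right _ _))

theorem PiecewiseContOn.intervalIntegrable {φ : ℝ → ℝ} {a b : ℝ}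
    (h : PiecewiseContOn φ (Icc a b)) (hab : a ≤ b) : IntervalIntegrable φ volume a b := by
  obtain ⟨M, hM⟩ := h.exists_bound subset_rfl isCompact_Icc
  set S := {t ∈ Icc a b | ¬ ContinuousWithinAt φ (Icc a b) t} with hS
  have hfin : S.Finite := h.1 _ subset_rfl isCompact_Icc
  have hcont : ContinuousOn φ (Icc a b \ S) := fun x hx => by
    by_contra hne
    exact hx.2 ⟨hx.1, fun h => hne (h.mono sdiff_subset)⟩
  have hae : (Icc a b \ S : Set ℝ) =ᵐ[volume] Icc a b :=
    sdiff_null_ae_eq_self (hfin.measure_zero volume)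
  have hmeas := hcont.aestronglyMeasurable (μ := volume)
    (measurableSet_Icc.diff hfin.measurableSet)
  rw [Measure.restrict_congr_set hae] at hmeas
  rw [intervalIntegrable_iff_integrableOn_Icc_of_le hab]
  exact Integrable.of_bound hmeas M ((ae_restrict_mem measurableSet_Icc).mono hM)

/-- The mean value inequality for a function differentiable off a countable set. -/
theorem abs_sub_le_integral {F F' E : ℝ → ℝ} {a b : ℝ} {S : Set ℝ} (hab : a ≤ b)
    (hS : S.Countable) (hF : ContinuousOn F (Icc a b)) (hE : Continuous E)
    (hd : ∀ x ∈ Ioo a b \ S, HasDerivAt F (F' x) x) (hb : ∀ x ∈ Ioo a b \ S, |F' x| ≤ E x) :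
    |F b - F a| ≤ ∫ x in a..b, E x := by
  have hae : ∀ᵐ x : ℝ, x ∈ Ioc a b → |deriv F x| ≤ E x := by
    filter_upwards [(hS.insert b).ae_notMem volume] with x hx hxab
    rw [mem_insert_iff, not_or] at hx
    have hx' : x ∈ Ioo a b \ S := ⟨⟨hxab.1, lt_of_le_of_ne hxab.2 hx.1⟩, hx.2⟩
    rw [(hd x hx').deriv]
    exact hb x hx'
  have hint : IntervalIntegrable (deriv F) volume a b := by
    refine (hE.intervalIntegrable a b).mono_fun' (measurable_deriv F).aestronglyMeasurable ?_
    rw [uIoc_of_le hab, EventuallyLE, ae_restrict_iff' measurableSet_Ioc]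
    exact hae
  rw [← integral_eq_of_hasDerivAt_off_countable_of_le F (deriv F) hab hS hF
    (fun x hx => (hd x hx).differentiableAt.hasDerivAt) hint]
  exact intervalIntegral.norm_integral_le_of_norm_le (f := deriv F) hab hae (hE.intervalIntegrable a b)

theorem eventually_ne_of_tendsto_atTop {τ : ℕ → ℝ} (hτ : Tendsto τ atTop atTop) (x : ℝ) :
    ∀ᶠ r in 𝓝[≠] x, ∀ i, r ≠ τ i := by
  have hfin : {i | τ i ≤ x + 1}.Finite := by
    have := hτ.eventually_gt_atTop (x + 1)
    rw [← Nat.cofinite_eq_atTop, eventually_cofinite] at this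
    simpa using this
  have h1 : ∀ᶠ r in 𝓝[≠] x, ∀ i ∈ {i | τ i ≤ x + 1}, r ≠ τ i := by
    rw [hfin.eventually_all]
    intro i _
    by_cases h : τ i = x
    · rw [h]; exact self_mem_nhdsWithin
    · exact eventually_nhdsWithin_of_eventually_nhds (eventually_ne_nhds (Ne.symm h))
  have h2 : ∀ᶠ r in 𝓝[≠] x, r < x + 1 :=
    eventually_nhdsWithin_of_eventually_nhds (eventually_lt_nhds (lt_add_one x))
  filter_upwards [h1, h2] with r h1 h2 i h3
  exact h1 i (h3 ▸ h2.le) h3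

/-- The value `c` of `t - z` is not on one of the singular characteristics. -/
def IsGeneric (τ : ℕ → ℝ) (c : ℝ) : Prop := ∀ i, c ≠ τ i ∧ c ≠ 1 + τ i

theorem eventually_isGeneric {τ : ℕ → ℝ} (hτ : Tendsto τ atTop atTop) (x : ℝ) :
    ∀ᶠ r in 𝓝[≠] x, IsGeneric τ r := by
  filter_upwards [eventually_ne_of_tendsto_atTop hτ x, eventually_ne_of_tendsto_atTop
    (tendsto_atTop_add_const_left _ 1 hτ) x] with r h1 h2 i
  exact ⟨h1 i, h2 i⟩

theorem eventually_nhds_of_nhdsNE {P : ℝ → Prop} {x : ℝ} (h : ∀ᶠ r in 𝓝[≠] x, P r) (hx : P x) :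
    ∀ᶠ r in 𝓝 x, P r := by
  rw [eventually_nhdsWithin_iff] at h
  filter_upwards [h] with r hr
  by_cases e : r = x
  exacts [e ▸ hx, hr e]

namespace IsSampledSolution

variable {g p : ℝ → ℝ} {f : ℝ → ℝ → ℝ} {τ u : ℕ → ℝ} {y₀ : ℝ → ℝ} {y : ℝ → ℝ → ℝ}

/-- A generic characteristic meets none of the jump lines t - z = τ i. It may cross lines t = 1 + τ
i, where only differentiability can fail. -/
theorem continuousOn_char (h : IsSampledSolution g p f τ u y₀ y) {c : ℝ} (hc : IsGeneric τ c) :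
    ContinuousOn (fun z => y (c + z) z) (Icc (max 0 (-c)) 1) := by
  refine h.cont.comp (f := fun z : ℝ => (c + z, z)) (by fun_prop) fun z hz => ⟨?_, ?_, fun i => ?_⟩
  · linarith [(le_max_right 0 (-c)).trans hz.1]
  · exact ⟨(le_max_left 0 (-c)).trans hz.1, hz.2⟩
  · simpa using (hc i).1

theorem mem_regRegion {c z : ℝ} (hc : IsGeneric τ c) (hz : z ∈ Ioo (max 0 (-c)) 1)
    (hne : ∀ i, c + z ≠ 1 + τ i) : (c + z, z) ∈ regRegion τ := by
  refine ⟨?_, ⟨(le_max_left 0 (-c)).trans hz.1.le, hz.2.le⟩, fun i => ⟨?_, ?_, hne i⟩⟩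
  · linarith [(le_max_right 0 (-c)).trans hz.1.le]
  · simpa using (hc i).1
  · simpa using (hc i).2

theorem hasDerivAt_char (h : IsSampledSolution g p f τ u y₀ y) (hτ : Tendsto τ atTop atTop)
    {c z : ℝ} (hc : IsGeneric τ c) (hz : z ∈ Ioo (max 0 (-c)) 1) (hne : ∀ i, c + z ≠ 1 + τ i) :
    HasDerivAt (fun x => y (c + x) x) (partialT y (c + z) z + partialZ y (c + z) z) z := by
  have hq := mem_regRegion hc hz hne
  have h0 : 0 < z := (le_max_left 0 (-c)).trans_lt hz.1
  have ht : 0 < c + z := by linarith [(le_max_right 0 (-c)).trans_lt hz.1]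
  have hnhds : regRegion τ ∈ 𝓝 (c + z, z) := by
    have c1 : Tendsto (fun q : ℝ × ℝ => q.1 - q.2) (𝓝 (c + z, z)) (𝓝 c) := by
      have : Continuous fun q : ℝ × ℝ => q.1 - q.2 := by fun_prop
      simpa using this.tendsto (c + z, z)
    filter_upwards [c1.eventually (eventually_nhds_of_nhdsNE (eventually_isGeneric hτ c) hc),
      continuous_fst.continuousAt.eventually (eventually_nhds_of_nhdsNE
        (eventually_ne_of_tendsto_atTop (tendsto_atTop_add_const_left _ 1 hτ) (c + z)) hne),
      continuous_fst.continuousAt.eventually (eventually_gt_nhds ht),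
      continuous_snd.continuousAt.eventually (Icc_mem_nhds h0 hz.2)] with q h1 h2 h3 h4
    exact ⟨le_of_lt h3, h4, fun i => ⟨(h1 i).1, (h1 i).2, h2 i⟩⟩
  have hd := ((h.contDiff _ hq).contDiffAt hnhds).differentiableAt one_ne_zero |>.hasFDerivAt
  have e1 := hd.comp_hasDerivAt (c + z) ((hasDerivAt_id (c + z)).prodMk (hasDerivAt_const _ z))
  have e2 := hd.comp_hasDerivAt z ((hasDerivAt_const z (c + z)).prodMk (hasDerivAt_id z))
  have e3 : partialT y (c + z) z = _ :=
    e1.hasDerivWithinAt.derivWithin (uniqueDiffOn_Ici 0 _ ht.le)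
  have e4 : partialZ y (c + z) z = _ :=
    e2.hasDerivWithinAt.derivWithin (uniqueDiffOn_Icc one_pos z hq.2.1)
  rw [e3, e4, ← map_add]
  have := HasFDerivAt.comp_hasDerivAt (f := fun x : ℝ => (c + x, x)) z hd
    (((hasDerivAt_id z).const_add c).prodMk (hasDerivAt_id z))
  rwa [Prod.mk_add_mk, zero_add, add_zero]

end IsSampledSolution

/-- Properties of the difference `w` of two solutions of the closed loop. -/
structure IsHomogeneous (τ : ℕ → ℝ) (a q : ℝ) (w : ℝ → ℝ → ℝ) : Prop where
  left_cont : ∀ t, 0 ≤ t → ∀ z ∈ Icc (0 : ℝ) 1, ContinuousWithinAt (w t) (Icc 0 z) z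
  cont : ∀ c, IsGeneric τ c → ContinuousOn (fun z => w (c + z) z) (Icc (max 0 (-c)) 1)
  diff : ∀ c z, IsGeneric τ c → z ∈ Ioo (max 0 (-c)) 1 → (∀ i, c + z ≠ 1 + τ i) →
    DifferentiableAt ℝ (fun x => w (c + x) x) z
  deriv_le : ∀ c z m, IsGeneric τ c → z ∈ Ioo (max 0 (-c)) 1 → (∀ i, c + z ≠ 1 + τ i) →
    (∀ s ∈ Icc (0 : ℝ) 1, |w (c + z) s| ≤ m) → |deriv (fun x => w (c + x) x) z| ≤ a * m
  deriv_bdd : ∀ R, ∃ C, ∀ c z, IsGeneric τ c → z ∈ Ioo (max 0 (-c)) 1 →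
    (∀ i, c + z ≠ 1 + τ i) → c + z ≤ R → |deriv (fun x => w (c + x) x) z| ≤ C
  inlet_bdd : ∀ R, ∃ M, ∀ t ∈ Icc 0 R, |w t 0| ≤ M
  inlet : ∀ t, 0 ≤ t → ∃ s ∈ Icc 0 t, ∀ m μ, 0 ≤ m → 0 < μ →
    (∀ x, x = s ∨ x = t → ∀ r ∈ Icc (0 : ℝ) 1, |w x r| ≤ m * Real.exp (μ * (1 - r))) →
    |w t 0| ≤ q * (m / μ * Real.exp μ)
  initial : ∀ z ∈ Ioc (0 : ℝ) 1, w 0 z = 0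

namespace IsHomogeneous

variable {τ : ℕ → ℝ} {a q : ℝ} {w : ℝ → ℝ → ℝ}

/-- The characteristic through (t,z) is followed back to its entry point: the inlet at time t - z if
z ≤ t, otherwise the initial line at height z - t > 0, where w = 0. -/
theorem abs_le_of_generic (h : IsHomogeneous τ a q w) {R : ℝ} {U E : ℝ → ℝ}
    (hE : Continuous E) (hU0 : ∀ x, 0 ≤ U x) (hU : ∀ t ∈ Icc 0 R, |w t 0| ≤ U t)
    (hd : ∀ c z, IsGeneric τ c → z ∈ Ioo (max 0 (-c)) 1 → (∀ i, c + z ≠ 1 + τ i) → c + z ≤ R →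
      |deriv (fun x => w (c + x) x) z| ≤ E (c + z)) {t z : ℝ} (ht : t ∈ Icc 0 R)
    (hz : z ∈ Icc (0 : ℝ) 1) (hc : IsGeneric τ (t - z)) :
    |w t z| ≤ U (t - z) + ∫ x in (max 0 (z - t))..z, E (t - z + x) := by
  have hz0 : max 0 (z - t) ≤ z := max_le hz.1 (by linarith [ht.1])
  have hcont := h.cont (t - z) hc
  rw [neg_sub] at hcont
  have key := abs_sub_le_integral (F' := deriv fun x => w (t - z + x) x)
    (S := range fun i => 1 + τ i - (t - z)) hz0 (countable_range _)
    (hcont.mono (Icc_subset_Icc_right hz.2)) (E := fun x => E (t - z + x)) (by fun_prop)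
    (fun x hx => (h.diff _ _ hc (by rw [neg_sub]; exact ⟨hx.1.1, hx.1.2.trans_le hz.2⟩)
      fun i hi => hx.2 ⟨i, by simp only; linarith⟩).hasDerivAt)
    fun x hx => hd _ _ hc (by rw [neg_sub]; exact ⟨hx.1.1, hx.1.2.trans_le hz.2⟩)
      (fun i hi => hx.2 ⟨i, by simp only; linarith⟩) (by linarith [hx.1.2, ht.2])
  have hstart : |w (t - z + max 0 (z - t)) (max 0 (z - t))| ≤ U (t - z) := by
    rcases le_or_gt (z - t) 0 with h1 | h1
    · rw [max_eq_left h1, add_zero]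
      exact hU _ ⟨by linarith, by linarith [ht.2, hz.1]⟩
    · rw [max_eq_right h1.le, show t - z + (z - t) = 0 by ring,
        h.initial _ ⟨h1, by linarith [ht.1, hz.2]⟩, abs_zero]
      exact hU0 _
  beta_reduce at key
  rw [sub_add_cancel] at key
  have := abs_sub_abs_le_abs_sub (w t z) (w (t - z + max 0 (z - t)) (max 0 (z - t)))
  linarith

/-- Generic points accumulate at z from the left, and w(t,·) is left continuous, so bounds extend to
all z > 0. -/
theorem abs_le_of_left (h : IsHomogeneous τ a q w) (hτ : Tendsto τ atTop atTop) {t z : ℝ}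
    {E : ℝ → ℝ} (hE : Continuous E) (ht : 0 ≤ t) (hz : z ∈ Ioc (0 : ℝ) 1)
    (hb : ∀ x ∈ Icc (0 : ℝ) 1, IsGeneric τ (t - x) → |w t x| ≤ E x) : |w t z| ≤ E z := by
  have h1 : Tendsto (w t) (𝓝[<] z) (𝓝 (w t z)) :=
    (h.left_cont t ht z (Ioc_subset_Icc_self hz)).tendsto.mono_left (by
      rw [nhdsWithin_le_iff]
      filter_upwards [Ioo_mem_nhdsLT hz.1] with x hx using Ioo_subset_Icc_self hx)
  have h2 : ∀ᶠ x in 𝓝[<] z, IsGeneric τ (t - x) := by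
    have : Tendsto (fun x => t - x) (𝓝[<] z) (𝓝[≠] (t - z)) := by
      refine tendsto_nhdsWithin_iff.2 ⟨?_, ?_⟩
      · exact (continuous_sub_left t).continuousAt.tendsto.mono_left nhdsWithin_le_nhds
      · filter_upwards [self_mem_nhdsWithin] with x hx hne
        have : t - x = t - z := hne
        have hx' : x < z := hx
        linarith
    exact this.eventually (eventually_isGeneric hτ (t - z))
  refine le_of_tendsto_of_tendsto h1.abs (hE.continuousAt.tendsto.mono_left nhdsWithin_le_nhds) ?_
  filter_upwards [h2, Ioo_mem_nhdsLT hz.1] with x hx hx'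
  exact hb x ⟨hx'.1.le, hx'.2.le.trans hz.2⟩ hx

theorem eq_zero (h : IsHomogeneous τ a q w) (hτ : Tendsto τ atTop atTop) (ha : 0 ≤ a)
    (hq : 0 ≤ q) {t z : ℝ} (ht : 0 ≤ t) (hz : z ∈ Icc (0 : ℝ) 1) : w t z = 0 := by
  -- Integrating the weight e^{μ(1-z)} in the inlet condition gains 1/μ; this μ makes that
  -- contribution at most a quarter of the bound, since q/μ ≤ 1/4.
  obtain ⟨μ, hμ⟩ : ∃ μ : ℝ, μ = 4 * q + 1 := ⟨_, rfl⟩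
  have hμ0 : 0 < μ := by linarith
  -- lam ≥ μ lets the inlet bound propagate along characteristics without loss in the weight, and
  -- lam ≥ 4 a e^μ makes the integral of the source another quarter.
  obtain ⟨lam, hlam⟩ : ∃ lam : ℝ, lam = μ + 4 * a * Real.exp μ := ⟨_, rfl⟩
  have hlμ : μ ≤ lam := by linarith [show 0 ≤ 4 * a * Real.exp μ by positivity]
  have hl0 : 0 < lam := hμ0.trans_le hlμ
  set P : ℝ → Prop := fun B => ∀ x ∈ Icc 0 t, ∀ s ∈ Icc (0 : ℝ) 1,
    |w x s| ≤ B * Real.exp (lam * x + μ * (1 - s)) with hP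
  have hbase : ∃ B, 0 ≤ B ∧ P B := by
    -- An a priori bound is needed to start the halving: it comes from the bounded inlet values and
    -- the bounded partial derivatives.
    obtain ⟨M, hM⟩ := h.inlet_bdd t
    obtain ⟨C, hC⟩ := h.deriv_bdd t
    have hb : ∀ x ∈ Icc 0 t, ∀ s ∈ Icc (0 : ℝ) 1, |w x s| ≤ |M| + |C| := fun x hx s hs => by
      rcases hs.1.eq_or_lt with rfl | hs0
      · exact ((hM x hx).trans (le_abs_self M)).trans (le_add_of_nonneg_right (abs_nonneg C))
      refine h.abs_le_of_left hτ continuous_const hx.1 ⟨hs0, hs.2⟩ fun r hr hc => ?_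
      refine (h.abs_le_of_generic (U := fun _ => |M|) (E := fun _ => |C|) continuous_const
        (fun _ => abs_nonneg M) (fun x hx => (hM x hx).trans (le_abs_self M))
        (fun c z h1 h2 h3 h4 => (hC c z h1 h2 h3 h4).trans (le_abs_self C)) hx hr hc).trans ?_
      rw [intervalIntegral.integral_const, smul_eq_mul]
      gcongr
      refine mul_le_of_le_one_left (abs_nonneg C) ?_
      linarith [le_max_left 0 (r - x), hr.2]
    refine ⟨|M| + |C|, by positivity, fun x hx s hs => (hb x hx s hs).trans
      (le_mul_of_one_le_right (by positivity) (Real.one_le_exp ?_))⟩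
    have := mul_nonneg hl0.le hx.1
    have := mul_nonneg hμ0.le (sub_nonneg.2 hs.2)
    linarith
  have hstep : ∀ B, 0 ≤ B → P B → P (B / 2) := fun B hB hPB => by
    have hin : ∀ x ∈ Icc 0 t, |w x 0| ≤ B / 4 * Real.exp (lam * x + μ) := fun x hx => by
      obtain ⟨s, hs, hsx⟩ := h.inlet x hx.1
      have := hsx (B * Real.exp (lam * x)) μ (by positivity) hμ0 fun r hr v hv => by
        have hr' : r ∈ Icc 0 t := by
          rcases hr with rfl | rfl
          exacts [⟨hs.1, hs.2.trans hx.2⟩, hx]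
        refine (hPB r hr' v hv).trans ?_
        rw [Real.exp_add, ← mul_assoc]
        gcongr
        rcases hr with rfl | rfl
        exacts [hs.2, le_rfl]
      refine this.trans ?_
      rw [Real.exp_add, show q * (B * Real.exp (lam * x) / μ * Real.exp μ) =
        q / μ * (B * (Real.exp (lam * x) * Real.exp μ)) by ring,
        show B / 4 * (Real.exp (lam * x) * Real.exp μ) =
        1 / 4 * (B * (Real.exp (lam * x) * Real.exp μ)) by ring]
      refine mul_le_mul_of_nonneg_right ?_ (by positivity)
      rw [div_le_iff₀ hμ0]
      linarith
    have hgen : ∀ x ∈ Icc 0 t, ∀ r ∈ Icc (0 : ℝ) 1, IsGeneric τ (x - r) →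
        |w x r| ≤ B / 2 * Real.exp (lam * x + μ * (1 - r)) := fun x hx r hr hc => by
      refine (h.abs_le_of_generic (R := t) (U := fun x => B / 4 * Real.exp (lam * x + μ))
        (E := fun x => a * (B * Real.exp (lam * x + μ))) (by fun_prop) (fun _ => by positivity) hin
        (fun c z h1 h2 h3 h4 => h.deriv_le c z _ h1 h2 h3 fun s hs => ?_) hx hr hc).trans ?_
      · refine (hPB (c + z) ⟨by linarith [(le_max_right 0 (-c)).trans_lt h2.1], h4⟩ s hs).trans ?_
        gcongr
        exact mul_le_of_le_one_right hμ0.le (by linarith [hs.1])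
      · have e1 := (le_abs_self _).trans (abs_integral_le_exp (lam := lam)
          (M := a * B * Real.exp (lam * (x - r) + μ)) (φ := fun y =>
            a * (B * Real.exp (lam * (x - r + y) + μ))) hl0 (by positivity)
          (max_le hr.1 (by linarith [hx.1]) : max 0 (r - x) ≤ r) fun v _ => by
            rw [abs_of_nonneg (by positivity), mul_assoc (a * B), ← Real.exp_add, ← mul_assoc]
            apply le_of_eq
            ring_nf)
        have e2 : a * B * Real.exp (lam * (x - r) + μ) / lam * Real.exp (lam * r) ≤
            B / 4 * Real.exp (lam * x + μ * (1 - r)) := by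
          rw [show a * B * Real.exp (lam * (x - r) + μ) / lam * Real.exp (lam * r) =
            B * (a / lam) * (Real.exp (lam * (x - r) + μ) * Real.exp (lam * r)) by ring,
            ← Real.exp_add, show lam * (x - r) + μ + lam * r = μ * r + (lam * x + μ * (1 - r)) by
            ring, Real.exp_add, show B * (a / lam) * (Real.exp (μ * r) *
            Real.exp (lam * x + μ * (1 - r))) = B * (a * Real.exp (μ * r) / lam) *
            Real.exp (lam * x + μ * (1 - r)) by ring, show B / 4 = B * (1 / 4) by ring]
          refine mul_le_mul_of_nonneg_right (mul_le_mul_of_nonneg_left ?_ hB) (Real.exp_pos _).le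
          rw [div_le_iff₀ hl0]
          have : Real.exp (μ * r) ≤ Real.exp μ :=
            Real.exp_le_exp.2 (mul_le_of_le_one_right hμ0.le hr.2)
          have := mul_le_mul_of_nonneg_left this ha
          linarith
        have e3 : B / 4 * Real.exp (lam * (x - r) + μ) ≤
            B / 4 * Real.exp (lam * x + μ * (1 - r)) := by
          refine mul_le_mul_of_nonneg_left (Real.exp_le_exp.2 ?_) (by positivity)
          have := mul_le_mul_of_nonneg_right hlμ hr.1
          linarith
        linarith
    intro x hx s hs
    rcases hs.1.eq_or_lt with rfl | hs0
    · refine (hin x hx).trans ?_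
      rw [sub_zero, mul_one]
      gcongr
      norm_num
    · exact h.abs_le_of_left hτ (E := fun s => B / 2 * Real.exp (lam * x + μ * (1 - s)))
        (by fun_prop) hx.1 ⟨hs0, hs.2⟩ (hgen x hx)
  obtain ⟨B, -, hB⟩ := exists_div_two_pow hbase hstep
  exact eq_zero_of_abs_le_div_two_pow fun n => hB n t ⟨ht, le_rfl⟩ z hz

end IsHomogeneous

section Uniqueness

variable {g p : ℝ → ℝ} {f k : ℝ → ℝ → ℝ} {τ : ℕ → ℝ} {y₀ : ℝ → ℝ} {y y' : ℝ → ℝ → ℝ}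

theorem IsSampledSolution.intervalIntegrable_mul {τ u : ℕ → ℝ}
    (h : IsSampledSolution g p f τ u y₀ y) {t a : ℝ} {P : ℝ → ℝ} (ht : 0 ≤ t)
    (ha : a ∈ Icc (0 : ℝ) 1) (hP : ContinuousOn P (Icc 0 1)) :
    IntervalIntegrable (fun s => P s * y t s) volume a 1 := by
  have hs : uIcc a 1 ⊆ Icc 0 1 := by
    rw [uIcc_of_le ha.2]
    exact Icc_subset_Icc_left ha.1
  exact (((h.piecewise_z t ht).intervalIntegrable zero_le_one).mono_set
    (by rwa [uIcc_of_le zero_le_one])).continuousOn_mul (hP.mono hs)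

theorem exists_index {τ : ℕ → ℝ} (hτ0 : τ 0 = 0) (hτt : Tendsto τ atTop atTop) {t : ℝ}
    (ht : 0 ≤ t) : ∃ i, t ∈ Ico (τ i) (τ (i + 1)) := by
  classical
  have hex : ∃ n, t < τ n := (hτt.eventually_gt_atTop t).exists
  obtain ⟨i, hi⟩ : ∃ i, Nat.find hex = i + 1 := Nat.exists_eq_succ_of_ne_zero fun h0 => by
    have := Nat.find_spec hex
    rw [h0, hτ0] at this
    linarith
  exact ⟨i, not_lt.1 (Nat.find_min hex (by omega)), hi ▸ Nat.find_spec hex⟩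

/-- The constant a bounds the right-hand side of the equation through g and f; q bounds the inlet
value, which involves the state at t through p and at the last sampling instant through p + k(0,·).
-/
theorem IsClosedLoopSolution.isHomogeneous_sub (hg : ContinuousOn g (Icc 0 1))
    (hp : ContinuousOn p (Icc 0 1)) (hk : ContinuousOn (k 0) (Icc 0 1))
    (hf : ContinuousOn (fun q : ℝ × ℝ => f q.1 q.2) (Icc 0 1 ×ˢ Icc 0 1))
    (hτ0 : τ 0 = 0) (hτ : Monotone τ) (hτt : Tendsto τ atTop atTop)
    (h : IsClosedLoopSolution g p f k τ y₀ y) (h' : IsClosedLoopSolution g p f k τ y₀ y') :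
    ∃ a q, 0 ≤ a ∧ 0 ≤ q ∧ IsHomogeneous τ a q fun t z => y t z - y' t z := by
  obtain ⟨cg, hcg⟩ := isCompact_Icc.exists_bound_of_continuousOn hg
  obtain ⟨cf, hcf⟩ := (isCompact_Icc.prod isCompact_Icc).exists_bound_of_continuousOn hf
  obtain ⟨cp, hcp⟩ := isCompact_Icc.exists_bound_of_continuousOn hp
  obtain ⟨cu, hcu⟩ := isCompact_Icc.exists_bound_of_continuousOn (hp.add hk)
  have hcg0 : 0 ≤ cg := (norm_nonneg _).trans (hcg 0 (by simp))
  have hcf0 : 0 ≤ cf := (norm_nonneg _).trans (hcf (0, 0) (by simp))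
  have hcp0 : 0 ≤ cp := (norm_nonneg _).trans (hcp 0 (by simp))
  have hcu0 : 0 ≤ cu := (norm_nonneg _).trans (hcu 0 (by simp))
  have hder : ∀ c z, IsGeneric τ c → z ∈ Ioo (max 0 (-c)) 1 → (∀ i, c + z ≠ 1 + τ i) →
      HasDerivAt (fun x => y (c + x) x - y' (c + x) x)
        ((partialT y (c + z) z + partialZ y (c + z) z) -
          (partialT y' (c + z) z + partialZ y' (c + z) z)) z := fun c z hc hz hne =>
    (IsSampledSolution.hasDerivAt_char h hτt hc hz hne).sub
      (IsSampledSolution.hasDerivAt_char h' hτt hc hz hne)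
  refine ⟨cg + cf, cu + cp, by positivity, by positivity, ?_, ?_, ?_, ?_, ?_, ?_, ?_, ?_⟩
  · exact fun t ht z hz => (h.left_cont_z t ht z hz).sub (h'.left_cont_z t ht z hz)
  · exact fun c hc => (IsSampledSolution.continuousOn_char h hc).sub
      (IsSampledSolution.continuousOn_char h' hc)
  · exact fun c z hc hz hne => (hder c z hc hz hne).differentiableAt
  · intro c z m hc hz hne hm
    have hq := IsSampledSolution.mem_regRegion hc hz hne
    have hz' : z ∈ Icc (0 : ℝ) 1 := hq.2.1
    have hfz : ContinuousOn (f z) (Icc 0 1) :=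
      hf.comp (f := fun s : ℝ => (z, s)) (by fun_prop) fun s hs => ⟨hz', hs⟩
    rw [(hder c z hc hz hne).deriv, h.pde _ _ hq, h'.pde _ _ hq, add_sub_add_comm, ← mul_sub,
      ← intervalIntegral.integral_sub
        (IsSampledSolution.intervalIntegrable_mul h hq.1 hz' hfz)
        (IsSampledSolution.intervalIntegrable_mul h' hq.1 hz' hfz), add_mul]
    have hm0 : 0 ≤ m := (abs_nonneg _).trans (hm 0 (by simp))
    refine (abs_add_le _ _).trans (add_le_add ?_ ?_)
    · rw [abs_mul]
      exact mul_le_mul (hcg z hz') (hm 1 (by simp)) (abs_nonneg _) hcg0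
    · have := intervalIntegral.norm_integral_le_of_norm_le_const (a := z) (b := 1) (C := cf * m)
        (f := fun s => f z s * y (c + z) s - f z s * y' (c + z) s) fun s hs => by
          rw [uIoc_of_le hz'.2] at hs
          have hs' : s ∈ Icc (0 : ℝ) 1 := ⟨hz'.1.trans hs.1.le, hs.2⟩
          rw [← mul_sub, norm_mul]
          exact mul_le_mul (hcf (z, s) ⟨hz', hs'⟩) (hm s hs') (norm_nonneg _) hcf0
      refine this.trans (mul_le_of_le_one_right (by positivity) ?_)
      rw [abs_of_nonneg (by linarith [hz'.2])]
      linarith [hz'.1]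
  · intro R
    obtain ⟨C, hC⟩ := h.bounded_partials (max R 1) (by positivity)
    obtain ⟨C', hC'⟩ := h'.bounded_partials (max R 1) (by positivity)
    refine ⟨C + C + (C' + C'), fun c z hc hz hne hR => ?_⟩
    have hq := IsSampledSolution.mem_regRegion hc hz hne
    rw [(hder c z hc hz hne).deriv]
    have b := hC _ _ hq (hR.trans (le_max_left _ _))
    have b' := hC' _ _ hq (hR.trans (le_max_left _ _))
    exact (abs_sub _ _).trans (add_le_add ((abs_add_le _ _).trans (add_le_add b.1 b.2))
      ((abs_add_le _ _).trans (add_le_add b'.1 b'.2)))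
  · intro R
    obtain ⟨M, hM⟩ := (h.piecewise_t 0 (by simp)).exists_bound
      (K := Icc 0 R) Icc_subset_Ici_self isCompact_Icc
    obtain ⟨M', hM'⟩ := (h'.piecewise_t 0 (by simp)).exists_bound
      (K := Icc 0 R) Icc_subset_Ici_self isCompact_Icc
    exact ⟨M + M', fun t ht => (abs_sub _ _).trans (add_le_add (hM t ht) (hM' t ht))⟩
  · intro t ht
    obtain ⟨i, hi⟩ := exists_index hτ0 hτt ht
    have hi0 : 0 ≤ τ i := hτ0 ▸ hτ (Nat.zero_le i)
    refine ⟨τ i, ⟨hi0, hi.1⟩, fun m μ hm hμ hb => ?_⟩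
    have h0 : (0 : ℝ) ∈ Icc (0 : ℝ) 1 := by simp
    have hest : ∀ (P : ℝ → ℝ) C x, ContinuousOn P (Icc 0 1) → 0 ≤ C →
        (∀ s ∈ Icc (0 : ℝ) 1, ‖P s‖ ≤ C) → 0 ≤ x → (x = τ i ∨ x = t) →
        |(∫ s in (0 : ℝ)..1, P s * y x s) - ∫ s in (0 : ℝ)..1, P s * y' x s| ≤
          C * (m / μ * Real.exp μ) := fun P C x hP hC hPC hx hxx => by
      rw [← intervalIntegral.integral_sub
        (IsSampledSolution.intervalIntegrable_mul h hx h0 hP)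
        (IsSampledSolution.intervalIntegrable_mul h' hx h0 hP)]
      have := abs_integral_le_exp_sub (φ := fun s => P s * y x s - P s * y' x s) (r := 1)
        (M := C * m) hμ (by positivity) zero_le_one fun s hs => by
          rw [← mul_sub, abs_mul, mul_assoc]
          exact mul_le_mul (hPC s hs) (hb x hxx s hs) (abs_nonneg _) hC
      rwa [mul_one, mul_div_assoc, mul_assoc] at this
    rw [h.boundary i t hi, h'.boundary i t hi, feedbackInput, feedbackInput, sub_sub_sub_comm,
      add_mul]
    exact (abs_sub _ _).trans (add_le_add (hest _ cu _ (hp.add hk) hcu0 hcu hi0 (.inl rfl))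
      (hest _ cp _ hp hcp0 hcp ht (.inr rfl)))
  · exact fun z hz => by rw [h.initial z hz, h'.initial z hz, sub_self]

/-- Uniqueness of the solution of the closed loop. -/
theorem IsClosedLoopSolution.unique (hg : ContinuousOn g (Icc 0 1))
    (hp : ContinuousOn p (Icc 0 1)) (hk : ContinuousOn (k 0) (Icc 0 1))
    (hf : ContinuousOn (fun q : ℝ × ℝ => f q.1 q.2) (Icc 0 1 ×ˢ Icc 0 1))
    (hτ0 : τ 0 = 0) (hτ : Monotone τ) (hτt : Tendsto τ atTop atTop)
    (h : IsClosedLoopSolution g p f k τ y₀ y) (h' : IsClosedLoopSolution g p f k τ y₀ y')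
    {t z : ℝ} (ht : 0 ≤ t) (hz : z ∈ Icc (0 : ℝ) 1) : y t z = y' t z := by
  obtain ⟨a, q, ha, hq, hw⟩ := h.isHomogeneous_sub hg hp hk hf hτ0 hτ hτt h'
  exact sub_eq_zero.1 (hw.eq_zero hτt ha hq ht hz)

end Uniqueness

/-! ### Decay of the inlet values -/

/-- A delay inequality with contraction factor `γ` forces exponential decay. -/
theorem abs_le_exp_of_contraction {v : ℝ → ℝ} {R X σ T γ : ℝ} (hX : 0 ≤ X) (hσ : 0 ≤ σ)
    (hγ0 : 0 ≤ γ) (hγ : γ * Real.exp (σ * (1 + T)) < 1) (hist : ∀ s ∈ Ico (-1) 0, |v s| ≤ X)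
    {M : ℝ} (hM : ∀ s ∈ Ico (-1) R, |v s| ≤ M)
    (hc : ∀ t ∈ Ico 0 R, ∃ θ ∈ Icc (t - T) t, 0 ≤ θ ∧
      ∀ N, (∀ s ∈ Icc (θ - 1) t, |v s| ≤ N) → |v t| ≤ γ * N) :
    ∀ t ∈ Ico (-1) R, |v t| ≤ X * Real.exp (-σ * t) := by
  -- The window [θ-1, t] reaches back by at most 1 + T, over which e^{-σs} grows by e^{σ(1+T)}; ρ is
  -- the contraction factor in this weight.
  set ρ := γ * Real.exp (σ * (1 + T)) with hρ
  have hρ0 : 0 ≤ ρ := by positivity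
  have hneg : ∀ A, 0 ≤ A → ∀ s ∈ Ico (-1 : ℝ) 0, X + A ≤ (X + A) * Real.exp (-σ * s) :=
    fun A hA s hs => le_mul_of_one_le_right (by positivity) (Real.one_le_exp (by
      rw [neg_mul, ← mul_neg]
      exact mul_nonneg hσ (by linarith [hs.2])))
  have hbase : ∀ s ∈ Ico (-1) R, |v s| ≤ (X + |M| * Real.exp (σ * |R|)) * Real.exp (-σ * s) :=
    fun s hs => by
      refine ((hM s hs).trans (le_abs_self M)).trans ?_
      rw [add_mul, mul_assoc, ← Real.exp_add]
      have h1 : |M| ≤ |M| * Real.exp (σ * |R| + -σ * s) :=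
        le_mul_of_one_le_right (abs_nonneg M) (Real.one_le_exp (by
          have := mul_le_mul_of_nonneg_left (hs.2.le.trans (le_abs_self R)) hσ
          linarith))
      have : 0 ≤ X * Real.exp (-σ * s) := by positivity
      linarith
  -- Each pass through the inequality shrinks the excess over X by ρ, so the crude bound M and the
  -- horizon R disappear in the limit.
  have hind : ∀ n : ℕ, ∀ s ∈ Ico (-1) R,
      |v s| ≤ (X + ρ ^ n * (|M| * Real.exp (σ * |R|))) * Real.exp (-σ * s) := by
    intro n
    induction n with
    | zero => simpa using hbase
    | succ n ih =>
      intro t ht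
      set A := |M| * Real.exp (σ * |R|) with hA
      have hA0 : 0 ≤ A := by positivity
      rcases lt_or_ge t 0 with h0 | h0
      · refine (hist t ⟨ht.1, h0⟩).trans (le_trans ?_ (hneg _ (by positivity) t ⟨ht.1, h0⟩))
        exact le_add_of_nonneg_right (by positivity)
      · obtain ⟨θ, hθ, hθ0, hN⟩ := hc t ⟨h0, ht.2⟩
        refine (hN ((X + ρ ^ n * A) * Real.exp (-σ * (t - T - 1))) fun s hs => ?_).trans ?_
        · refine (ih s ⟨by linarith [hs.1], hs.2.trans_lt ht.2⟩).trans ?_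
          refine mul_le_mul_of_nonneg_left (Real.exp_le_exp.2 ?_) (by positivity)
          have := mul_le_mul_of_nonneg_left (show t - T - 1 ≤ s by linarith [hs.1, hθ.1]) hσ
          linarith
        · have e : γ * ((X + ρ ^ n * A) * Real.exp (-σ * (t - T - 1))) =
              ρ * (X + ρ ^ n * A) * Real.exp (-σ * t) := by
            rw [hρ, show -σ * (t - T - 1) = σ * (1 + T) + -σ * t by ring, Real.exp_add]
            ring
          rw [e]
          refine mul_le_mul_of_nonneg_right ?_ (Real.exp_pos _).le
          rw [mul_add, pow_succ']
          have := mul_le_of_le_one_left hX hγ.le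
          linarith
  intro t ht
  have hlim : Tendsto (fun n : ℕ =>
      (X + ρ ^ n * (|M| * Real.exp (σ * |R|))) * Real.exp (-σ * t)) atTop
      (𝓝 ((X + 0 * (|M| * Real.exp (σ * |R|))) * Real.exp (-σ * t))) :=
    (((tendsto_pow_atTop_nhds_zero_of_lt_one hρ0 hγ).mul_const _).const_add _).mul_const _
  rw [zero_mul, add_zero] at hlim
  exact ge_of_tendsto' hlim fun n => hind n t ht

/-- One sampling interval of the loop with gain `κ` contracts by the factor `γ`. -/
def IsContraction (κ : ℝ → ℝ) (T γ : ℝ) : Prop :=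
  ∀ (v : ℝ → ℝ) (C : Set ℝ), PiecewiseCont v C → ∀ θ t, θ ≤ t → t ≤ θ + T →
    (∀ x ∈ Icc θ t, v x + ∫ s in (0 : ℝ)..1, κ s * v (x - s) =
      ∫ s in (0 : ℝ)..1, κ s * v (θ - s)) →
    ∀ N, (∀ s ∈ Icc (θ - 1) t, |v s| ≤ N) → |v t| ≤ γ * N

theorem integral_mul_comp_sub_eq (κ v : ℝ → ℝ) (t : ℝ) :
    ∫ s in (0 : ℝ)..1, κ s * v (t - s) = ∫ r in (t - 1)..t, κ (t - r) * v r := by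
  have := intervalIntegral.integral_comp_sub_left (a := 0) (b := 1) (fun r => κ (t - r) * v r) t
  simpa using this

/-- v(t) is a difference of two moving averages with windows [θ-1, θ] and [t-1, t]. On the union the
weights differ little by uniform continuity, and the two surplus intervals have length t - θ ≤ T.
The choice of T gives 2·ε/4 for the first effect and 2cT ≤ ε/2 for the second. -/
theorem exists_isContraction {κ : ℝ → ℝ} (hκ : Continuous κ) (ε : ℝ) (hε : 0 < ε) :
    ∃ T, 0 < T ∧ T ≤ 1 ∧ IsContraction κ T ε := by
  obtain ⟨c, hc⟩ := (isCompact_Icc (a := (-1 : ℝ)) (b := 2)).exists_bound_of_continuousOn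
    hκ.continuousOn
  have hc0 : 0 ≤ c := (norm_nonneg _).trans (hc 0 (by norm_num))
  have hu := isCompact_Icc.uniformContinuousOn_of_continuous
    (hκ.continuousOn (s := Icc (-1 : ℝ) 2))
  obtain ⟨δ, hδ, hδε⟩ := Metric.uniformContinuousOn_iff.1 hu (ε / 4) (by positivity)
  have hT1 : min (min (δ / 2) 1) (ε / (4 * (c + 1))) ≤ 1 :=
    (min_le_left _ _).trans (min_le_right _ _)
  have hTδ : min (min (δ / 2) 1) (ε / (4 * (c + 1))) ≤ δ / 2 :=
    (min_le_left _ _).trans (min_le_left _ _)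
  have hTc : min (min (δ / 2) 1) (ε / (4 * (c + 1))) * (4 * (c + 1)) ≤ ε :=
    (le_div_iff₀ (by positivity)).1 (min_le_right _ _)
  have hT0 : 0 < min (min (δ / 2) 1) (ε / (4 * (c + 1))) := by positivity
  generalize min (min (δ / 2) 1) (ε / (4 * (c + 1))) = T at hT1 hTδ hTc hT0
  refine ⟨T, hT0, hT1, fun v C hv θ t hθt htT hloop N hN => ?_⟩
  have hN0 : 0 ≤ N := (abs_nonneg _).trans (hN t ⟨by linarith, le_rfl⟩)
  have hvi : ∀ x a b, IntervalIntegrable (fun r => κ (x - r) * v r) volume a b := fun x a b =>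
    (hv.intervalIntegrable a b).continuousOn_mul (hκ.comp (by fun_prop)).continuousOn
  have e := hloop t ⟨hθt, le_rfl⟩
  rw [integral_mul_comp_sub_eq, integral_mul_comp_sub_eq,
    ← intervalIntegral.integral_add_adjacent_intervals (hvi θ (θ - 1) t) (hvi θ t θ),
    intervalIntegral.integral_symm θ t] at e
  have e2 := intervalIntegral.integral_add_adjacent_intervals (hvi t (θ - 1) (t - 1))
    (hvi t (t - 1) t)
  have e3 := intervalIntegral.integral_sub (hvi θ (θ - 1) t) (hvi t (θ - 1) t)
  have b1 := intervalIntegral.norm_integral_le_of_norm_le_const (a := θ - 1) (b := t)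
    (C := ε / 4 * N) (f := fun r => κ (θ - r) * v r - κ (t - r) * v r) fun r hr => by
      rw [uIoc_of_le (by linarith)] at hr
      rw [← sub_mul, norm_mul]
      refine mul_le_mul ?_ (hN r ⟨hr.1.le, hr.2⟩) (norm_nonneg _) (by positivity)
      rw [← dist_eq_norm]
      refine (hδε _ ⟨by linarith [hr.2], by linarith [hr.1]⟩ _
        ⟨by linarith [hr.2], by linarith [hr.1]⟩ ?_).le
      rw [dist_comm, Real.dist_eq, sub_sub_sub_cancel_right, abs_of_nonneg (by linarith)]
      linarith
  have b2 := intervalIntegral.norm_integral_le_of_norm_le_const (a := θ) (b := t)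
    (C := c * N) (f := fun r => κ (θ - r) * v r) fun r hr => by
      rw [uIoc_of_le hθt] at hr
      rw [norm_mul]
      exact mul_le_mul (hc _ ⟨by linarith [hr.2], by linarith [hr.1]⟩)
        (hN r ⟨by linarith [hr.1], hr.2⟩) (norm_nonneg _) hc0
  have b3 := intervalIntegral.norm_integral_le_of_norm_le_const (a := θ - 1) (b := t - 1)
    (C := c * N) (f := fun r => κ (t - r) * v r) fun r hr => by
      rw [uIoc_of_le (by linarith)] at hr
      rw [norm_mul]
      exact mul_le_mul (hc _ ⟨by linarith [hr.2], by linarith [hr.1]⟩)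
        (hN r ⟨by linarith [hr.1], by linarith [hr.2]⟩) (norm_nonneg _) hc0
  have hsum : v t = (∫ r in (θ - 1)..t, κ (θ - r) * v r - κ (t - r) * v r) -
      (∫ r in θ..t, κ (θ - r) * v r) + ∫ r in (θ - 1)..(t - 1), κ (t - r) * v r := by
    rw [e3]
    linarith
  have h1 : |t - (θ - 1)| ≤ 2 := by rw [abs_of_nonneg (by linarith)]; linarith
  have h2 : |t - θ| ≤ T := by rw [abs_of_nonneg (by linarith)]; linarith
  have h3 : |t - 1 - (θ - 1)| ≤ T := by rw [abs_of_nonneg (by linarith)]; linarith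
  have b1' := b1.trans (mul_le_mul_of_nonneg_left h1 (by positivity))
  have b2' := b2.trans (mul_le_mul_of_nonneg_left h2 (by positivity))
  have b3' := b3.trans (mul_le_mul_of_nonneg_left h3 (by positivity))
  rw [hsum]
  refine (abs_add_le _ _).trans ((add_le_add ((abs_sub _ _).trans (add_le_add b1' b2')) b3').trans ?_)
  have h4 := mul_le_mul_of_nonneg_right hTc hN0
  have h5 : 0 ≤ T * N := by positivity
  linarith

theorem expIntegral_eq (a t : ℝ) : expIntegral a t = ∫ s in (0 : ℝ)..t, Real.exp (-a * s) := by
  have := intervalIntegral.integral_comp_sub_left (a := 0) (b := t)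
    (fun s => Real.exp (-a * s)) t
  simpa [expIntegral] using this

theorem expIntegral_mono (a : ℝ) {s t : ℝ} (hs : 0 ≤ s) (hst : s ≤ t) :
    expIntegral a s ≤ expIntegral a t := by
  rw [expIntegral_eq, expIntegral_eq]
  exact intervalIntegral.integral_mono_interval le_rfl hs hst
    (.of_forall fun _ => (Real.exp_pos _).le) (Continuous.intervalIntegrable (by fun_prop) _ _)

/-- After s = h + r the increment h sits in κ and in the limits, not in v, so v need only be
continuous at t and t - 1. The result is a difference of two instances of
`SmoothKernel.hasDerivAt_shift`. -/
theorem hasDerivAt_integral_mul_comp_sub {κ κ' v : ℝ → ℝ} {C : Set ℝ} (hκ' : Continuous κ')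
    (hκ : ∀ x, HasDerivAt κ (κ' x) x) (hv : PiecewiseCont v C) {t : ℝ} (ht : t ∉ C)
    (ht1 : t - 1 ∉ C) :
    HasDerivAt (fun x => ∫ s in (0 : ℝ)..1, κ s * v (x - s))
      (κ 0 * v t - κ 1 * v (t - 1) + ∫ s in (0 : ℝ)..1, κ' s * v (t - s)) t := by
  have cκ : Continuous κ := continuous_iff_continuousAt.2 fun x => (hκ x).continuousAt
  have hS : SmoothKernel (fun z r => κ (z + r)) (fun z r => κ' (z + r)) :=
    ⟨by fun_prop, by fun_prop, fun z r => (hκ (z + r)).comp_add_const z r⟩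
  have h1 := (hS.hasDerivAt_shift hv 0 1 t ht1).sub
    (hS.hasDerivAt_shift hv 0 0 t (by rwa [sub_zero]))
  have h2 : HasDerivAt (fun h => ∫ s in (0 : ℝ)..1, κ s * v (t + h - s))
      (κ 0 * v t - κ 1 * v (t - 1) + ∫ s in (0 : ℝ)..1, κ' s * v (t - s)) 0 := by
    have hi : ∀ h a b, IntervalIntegrable (fun r => κ (h + r) * v (t - r)) volume a b :=
      fun h a b => hv.intervalIntegrable_mul_comp_sub (κ := fun r => κ (h + r)) (by fun_prop) t a b
    refine (h1.congr_deriv ?_).congr_of_eventuallyEq (.of_forall fun h => ?_)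
    · simp
      ring
    · have := intervalIntegral.integral_comp_add_left (a := -h) (b := 1 - h)
        (fun s => κ s * v (t + h - s)) h
      simp only [add_neg_cancel, add_sub_cancel] at this
      simp only [zero_add, zero_sub]
      rw [← this, Pi.sub_apply, intervalIntegral.integral_interval_sub_left (hi _ _ _) (hi _ _ _)]
      refine intervalIntegral.integral_congr fun r _ => ?_
      rw [show t + h - (h + r) = t - r by ring]
  have h3 := HasDerivAt.comp_sub_const (x := t) (a := t) (by rwa [sub_self])
    (f := fun h => ∫ s in (0 : ℝ)..1, κ s * v (t + h - s))
  simpa using h3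

/-- Differentiating the delay equation gives v' + a v = κ(1) v(x-1) - ∫ κ'(s) v(x-s) ds with a =
κ(0). The right-hand side is at most M N, and variation of constants from θ yields M N p_a(t-θ). -/
theorem isContraction_of_contDiffOn {κ : ℝ → ℝ} (hκ : ContDiffOn ℝ 1 κ (Icc 0 1)) {T : ℝ} :
    IsContraction κ T (gainM κ * expIntegral (κ 0) T) := by
  intro v C hv θ t hθt htT hloop N hN
  obtain ⟨Φ, Φ', hΦ', hΦ, -, hΦκ⟩ := exists_contDiff_extension one_pos hκ
  have cΦ : Continuous Φ := continuous_iff_continuousAt.2 fun x => (hΦ x).continuousAt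
  have hN0 : 0 ≤ N := (abs_nonneg _).trans (hN t ⟨by linarith, le_rfl⟩)
  have e1 : ∀ x, ∫ s in (0 : ℝ)..1, κ s * v (x - s) = ∫ s in (0 : ℝ)..1, Φ s * v (x - s) :=
    fun x => intervalIntegral.integral_congr fun s hs => by
      rw [uIcc_of_le zero_le_one] at hs
      rw [hΦκ s hs]
  have e2 : gainM κ = |Φ 1| + ∫ s in (0 : ℝ)..1, |Φ' s| := by
    rw [gainM, hΦκ 1 (by simp)]
    congr 1
    refine intervalIntegral.integral_congr fun s hs => ?_
    rw [uIcc_of_le zero_le_one] at hs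
    rw [((hΦ s).hasDerivWithinAt.congr (fun x hx => (hΦκ x hx).symm)
      (hΦκ s hs).symm).derivWithin (uniqueDiffOn_Icc one_pos s hs)]
  have hG0 : 0 ≤ gainM κ := by
    rw [e2]
    exact add_nonneg (abs_nonneg _) (intervalIntegral.integral_nonneg zero_le_one
      fun _ _ => abs_nonneg _)
  rw [← hΦκ 0 (by simp)]
  simp only [e1] at hloop
  set c := ∫ s in (0 : ℝ)..1, Φ s * v (θ - s) with hc
  -- This is e^{ax} v(x) on [θ, t], written through the convolution so that it is continuous
  -- everywhere, including at jumps of v.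
  set F : ℝ → ℝ := fun x => Real.exp (Φ 0 * x) * (c - ∫ s in (0 : ℝ)..1, Φ s * v (x - s)) with hF
  have hFv : ∀ x ∈ Icc θ t, F x = Real.exp (Φ 0 * x) * v x := fun x hx => by
    simp only [hF]
    rw [← hloop x hx]
    ring
  have hFc : Continuous F := by
    have := (continuous_conv hv (G := fun _ r => Φ r) (by fun_prop)).comp
      (f := fun x : ℝ => (x, (0 : ℝ), (1 : ℝ))) (by fun_prop)
    exact (by fun_prop : Continuous fun x => Real.exp (Φ 0 * x)).mul (continuous_const.sub this)
  have key := abs_sub_le_integral (F := F)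
    (F' := fun x => Real.exp (Φ 0 * x) * (Φ 1 * v (x - 1) - ∫ s in (0 : ℝ)..1, Φ' s * v (x - s)))
    (E := fun x => gainM κ * N * Real.exp (Φ 0 * x)) (S := C ∪ (fun x => x + 1) '' C) hθt
    (hv.fin.countable.union (hv.fin.image _).countable) hFc.continuousOn (by fun_prop)
    (fun x hx => ?_) fun x hx => ?_
  -- At the sampling instant the delay equation reads v(θ) = 0, so no initial term appears.
  · have ht0 : F θ = 0 := by
      simp only [hF, hc, sub_self, mul_zero]
    rw [ht0, sub_zero, hFv t ⟨hθt, le_rfl⟩, abs_mul, abs_of_pos (Real.exp_pos _),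
      intervalIntegral.integral_const_mul] at key
    have e3 : ∫ x in θ..t, Real.exp (Φ 0 * x) =
        Real.exp (Φ 0 * t) * expIntegral (Φ 0) (t - θ) := by
      have := intervalIntegral.integral_comp_sub_left (a := 0) (b := t - θ)
        (fun x => Real.exp (Φ 0 * x)) t
      rw [sub_sub_cancel, sub_zero] at this
      rw [← this, expIntegral_eq, ← intervalIntegral.integral_const_mul]
      refine intervalIntegral.integral_congr fun s _ => ?_
      rw [← Real.exp_add]
      congr 1
      ring
    rw [e3, mul_left_comm] at key
    have h1 := le_of_mul_le_mul_left key (Real.exp_pos _)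
    refine h1.trans ?_
    have h2 := mul_le_mul_of_nonneg_left (expIntegral_mono (Φ 0) (sub_nonneg.2 hθt)
      (by linarith : t - θ ≤ T)) (mul_nonneg hG0 hN0)
    linarith
  · have hx1 : x ∉ C := fun h => hx.2 (.inl h)
    have hx2 : x - 1 ∉ C := fun h => hx.2 (.inr ⟨_, h, sub_add_cancel x 1⟩)
    have hd := (hasDerivAt_integral_mul_comp_sub hΦ' hΦ hv hx1 hx2).const_sub c
    have he : HasDerivAt (fun x => Real.exp (Φ 0 * x)) (Real.exp (Φ 0 * x) * (Φ 0 * 1)) x :=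
      ((hasDerivAt_id x).const_mul (Φ 0)).exp
    refine (he.mul hd).congr_deriv ?_
    rw [← hloop x (Ioo_subset_Icc_self hx.1)]
    ring
  · rw [abs_mul, abs_of_pos (Real.exp_pos _), mul_comm]
    refine mul_le_mul_of_nonneg_right ?_ (Real.exp_pos _).le
    rw [e2, add_mul]
    refine (abs_sub _ _).trans (add_le_add ?_ ?_)
    · rw [abs_mul]
      exact mul_le_mul_of_nonneg_left (hN _ ⟨by linarith [hx.1.1], by linarith [hx.1.2]⟩)
        (abs_nonneg _)
    · rw [← intervalIntegral.integral_mul_const]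
      have hi : IntervalIntegrable (fun s => |Φ' s| * N) volume 0 1 :=
        Continuous.intervalIntegrable (by fun_prop) _ _
      refine intervalIntegral.norm_integral_le_of_norm_le (f := fun s => Φ' s * v (x - s))
        zero_le_one (.of_forall fun s hs => ?_) hi
      rw [norm_mul]
      exact mul_le_mul_of_nonneg_left (hN _ ⟨by linarith [hx.1.1, hs.2], by linarith [hx.1.2, hs.1]⟩)
        (abs_nonneg _)

/-! ### From decay of the inlet values to stabilization -/

section Stabilization

variable {g p : ℝ → ℝ} {f k l L L' K K' : ℝ → ℝ → ℝ}

theorem abs_le_supNorm {w : ℝ → ℝ} (hw : ContinuousOn w (Icc 0 1)) {z : ℝ}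
    (hz : z ∈ Icc (0 : ℝ) 1) : |w z| ≤ supNorm w :=
  le_csSup (isCompact_Icc.image_of_continuousOn hw.abs).bddAbove (mem_image_of_mem _ hz)

theorem exists_bound_of_continuous_kernel {A : ℝ → ℝ → ℝ}
    (hA : Continuous fun q : ℝ × ℝ => A q.1 q.2) :
    ∃ c, 0 ≤ c ∧ ∀ z ∈ Icc (0 : ℝ) 1, ∀ r ∈ Icc (0 : ℝ) 1, |A z r| ≤ c := by
  obtain ⟨c, hc⟩ := (isCompact_Icc (a := (0 : ℝ)) (b := 1)).prod
    (isCompact_Icc (a := (0 : ℝ)) (b := 1)) |>.exists_bound_of_continuousOn hA.continuousOn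
  exact ⟨c, (norm_nonneg _).trans (hc (0, 0) (by simp)), fun z hz r hr => hc (z, r) ⟨hz, hr⟩⟩

theorem abs_integral_kernel_le {A : ℝ → ℝ → ℝ} {c N z : ℝ} {φ : ℝ → ℝ}
    (hA : ∀ z ∈ Icc (0 : ℝ) 1, ∀ r ∈ Icc (0 : ℝ) 1, |A z r| ≤ c) (hc : 0 ≤ c) (hN : 0 ≤ N)
    (hz : z ∈ Icc (0 : ℝ) 1) (hφ : ∀ r ∈ Icc 0 (1 - z), |φ r| ≤ N) :
    |∫ r in (0 : ℝ)..1 - z, A z r * φ r| ≤ c * N := by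
  have h1 := intervalIntegral.norm_integral_le_of_norm_le_const (a := 0) (b := 1 - z)
    (C := c * N) (f := fun r => A z r * φ r) fun r hr => by
      rw [uIoc_of_le (by linarith [hz.2])] at hr
      rw [norm_mul]
      exact mul_le_mul (hA z hz r ⟨hr.1.le, by linarith [hr.2, hz.1]⟩) (hφ r ⟨hr.1.le, hr.2⟩)
        (norm_nonneg _) hc
  refine h1.trans (mul_le_of_le_one_right (by positivity) ?_)
  rw [abs_of_nonneg (by linarith [hz.2])]
  linarith [hz.1]

/-- Each factor of the constant has one source: 1 + cK bounds the transformed initial datum, e^σ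
accounts for the delay of at most 1 since y[t] uses v on [t-1, t], and 1 + cL bounds the inverse
transformation. None depends on the schedule or on the datum. -/
theorem InletRepresentation.abs_le_exp {τ : ℕ → ℝ} {y₀ : ℝ → ℝ} {v : ℕ → ℝ → ℝ} {y : ℝ → ℝ → ℝ}
    (h : InletRepresentation p L K τ y₀ v y) (hy : ContinuousOn y₀ (Icc 0 1)) {T γ σ cL cK : ℝ}
    (hτ : IsSchedule τ T) (hcon : IsContraction (gainExt p L) T γ) (hσ : 0 ≤ σ) (hγ0 : 0 ≤ γ)
    (hγ : γ * Real.exp (σ * (1 + T)) < 1)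
    (hcL : ∀ z ∈ Icc (0 : ℝ) 1, ∀ r ∈ Icc (0 : ℝ) 1, |L z r| ≤ cL) (hcL0 : 0 ≤ cL)
    (hcK : ∀ z ∈ Icc (0 : ℝ) 1, ∀ r ∈ Icc (0 : ℝ) 1, |K z r| ≤ cK) (hcK0 : 0 ≤ cK) {t z : ℝ}
    (ht : 0 ≤ t) (hz : z ∈ Icc (0 : ℝ) 1) :
    |y t z| ≤ (1 + cL) * (1 + cK) * Real.exp σ * Real.exp (-σ * t) * supNorm y₀ := by
  obtain ⟨n, hn⟩ := (hτ.unbounded.eventually_gt_atTop t).exists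
  obtain ⟨C, hC⟩ := h.piecewise n
  have hY0 : 0 ≤ supNorm y₀ := (abs_nonneg _).trans (abs_le_supNorm hy hz)
  have hist : ∀ s ∈ Ico (-1 : ℝ) 0, |v n s| ≤ (1 + cK) * supNorm y₀ := fun s hs => by
    have hs' : -s ∈ Ioc (0 : ℝ) 1 := ⟨by linarith [hs.2], by linarith [hs.1]⟩
    have := h.history n (-s) hs'
    rw [neg_neg] at this
    rw [this, add_mul, one_mul]
    refine (abs_sub _ _).trans (add_le_add (abs_le_supNorm hy (Ioc_subset_Icc_self hs'))
      (abs_integral_kernel_le (φ := fun r => y₀ (-s + r)) hcK hcK0 hY0 (Ioc_subset_Icc_self hs')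
        fun r hr => abs_le_supNorm hy ⟨by linarith [hr.1, hs.2], by linarith [hr.2]⟩))
  obtain ⟨M, hM⟩ := hC.bdd (1 + |τ n|)
  have hdec := abs_le_exp_of_contraction (v := v n) (R := τ n) (by positivity) hσ hγ0 hγ hist
    (M := M) (fun s hs => hM s (abs_le.2 ⟨by linarith [hs.1, abs_nonneg (τ n)],
      by linarith [hs.2, le_abs_self (τ n)]⟩)) fun x hx => by
      obtain ⟨i, hi⟩ := exists_index hτ.zero hτ.unbounded hx.1
      have hi0 : 0 ≤ τ i := hτ.zero ▸ hτ.strictMono.monotone (Nat.zero_le i)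
      have hin : i < n := hτ.strictMono.lt_iff_lt.1 (hi.1.trans_lt hx.2)
      exact ⟨τ i, ⟨by linarith [hτ.gap i, hi.2], hi.1⟩, hi0, hcon (v n) C hC (τ i) x hi.1
        (by linarith [hτ.gap i, hi.2]) fun r hr => h.closed_loop n i r hin ⟨hr.1, hr.2.trans_lt hi.2⟩⟩
  have hv : ∀ s ∈ Icc (t - 1) t,
      |v n s| ≤ (1 + cK) * supNorm y₀ * (Real.exp σ * Real.exp (-σ * t)) := fun s hs => by
    refine (hdec s ⟨by linarith [hs.1], hs.2.trans_lt hn⟩).trans ?_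
    rw [← Real.exp_add]
    refine mul_le_mul_of_nonneg_left (Real.exp_le_exp.2 ?_) (by positivity)
    have := mul_le_mul_of_nonneg_left hs.1 hσ
    linarith
  rw [h.eq n t z hn hz, charSolution,
    show (1 + cL) * (1 + cK) * Real.exp σ * Real.exp (-σ * t) * supNorm y₀ =
      (1 + cK) * supNorm y₀ * (Real.exp σ * Real.exp (-σ * t)) +
      cL * ((1 + cK) * supNorm y₀ * (Real.exp σ * Real.exp (-σ * t))) by ring]
  exact (abs_add_le _ _).trans (add_le_add (hv _ ⟨by linarith [hz.2], by linarith [hz.1]⟩)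
    (abs_integral_kernel_le (φ := fun r => v n (t - z - r)) hcL hcL0 (by positivity) hz
      fun r hr => hv _ ⟨by linarith [hr.2], by linarith [hr.1, hz.1]⟩))

theorem KernelData.exists_expStabilized (h : KernelData g f L L' K K')
    (hg : ContinuousOn g (Icc 0 1)) (hp : ContinuousOn p (Icc 0 1))
    (hf : ContinuousOn (fun q : ℝ × ℝ => f q.1 q.2) (Icc 0 1 ×ˢ Icc 0 1))
    (hl : ∀ z r, 0 ≤ z → 0 ≤ r → z + r ≤ 1 → L z r = l z (z + r))
    (hk : ∀ z r, 0 ≤ z → 0 ≤ r → z + r ≤ 1 → K z r = k z (z + r)) {T γ σ : ℝ}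
    (hcon : IsContraction (gainExt p L) T γ) (hσ : 0 ≤ σ) (hγ0 : 0 ≤ γ)
    (hγ : γ * Real.exp (σ * (1 + T)) < 1) : ∃ G : ℝ, 0 < G ∧ ExpStabilized g p f k σ T G := by
  obtain ⟨cL, hcL0, hcL⟩ := exists_bound_of_continuous_kernel h.smooth_L.cont
  obtain ⟨cK, hcK0, hcK⟩ := exists_bound_of_continuous_kernel h.smooth_K.cont
  refine ⟨(1 + cL) * (1 + cK) * Real.exp σ, by positivity, fun y₀ τ hy hτ => ?_⟩
  obtain ⟨y, v, hsol, hrep⟩ := h.exists_closedLoopSolution hp hf hl hk hy hτ.strictMono hτ.zero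
    hτ.unbounded
  have hk0 : ContinuousOn (k 0) (Icc 0 1) := by
    have : Continuous (K 0) := h.smooth_K.cont.comp (f := fun s : ℝ => (0, s)) (by fun_prop)
    refine this.continuousOn.congr fun s hs => ?_
    rw [hk 0 s le_rfl hs.1 (by linarith [hs.2]), zero_add]
  exact ⟨y, hsol, fun y' hy' t ht z hz => hy'.unique hg hp hk0 hf hτ.zero hτ.strictMono.monotone
    hτ.unbounded hsol ht hz, fun t ht z hz => hrep.abs_le_exp hy.continuousOn hτ hcon hσ hγ0 hγ
    hcL hcL0 hcK hcK0 ht hz⟩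

theorem IsContraction.congr {κ κ' : ℝ → ℝ} {T γ : ℝ} (h : IsContraction κ T γ)
    (he : ∀ s ∈ Icc (0 : ℝ) 1, κ s = κ' s) : IsContraction κ' T γ := by
  have e : ∀ (v : ℝ → ℝ) t, ∫ s in (0 : ℝ)..1, κ' s * v (t - s) =
      ∫ s in (0 : ℝ)..1, κ s * v (t - s) := fun v t =>
    intervalIntegral.integral_congr fun s hs => by
      rw [uIcc_of_le zero_le_one] at hs
      rw [he s hs]
  intro v C hv θ t h1 h2 h3
  simp only [e] at h3
  exact h v C hv θ t h1 h2 h3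

end Stabilization

theorem theorem2p1 (g p : ℝ → ℝ) (f : ℝ → ℝ → ℝ)
    (hg : ContinuousOn g (Set.Icc 0 1)) (hp : ContDiffOn ℝ 1 p (Set.Icc 0 1))
    (hf : ContinuousOn (fun q : ℝ × ℝ => f q.1 q.2) (Set.Icc 0 1 ×ˢ Set.Icc 0 1)) :
    (∃ k l : ℝ → ℝ → ℝ, IsKernelPair g f k l) ∧
    ∀ k l : ℝ → ℝ → ℝ, IsKernelPair g f k l →
      (∀ σ : ℝ, 0 < σ → ∃ T G : ℝ, 0 < T ∧ 0 < G ∧ ExpStabilized g p f k σ T G) ∧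
      (ContDiffOn ℝ 1 g (Set.Icc 0 1) →
        ContDiffOn ℝ 1 (fun q : ℝ × ℝ => f q.1 q.2) (Set.Icc 0 1 ×ˢ Set.Icc 0 1) →
        ContDiffOn ℝ 1 (kTilde p k l) (Set.Icc 0 1)) ∧
      (ContDiffOn ℝ 1 (kTilde p k l) (Set.Icc 0 1) →
        ∀ σ T : ℝ, 0 < σ → 0 < T →
          gainM (kTilde p k l) * expIntegral (kTilde p k l 0) T * Real.exp (σ * (1 + T)) < 1 →
          ∃ G : ℝ, 0 < G ∧ ExpStabilized g p f k σ T G) := by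
  refine ⟨exists_isKernelPair hg hf, fun k l hkl => ?_⟩
  obtain ⟨L, L', K, K', D, hl, hk⟩ := hkl.exists_kernelData hf
  have hpc := hp.continuousOn
  have hgain : ∀ s ∈ Icc (0 : ℝ) 1, kTilde p k l s = gainExt p L s := fun s hs =>
    D.kTilde_eq_gainExt hpc hl hk hs
  refine ⟨fun σ hσ => ?_, fun hg' hf' => (D.contDiffOn_gainExt hp hg' hf').congr hgain,
    fun hκ σ T hσ hT hlt => ?_⟩
  -- T ≤ 1 gives e^{σ(1+T)} ≤ e^{2σ}, so a contraction factor e^{-2σ}/2 leaves a product of at most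
  -- 1/2.
  · obtain ⟨T, hT, hT1, hcon⟩ := exists_isContraction (continuous_gainExt hpc D.smooth_L.cont)
      (Real.exp (-(2 * σ)) / 2) (by positivity)
    obtain ⟨G, hG, hstab⟩ := D.exists_expStabilized hg hpc hf hl hk hcon hσ.le (by positivity) (by
      have : Real.exp (σ * (1 + T)) ≤ Real.exp (2 * σ) := Real.exp_le_exp.2 (by
        have := mul_le_mul_of_nonneg_left hT1 hσ.le
        linarith)
      refine (mul_le_mul_of_nonneg_left this (by positivity)).trans_lt ?_
      rw [div_mul_eq_mul_div, ← Real.exp_add, neg_add_cancel, Real.exp_zero]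
      norm_num)
    exact ⟨T, G, hT, hG, hstab⟩
  · refine D.exists_expStabilized hg hpc hf hl hk
      ((isContraction_of_contDiffOn hκ (T := T)).congr hgain) hσ.le ?_ hlt
    refine mul_nonneg (add_nonneg (abs_nonneg _) (intervalIntegral.integral_nonneg zero_le_one
      fun _ _ => abs_nonneg _)) ?_
    rw [expIntegral_eq]
    exact intervalIntegral.integral_nonneg hT.le fun _ _ => (Real.exp_pos _).le
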